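/- **Theorem (optimal linear growth).** Let $n\ge 1$. There exists a constant $C>0$, depending only on the dimension $n$, such that the following holds. Let $\Omega\subset\mathbb{R}^n$ be a bounded domain, $m\ge 1$, $0<Q_{\min}\le Q_{\max}$, and let $Q:\Omega\to\mathbb{R}$ be Lebesgue measurable with $Q_{\min}\le Q\le Q_{\max}$ a.e. in $\Omega$. Let $\mathbf g\in H^1(\Omega;\mathbb{R}^m)$ with $g_i\ge 0$ a.e. for all $i$, and let $$\mathcal A=\{\mathbf v\in H^1(\Omega;\mathbb{R}^m):\ \mathbf v-\mathbf g\in H^1_0(\Omega;\mathbb{R}^m),\ v_i\ge 0 \text{ a.e. in }\Omega \text{ for } i=1,\dots,m\},$$ $$J(\mathbf v)=\int_\Omega\Bigl(\sum_{i=1}^m|\nabla v_i|^2+Q^2\chi_{\{|\mathbf v|>0\}}\Bigr)dx .$$ Call $\mathbf u\in\mathcal A$ an *absolute minimizer* if $J(\mathbf u)\le J(\mathbf v)$ for all $\mathbf v\in\mathcal A$, and a *local minimizer* if for some $\epsilon>0$ one has $J(\mathbf u)\le J(\mathbf v)$ for all $\mathbf v\in\mathcal A$ with $$\|\mathbf u-\mathbf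 v\|_{H^1(\Omega;\mathbb{R}^m)}+\|\chi_{\{|\mathbf u|>0\}}-\chi_{\{|\mathbf v|>0\}}\|_{L^1(\Omega)}<\epsilon .$$ Every absolute or local minimizer $\mathbf u$ has a version with $u_i(x)=\lim_{\rho\to0^+}\frac{1}{|B_\rho(x)|}\int_{B_\rho(x)}u_i\,dy$ for all $x\in\Omega$ and $i=1,\dots,m$. For this version: 1. If $\mathbf u$ is an absolute minimizer, then for every ball $B_r(x)\subset\subset\Omega$ with $\overline{B_r(x)}\cap\{|\mathbf u|=0\}\ne\emptyset$, each $u_i$ is integrable on $\partial B_r(x)$ and $$\frac{1}{\sigma(\partial B_r(x))}\int_{\partial B_r(x)}u_i\,d\sigma\le C\,Q_{\max}\,r\qquad\text{for } i=1,\dots,m,$$ where $\sigma$ denotes surface measure. 2. If $\mathbf u$ is a local minimizer, then there is $r_0>0$ (which may depend on $\mathbf u$) such that the same conclusion holds for every such ball with $r<r_0$. -/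

import Mathlib

open MeasureTheory Set Filter Topology
open scoped ContDiff

noncomputable section

/-- `G` is the weak gradient of the scalar function `f` on the open set `Ω`: for every test
function `φ ∈ C_c^∞(Ω)` and every coordinate `j`, `∫_Ω f ∂_j φ = - ∫_Ω G_j φ`. -/
def IsWeakGradient {n : ℕ} (Ω : Set (EuclideanSpace ℝ (Fin n)))
    (f : EuclideanSpace ℝ (Fin n) → ℝ)
    (G : EuclideanSpace ℝ (Fin n) → EuclideanSpace ℝ (Fin n)) : Prop :=
  ∀ φ : EuclideanSpace ℝ (Fin n) → ℝ,
    ContDiff ℝ ∞ φ → HasCompactSupport φ → tsupport φ ⊆ Ω →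
      ∀ j : Fin n, ∫ x in Ω, f x * gradient φ x j = - ∫ x in Ω, G x j * φ x

/-- An element of the Sobolev space `H¹(Ω; ℝᵐ)`: a square integrable function on `Ω` (its values
outside `Ω` play no role) together with its square integrable weak gradient; `grad i` is the weak
gradient of the `i`-th component. -/
structure SobolevH1 {n : ℕ} (Ω : Set (EuclideanSpace ℝ (Fin n))) (m : ℕ) where
  /-- a representative of the function -/
  toFun : EuclideanSpace ℝ (Fin n) → EuclideanSpace ℝ (Fin m)
  /-- representatives of the weak gradients of the components -/
  grad : Fin m → EuclideanSpace ℝ (Fin n) → EuclideanSpace ℝ (Fin n)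
  memLp_toFun : MemLp toFun 2 (volume.restrict Ω)
  memLp_grad : ∀ i, MemLp (grad i) 2 (volume.restrict Ω)
  isWeakGradient : ∀ i, IsWeakGradient Ω (fun x => toFun x i) (grad i)

namespace SobolevH1

variable {n m : ℕ} {Ω : Set (EuclideanSpace ℝ (Fin n))}

/-- `χ_{|u| > 0}`. -/
def posIndicator (u : SobolevH1 Ω m) : EuclideanSpace ℝ (Fin n) → ℝ :=
  indicator {x | 0 < ‖u.toFun x‖} (fun _ => 1)

/-- The functional `J(u) = ∫_Ω (|∇u|² + Q² χ_{|u| > 0})`, where `|∇u|² = ∑ᵢ |∇uᵢ|²`. -/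
def energy (Q : EuclideanSpace ℝ (Fin n) → ℝ) (u : SobolevH1 Ω m) : ℝ :=
  ∫ x in Ω, ((∑ i, ‖u.grad i x‖ ^ 2) + Q x ^ 2 * u.posIndicator x)

/-- `uᵢ ≥ 0` a.e. in `Ω` for every component. -/
def Nonneg (u : SobolevH1 Ω m) : Prop :=
  ∀ i, ∀ᵐ x ∂(volume.restrict Ω), 0 ≤ u.toFun x i

/-- `u = g` on `∂Ω` in the Sobolev sense, i.e. `u - g ∈ H¹₀(Ω; ℝᵐ)`, the closure of
`C_c^∞(Ω; ℝᵐ)` in `H¹(Ω; ℝᵐ)`. -/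
def EqOnBoundary (u g : SobolevH1 Ω m) : Prop :=
  ∀ ε > 0, ∃ φ : EuclideanSpace ℝ (Fin n) → EuclideanSpace ℝ (Fin m),
    ContDiff ℝ ∞ φ ∧ HasCompactSupport φ ∧ tsupport φ ⊆ Ω ∧
      ∫ x in Ω, (‖u.toFun x - g.toFun x - φ x‖ ^ 2 +
        ∑ i, ‖u.grad i x - g.grad i x - gradient (fun y => φ y i) x‖ ^ 2) < ε

/-- The admissible class `𝒜` for the boundary datum `g`. -/
def Admissible (g u : SobolevH1 Ω m) : Prop :=
  u.EqOnBoundary g ∧ u.Nonneg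

/-- The metric `d(u,v) = ‖u - v‖_{H¹(Ω)} + ‖χ_{|u| > 0} - χ_{|v| > 0}‖_{L¹(Ω)}`. -/
def dist (u v : SobolevH1 Ω m) : ℝ :=
  Real.sqrt (∫ x in Ω, (‖u.toFun x - v.toFun x‖ ^ 2 +
      ∑ i, ‖u.grad i x - v.grad i x‖ ^ 2)) +
    ∫ x in Ω, |u.posIndicator x - v.posIndicator x|

/-- `u` is an absolute minimizer of `J` for the boundary datum `g`. -/
def IsAbsoluteMinimizer (Q : EuclideanSpace ℝ (Fin n) → ℝ) (g u : SobolevH1 Ω m) : Prop :=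
  Admissible g u ∧ ∀ v : SobolevH1 Ω m, Admissible g v → energy Q u ≤ energy Q v

/-- `u` is a local minimizer of `J` for the boundary datum `g`. -/
def IsLocalMinimizer (Q : EuclideanSpace ℝ (Fin n) → ℝ) (g u : SobolevH1 Ω m) : Prop :=
  Admissible g u ∧ ∃ ε > 0, ∀ v : SobolevH1 Ω m, Admissible g v → dist u v < ε →
    energy Q u ≤ energy Q v

/-- `w` is the version of `u` which is at every point of `Ω` the limit of its ball averages,
`wᵢ(x) = lim_{ρ → 0} ⨍_{B_ρ(x)} uᵢ`. These conditions determine `w` at every point of `Ω`. -/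
def IsPreciseVersion (u : SobolevH1 Ω m)
    (w : EuclideanSpace ℝ (Fin n) → EuclideanSpace ℝ (Fin m)) : Prop :=
  w =ᵐ[volume.restrict Ω] u.toFun ∧
    ∀ x ∈ Ω, ∀ i, Tendsto (fun ρ : ℝ => ⨍ y in Metric.ball x ρ, u.toFun y i)
      (𝓝[>] 0) (𝓝 (w x i))

end SobolevH1

/-- `f` is integrable on the sphere `∂B_r(x)` with respect to surface measure
(`volume.toSphere` is the surface measure of the unit sphere). -/
def IntegrableOnSphere {n : ℕ} (f : EuclideanSpace ℝ (Fin n) → ℝ)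
    (x : EuclideanSpace ℝ (Fin n)) (r : ℝ) : Prop :=
  Integrable (fun θ : Metric.sphere (0 : EuclideanSpace ℝ (Fin n)) 1 =>
    f (x + r • (θ : EuclideanSpace ℝ (Fin n))))
    (volume : Measure (EuclideanSpace ℝ (Fin n))).toSphere

/-- The mean `⨍_{∂B_r(x)} f dσ` over the sphere with respect to surface measure, parametrized by
the unit sphere. -/
def sphereMean {n : ℕ} (f : EuclideanSpace ℝ (Fin n) → ℝ)
    (x : EuclideanSpace ℝ (Fin n)) (r : ℝ) : ℝ :=
  ⨍ θ : Metric.sphere (0 : EuclideanSpace ℝ (Fin n)) 1,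
    f (x + r • (θ : EuclideanSpace ℝ (Fin n)))
    ∂(volume : Measure (EuclideanSpace ℝ (Fin n))).toSphere

end

noncomputable section

/-! Fix a component `uᵢ`, a ball `B_r(x)` whose closure contains a zero of `u`, and a radius `R`
slightly larger than `r`. Let `M` be the mean of `uᵢ` over `∂B_r(x)`, let `h` be the harmonic
function in `B_R(x)` with boundary values `uᵢ`, and let `Z` be the zero set of `u` in `B_R(x)`.
Replacing `uᵢ` by `max(uᵢ, h)` lowers the Dirichlet energy by `∫|∇(h - uᵢ)⁺|²` and raises the volume
term by at most `Qmax²|Z|`, so minimality gives `∫|∇(h - uᵢ)⁺|² ≤ Qmax²|Z|`.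

Two explicit estimates on the ball turn this into a bound for `M`. Hardy's inequality (`hardy`)
bounds the left side below by the integral of `((h - uᵢ)⁺)²` against the square of `R/(R² - |y -
x|²)`. The Poisson kernel (`le_poissonInt`) and the monotonicity of spherical means give `h(y) ≥ (R²
- |y - x|²) M / (2ⁿR²)`. On `Z` the factors vanishing at the boundary cancel, leaving `(M/(2ⁿR))²|Z|
≤ Qmax²|Z|`. Hence either `M ≤ 2ⁿ Qmax R`, or `|Z| = 0`. In the second case the Hardy integral
vanishes, so `uᵢ` lies a.e. above a barrier that is positive on the closed ball of radius `r` unless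
`M ≤ 0`, which is incompatible with a zero there if `M > 0`
(`SobolevH1.le_or_ae_poissonBarrier_le`). Letting `R ↓ r` gives the theorem with `C = 2ⁿ`.

Everything pointwise rests on subharmonicity (`SobolevH1.IsLocalMinimizer.weaklySubharmonic`):
lowering `uᵢ` by a small multiple of a function dominated by `uᵢ` does not change the positivity
set, so only the Dirichlet energy is varied. It makes ball averages monotone in the radius, so the
precise version exists at every point, and it bounds this version by mollifications, which gives
integrability on spheres.

Traces are avoided by mollification. The harmonic replacement is taken for a mollified component
`U`, and the competitor adds to `uᵢ` a smooth positive part of `h - U`, a genuine test function in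
the ball (`SobolevH1.exists_isTest_poissonInt_sub_le`). The error terms vanish with the scale, and
Fatou's lemma yields the limit inequality (`SobolevH1.lintegral_poissonBarrier_sub_le`). For a local
minimizer the competitor is admissible on small balls, because the Dirichlet integral of the added
function is controlled by that of `U` and Poincaré's inequality handles the rest
(`SobolevH1.IsLocalMinimizer.eventually_minimizesAbove`). -/

/-- The Euclidean space `ℝⁿ`. -/
abbrev Euc (n : ℕ) := EuclideanSpace ℝ (Fin n)

/-- The partial derivative `∂_j f`. -/
def pd {n : ℕ} (j : Fin n) (f : Euc n → ℝ) (x : Euc n) : ℝ :=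
  fderiv ℝ f x (EuclideanSpace.single j 1)

/-- The Laplacian `∑_j ∂_j ∂_j f`. -/
def lap {n : ℕ} (f : Euc n → ℝ) (x : Euc n) : ℝ := ∑ j, pd j (pd j f) x

/-- Test functions: smooth with compact support in `U`. -/
structure IsTest {n : ℕ} (U : Set (Euc n)) (φ : Euc n → ℝ) : Prop where
  contDiff : ContDiff ℝ ∞ φ
  hasCompactSupport : HasCompactSupport φ
  tsupport_subset : tsupport φ ⊆ U

/-! ### Partial derivatives, test functions, Green's identity and Hardy's inequality. -/

section Calculus

variable {n : ℕ} {f g : Euc n → ℝ} {x : Euc n} {j : Fin n}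

lemma gradient_apply_eq_pd (f : Euc n → ℝ) (x : Euc n) (j : Fin n) :
    gradient f x j = pd j f x := by
  have h := InnerProductSpace.toDual_symm_apply (𝕜 := ℝ) (x := EuclideanSpace.single j (1 : ℝ))
    (y := fderiv ℝ f x)
  rw [← gradient, EuclideanSpace.inner_single_right] at h
  simpa [pd] using h

lemma Filter.EventuallyEq.pd_eq (h : f =ᶠ[𝓝 x] g) : pd j f x = pd j g x := by
  simp only [pd, h.fderiv_eq]

lemma pd_const (c : ℝ) : pd j (fun _ => c) x = 0 := by simp [pd]

lemma pd_add (hf : DifferentiableAt ℝ f x) (hg : DifferentiableAt ℝ g x) :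
    pd j (fun y => f y + g y) x = pd j f x + pd j g x := by
  simp [pd, fderiv_fun_add hf hg]

lemma pd_sub (hf : DifferentiableAt ℝ f x) (hg : DifferentiableAt ℝ g x) :
    pd j (fun y => f y - g y) x = pd j f x - pd j g x := by
  simp [pd, fderiv_fun_sub hf hg]

lemma pd_neg : pd j (fun y => -f y) x = -pd j f x := by
  simp [pd, fderiv_fun_neg]

lemma pd_mul (hf : DifferentiableAt ℝ f x) (hg : DifferentiableAt ℝ g x) :
    pd j (fun y => f y * g y) x = f x * pd j g x + g x * pd j f x := by
  simp [pd, fderiv_fun_mul hf hg]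

lemma pd_const_mul (c : ℝ) (hf : DifferentiableAt ℝ f x) :
    pd j (fun y => c * f y) x = c * pd j f x := by
  simp [pd, fderiv_const_mul hf]

lemma pd_comp {φ : ℝ → ℝ} {φ' : ℝ} (hφ : HasDerivAt φ φ' (f x)) (hf : DifferentiableAt ℝ f x) :
    pd j (fun y => φ (f y)) x = φ' * pd j f x := by
  have := (hφ.comp_hasFDerivAt x hf.hasFDerivAt).fderiv
  simp only [Function.comp_def] at this
  simp [pd, this]

lemma differentiable_coord_sub (a : ℝ) (j : Fin n) :
    Differentiable ℝ (fun y : Euc n => y j - a) := by fun_prop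

lemma pd_coord_sub_self (a : ℝ) : pd j (fun y : Euc n => y j - a) x = 1 := by
  have h : HasFDerivAt (fun y : Euc n => y j - a) (EuclideanSpace.proj j : Euc n →L[ℝ] ℝ) x :=
    (EuclideanSpace.proj j : Euc n →L[ℝ] ℝ).hasFDerivAt.sub_const a
  simp [pd, h.fderiv]

lemma pd_norm_sub_sq (x₀ : Euc n) :
    pd j (fun y => ‖y - x₀‖ ^ 2) x = 2 * (x j - x₀ j) := by
  have h : HasFDerivAt (fun y : Euc n => ‖y - x₀‖ ^ 2) _ x :=
    ((hasFDerivAt_id x).sub_const x₀).norm_sq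
  simp [pd, h.fderiv, EuclideanSpace.inner_single_right]

lemma differentiable_norm_sub_sq (x₀ : Euc n) :
    Differentiable ℝ (fun y => ‖y - x₀‖ ^ 2) :=
  (differentiable_id.sub_const x₀).norm_sq ℝ

lemma norm_sq_eq_sum (x : Euc n) : ‖x‖ ^ 2 = ∑ j, x j ^ 2 := by
  rw [EuclideanSpace.norm_sq_eq]; simp

lemma ContDiff.pd (hf : ContDiff ℝ ∞ f) (j : Fin n) : ContDiff ℝ ∞ (pd j f) :=
  (hf.fderiv_right (m := ∞) le_rfl).clm_apply contDiff_const

lemma ContDiffOn.pd {U : Set (Euc n)} (hf : ContDiffOn ℝ ∞ f U) (hU : IsOpen U) (j : Fin n) :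
    ContDiffOn ℝ ∞ (pd j f) U :=
  (hf.fderiv_of_isOpen hU (m := ∞) le_rfl).clm_apply contDiffOn_const

lemma ContDiffOn.diffAt {U : Set (Euc n)} (hf : ContDiffOn ℝ ∞ f U) (hU : IsOpen U)
    (hx : x ∈ U) : DifferentiableAt ℝ f x :=
  (hf.contDiffAt (hU.mem_nhds hx)).differentiableAt (by simp)

lemma ContDiff.diffAt (hf : ContDiff ℝ ∞ f) : DifferentiableAt ℝ f x :=
  hf.contDiffAt.differentiableAt (by simp)

lemma lap_neg (f : Euc n → ℝ) (x : Euc n) : lap (fun y => -f y) x = -lap f x := by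
  have h : ∀ j : Fin n, pd j (fun y => -f y) = fun y => -pd j f y := fun j => by
    ext y; exact pd_neg
  simp [lap, h, pd_neg]

lemma tsupport_pd_subset (f : Euc n → ℝ) (j : Fin n) : tsupport (pd j f) ⊆ tsupport f :=
  tsupport_fderiv_apply_subset ℝ _

lemma IsTest.pd {U : Set (Euc n)} (hf : IsTest U f) (j : Fin n) : IsTest U (pd j f) :=
  ⟨hf.1.pd j, hf.2.fderiv_apply ℝ _, (tsupport_pd_subset f j).trans hf.3⟩

lemma IsTest.mono {U V : Set (Euc n)} (hf : IsTest U f) (h : U ⊆ V) : IsTest V f :=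
  ⟨hf.1, hf.2, hf.3.trans h⟩

lemma IsTest.lap {U : Set (Euc n)} (hf : IsTest U f) : IsTest U (lap f) := by
  have h : ∀ s : Finset (Fin n), IsTest U (fun x => ∑ j ∈ s, _root_.pd j (_root_.pd j f) x) := by
    intro s
    induction s using Finset.cons_induction with
    | empty =>
      simp only [Finset.sum_empty]
      exact ⟨contDiff_const, HasCompactSupport.zero, by
        rw [show (fun _ : Euc n => (0 : ℝ)) = 0 from rfl, tsupport_zero]; exact empty_subset _⟩
    | cons a s ha ih =>
      simp only [Finset.sum_cons]
      have ha := (hf.pd a).pd a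
      exact ⟨ha.1.add ih.1, ha.2.add ih.2, (tsupport_add _ _).trans (union_subset ha.3 ih.3)⟩
  exact h Finset.univ

lemma IsTest.mul_contDiffOn {U : Set (Euc n)} (hU : IsOpen U) (hg : IsTest U g)
    (hf : ContDiffOn ℝ ∞ f U) : IsTest U (fun x => g x * f x) := by
  have hs : tsupport (fun x => g x * f x) ⊆ tsupport g := tsupport_mul_subset_left
  refine ⟨?_, hg.2.mul_right, hs.trans hg.3⟩
  refine contDiff_iff_contDiffAt.2 fun x => ?_
  by_cases hx : x ∈ tsupport g
  · exact hg.1.contDiffAt.mul (hf.contDiffAt (hU.mem_nhds (hg.3 hx)))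
  · refine (contDiffAt_const (c := (0 : ℝ))).congr_of_eventuallyEq ?_
    filter_upwards [notMem_tsupport_iff_eventuallyEq.1 hx] with y hy
    simp [hy]

lemma IsTest.eq_zero {U : Set (Euc n)} (hg : IsTest U g) (hx : x ∉ U) : g x = 0 :=
  image_eq_zero_of_notMem_tsupport fun h => hx (hg.3 h)

lemma IsTest.integrable {U : Set (Euc n)} (hg : IsTest U g) : Integrable g :=
  hg.1.continuous.integrable_of_hasCompactSupport hg.2

lemma IsTest.integrable_mul {U : Set (Euc n)} (hU : IsOpen U) (hg : IsTest U g)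
    (hf : ContinuousOn f U) : Integrable (fun x => g x * f x) := by
  have hs : tsupport (fun x => g x * f x) ⊆ tsupport g := tsupport_mul_subset_left
  refine Continuous.integrable_of_hasCompactSupport ?_ hg.2.mul_right
  refine ContinuousOn.continuous_of_tsupport_subset ?_ hU (hs.trans hg.3)
  exact hg.1.continuous.continuousOn.mul hf

/-- Integration by parts against a test function. -/
lemma integral_pd_mul {U : Set (Euc n)} (hU : IsOpen U) (hg : IsTest U g)
    (hf : ContDiffOn ℝ ∞ f U) (j : Fin n) :
    ∫ x, pd j g x * f x = -∫ x, g x * pd j f x := by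
  have h1 := (hg.pd j).integrable_mul hU hf.continuousOn
  have h2 := hg.integrable_mul hU (hf.pd hU j).continuousOn
  have h3 := hg.integrable_mul hU hf.continuousOn
  have := integral_mul_fderiv_eq_neg_fderiv_mul_of_integrable (μ := volume) (f := g) (g := f)
    (v := EuclideanSpace.single j (1 : ℝ)) h1 h2 h3
    (fun x _ => hg.1.diffAt) (fun x hx => hf.diffAt hU (hg.3 hx))
  simp only [pd] at *
  linarith

/-- Green's identity `∫ g Δf = -∫ ∇g ⬝ ∇f`. -/
lemma integral_mul_lap {U : Set (Euc n)} (hU : IsOpen U) (hg : IsTest U g)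
    (hf : ContDiffOn ℝ ∞ f U) :
    ∫ x, g x * lap f x = -∑ j, ∫ x, pd j g x * pd j f x := by
  simp only [lap, Finset.mul_sum]
  rw [integral_finsetSum, ← Finset.sum_neg_distrib]
  · refine Finset.sum_congr rfl fun j _ => ?_
    rw [integral_pd_mul hU hg (hf.pd hU j), neg_neg]
  · exact fun j _ => hg.integrable_mul hU ((hf.pd hU j).pd hU j).continuousOn

lemma integral_lap_mul {U : Set (Euc n)} (hU : IsOpen U) (hg : IsTest U g)
    (hf : ContDiffOn ℝ ∞ f U) :
    ∫ x, lap g x * f x = -∑ j, ∫ x, pd j g x * pd j f x := by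
  simp only [lap, Finset.sum_mul]
  rw [integral_finsetSum, ← Finset.sum_neg_distrib]
  · refine Finset.sum_congr rfl fun j _ => ?_
    rw [integral_pd_mul hU (hg.pd j) hf]
  · exact fun j _ => ((hg.pd j).pd j).integrable_mul hU hf.continuousOn

/-- **Hardy's inequality** on a ball for test functions. -/
lemma hardy (hn : 1 ≤ n) {φ : Euc n → ℝ} {x₀ : Euc n} {R : ℝ}
    (hφ : IsTest (Metric.ball x₀ R) φ) :
    ∫ x, φ x ^ 2 * (R / (R ^ 2 - ‖x - x₀‖ ^ 2)) ^ 2 ≤ ∫ x, ∑ j, pd j φ x ^ 2 := by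
  set D : Euc n → ℝ := fun x => R ^ 2 - ‖x - x₀‖ ^ 2 with hD
  have hDpos : ∀ x ∈ Metric.ball x₀ R, 0 < D x := by
    intro x hx
    rw [mem_ball_iff_norm] at hx
    simp only [hD]; nlinarith [norm_nonneg (x - x₀)]
  have hDc : ContDiff ℝ ∞ D := contDiff_const.sub ((contDiff_id.sub contDiff_const).norm_sq ℝ)
  -- The field `k` is chosen so that `∂_j k_j - k_j² = 1/D + (x_j - x₀_j)²/D²`; completing the
  -- square in `(∂_j φ + φ k_j)² ≥ 0` then bounds `∫ (∂_j φ)²` below by the integral of `φ²` times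
  -- this expression.
  set k : Fin n → Euc n → ℝ := fun j x => (x j - x₀ j) / D x with hk
  have hkc : ∀ j, ContDiffOn ℝ ∞ (k j) (Metric.ball x₀ R) := fun j =>
    ContDiffOn.div (ContDiff.contDiffOn (by fun_prop)) hDc.contDiffOn (fun x hx => (hDpos x hx).ne')
  have hinvc : ContDiffOn ℝ ∞ (fun x => (D x)⁻¹) (Metric.ball x₀ R) :=
    hDc.contDiffOn.inv (fun x hx => (hDpos x hx).ne')
  have hsq : IsTest (Metric.ball x₀ R) (fun x => φ x * φ x) :=
    hφ.mul_contDiffOn Metric.isOpen_ball hφ.1.contDiffOn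
  have hpk : ∀ j, ∀ x ∈ Metric.ball x₀ R,
      pd j (k j) x = (D x)⁻¹ + 2 * (x j - x₀ j) ^ 2 / D x ^ 2 := by
    intro j x hx
    have h0 := (hDpos x hx).ne'
    have hd : DifferentiableAt ℝ D x := hDc.diffAt
    have h1 : pd j D x = -(2 * (x j - x₀ j)) := by
      simp only [hD]
      rw [pd_sub (by fun_prop) (differentiable_norm_sub_sq x₀ x), pd_norm_sub_sq, pd_const]
      ring
    have h2 := pd_comp (j := j) (hasDerivAt_inv h0) hd
    simp only [hk, div_eq_mul_inv]
    rw [pd_mul (g := fun y => (D y)⁻¹) (differentiable_coord_sub _ j x) (hd.inv h0), h2, pd_coord_sub_self, h1]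
    field_simp; ring
  have key : ∀ j, ∫ x, (φ x * φ x) * ((D x)⁻¹ + (x j - x₀ j) ^ 2 / D x ^ 2) ≤
      ∫ x, pd j φ x ^ 2 := by
    intro j
    have h1 := integral_pd_mul Metric.isOpen_ball hsq (hkc j) j
    have i1 : Integrable (fun x => pd j (fun x => φ x * φ x) x * k j x) :=
      (hsq.pd j).integrable_mul Metric.isOpen_ball (hkc j).continuousOn
    have i2 : Integrable (fun x => φ x * φ x * pd j (k j) x) :=
      hsq.integrable_mul Metric.isOpen_ball ((hkc j).pd Metric.isOpen_ball j).continuousOn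
    have i3 : Integrable (fun x => pd j φ x ^ 2) := by
      simpa only [sq] using ((hφ.pd j).integrable_mul Metric.isOpen_ball
        (hφ.pd j).1.continuous.continuousOn : Integrable (fun x => pd j φ x * pd j φ x))
    have i4 : Integrable (fun x => (φ x * φ x) * ((D x)⁻¹ + (x j - x₀ j) ^ 2 / D x ^ 2)) := by
      refine hsq.integrable_mul Metric.isOpen_ball ?_
      have : ContinuousOn (fun x => (D x)⁻¹ + k j x ^ 2) (Metric.ball x₀ R) :=
        hinvc.continuousOn.add ((hkc j).continuousOn.pow 2)
      simpa only [hk, div_pow] using this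
    -- The two subtracted terms have total integral zero by the integration by parts `h1`; they turn
    -- the integrand into `(∂_j φ)²` minus a square.
    have : ∫ x, ((φ x * φ x) * ((D x)⁻¹ + (x j - x₀ j) ^ 2 / D x ^ 2)
        - φ x * φ x * pd j (k j) x - pd j (fun x => φ x * φ x) x * k j x) ≤
        ∫ x, pd j φ x ^ 2 := by
      refine integral_mono ((i4.sub i2).sub i1) i3 fun x => ?_
      by_cases hx : x ∈ Metric.ball x₀ R
      · have h0 := (hDpos x hx).ne'
        simp only [hpk j x hx]
        rw [pd_mul hφ.1.diffAt hφ.1.diffAt]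
        simp only [hk]
        have e : φ x * φ x * ((D x)⁻¹ + (x j - x₀ j) ^ 2 / D x ^ 2) -
            φ x * φ x * ((D x)⁻¹ + 2 * (x j - x₀ j) ^ 2 / D x ^ 2) -
            (φ x * pd j φ x + φ x * pd j φ x) * ((x j - x₀ j) / D x) =
            pd j φ x ^ 2 - (pd j φ x + φ x * ((x j - x₀ j) / D x)) ^ 2 := by
          field_simp; ring
        rw [e]; nlinarith [sq_nonneg (pd j φ x + φ x * ((x j - x₀ j) / D x))]
      · rw [(hsq.pd j).eq_zero hx, hφ.eq_zero hx]
        simp only [zero_mul, sub_zero]; positivity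
    rw [integral_sub (by exact i4.sub i2) i1, integral_sub i4 i2] at this
    linarith
  have i3 : ∀ j, Integrable (fun x => pd j φ x ^ 2) := fun j => by
    simpa only [sq] using ((hφ.pd j).integrable_mul Metric.isOpen_ball
      (hφ.pd j).1.continuous.continuousOn : Integrable (fun x => pd j φ x * pd j φ x))
  have i4 : ∀ j, Integrable (fun x => (φ x * φ x) * ((D x)⁻¹ + (x j - x₀ j) ^ 2 / D x ^ 2)) := by
    intro j
    refine hsq.integrable_mul Metric.isOpen_ball ?_
    have : ContinuousOn (fun x => (D x)⁻¹ + k j x ^ 2) (Metric.ball x₀ R) :=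
      hinvc.continuousOn.add ((hkc j).continuousOn.pow 2)
    simpa only [hk, div_pow] using this
  rw [integral_finsetSum _ fun j _ => i3 j]
  refine le_trans ?_ (Finset.sum_le_sum fun j _ => key j)
  rw [← integral_finsetSum _ fun j _ => i4 j]
  refine integral_mono ?_ (integrable_finsetSum _ fun j _ => i4 j) fun x => ?_
  · have : ContinuousOn (fun x => (R * (D x)⁻¹) ^ 2) (Metric.ball x₀ R) :=
      (continuousOn_const.mul hinvc.continuousOn).pow 2
    simpa only [div_eq_mul_inv, sq (φ _)] using hsq.integrable_mul Metric.isOpen_ball this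
  · by_cases hx : x ∈ Metric.ball x₀ R
    · have h0 := hDpos x hx
      simp only [← Finset.mul_sum, Finset.sum_add_distrib, ← Finset.sum_div]
      have hs : ∑ j, (x j - x₀ j) ^ 2 = ‖x - x₀‖ ^ 2 := by rw [norm_sq_eq_sum]; simp
      rw [hs]
      simp only [Finset.sum_const, Finset.card_univ, Fintype.card_fin, nsmul_eq_mul, ← sq]
      refine mul_le_mul_of_nonneg_left ?_ (sq_nonneg _)
      -- Summing over `j` gives the weight `n/D + |x - x₀|²/D²`, and `n ≥ 1` with `D + |x - x₀|² =
      -- R²` makes it at least `R²/D²`.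
      have hn' : (1 : ℝ) ≤ n := by exact_mod_cast hn
      have : (n : ℝ) * (D x)⁻¹ + ‖x - x₀‖ ^ 2 / D x ^ 2 = (n * D x + ‖x - x₀‖ ^ 2) / D x ^ 2 := by
        field_simp
      rw [this, div_pow]
      refine div_le_div_of_nonneg_right ?_ (sq_nonneg _)
      have : D x + ‖x - x₀‖ ^ 2 = R ^ 2 := by simp [hD]
      nlinarith
    · rw [hφ.eq_zero hx]; simp

end Calculus
end

/-! ### Polar coordinates and monotonicity of spherical means. -/

noncomputable section

/-- The unit sphere of `ℝⁿ`. -/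
abbrev USphere (n : ℕ) := Metric.sphere (0 : Euc n) 1

/-- Surface measure on the unit sphere. -/
abbrev surf (n : ℕ) : Measure (USphere n) := (volume : Measure (Euc n)).toSphere

/-- The unnormalised spherical integral `∫_S f(x₀ + tθ) dσ(θ)`. -/
def sphInt {n : ℕ} (f : Euc n → ℝ) (x₀ : Euc n) (t : ℝ) : ℝ :=
  ∫ θ : USphere n, f (x₀ + t • (θ : Euc n)) ∂(surf n)

section Sphere

variable {n : ℕ} {f : Euc n → ℝ} {x₀ : Euc n} {R : ℝ}

lemma USphere.norm_eq (θ : USphere n) : ‖(θ : Euc n)‖ = 1 := by simp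

lemma surf_real_univ_pos (hn : 1 ≤ n) : 0 < (surf n).real univ := by
  have : Nonempty (Fin n) := ⟨⟨0, hn⟩⟩
  have : Nontrivial (Euc n) := inferInstance
  have h : (surf n) ≠ 0 := Measure.toSphere_ne_zero _
  exact ENNReal.toReal_pos (fun h' => h (Measure.measure_univ_eq_zero.1 h')) (measure_ne_top _ _)

lemma sphereMean_eq (f : Euc n → ℝ) (x₀ : Euc n) (t : ℝ) :
    sphereMean f x₀ t = ((surf n).real univ)⁻¹ * sphInt f x₀ t := by
  rw [sphereMean, average_eq, smul_eq_mul]; rfl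

/-- Integration in polar coordinates. -/
lemma integrable_and_integral_polar (hn : 1 ≤ n) {F : Euc n → ℝ} (hF : Integrable F) :
    IntegrableOn (fun t : ℝ => t ^ (n - 1) * sphInt F 0 t) (Ioi 0) ∧
    ∫ x, F x = ∫ t in Ioi (0 : ℝ), t ^ (n - 1) * sphInt F 0 t := by
  have : Nonempty (Fin n) := ⟨⟨0, hn⟩⟩
  have : Nontrivial (Euc n) := inferInstance
  have hdim : Module.finrank ℝ (Euc n) = n := by simp
  set ν := Measure.volumeIoiPow (n - 1) with hν
  have hmp := (volume : Measure (Euc n)).measurePreserving_homeomorphUnitSphereProd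
  rw [hdim] at hmp
  have hemb := (homeomorphUnitSphereProd (Euc n)).measurableEmbedding
  set H : USphere n × Ioi (0 : ℝ) → ℝ := fun p => F ((p.2 : ℝ) • (p.1 : Euc n)) with hH
  have hcomp : ∀ x : ({0}ᶜ : Set (Euc n)), H (homeomorphUnitSphereProd (Euc n) x) = F x := by
    intro x
    have hx : ‖(x : Euc n)‖ ≠ 0 := norm_ne_zero_iff.2 x.2
    simp [hH, smul_smul, hx]
  have hFi : Integrable (fun x : ({0}ᶜ : Set (Euc n)) => F x)
      ((volume : Measure (Euc n)).comap (↑)) := by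
    have := integrableOn_iff_comap_subtypeVal (μ := (volume : Measure (Euc n))) (f := F)
      (measurableSet_singleton (0 : Euc n)).compl
    exact this.1 hF.integrableOn
  have hHi : Integrable H ((surf n).prod ν) := by
    rw [← hmp.integrable_comp_emb hemb]
    exact hFi.congr (Eventually.of_forall fun x => (hcomp x).symm)
  have hgi : Integrable (fun t : Ioi (0 : ℝ) => sphInt F 0 t) ν := by
    simpa [sphInt, hH] using hHi.integral_prod_right
  have hint : ∫ x, F x = ∫ t : Ioi (0 : ℝ), sphInt F 0 t ∂ν := by
    calc ∫ x, F x = ∫ x : ({0}ᶜ : Set (Euc n)), F x ∂((volume : Measure (Euc n)).comap (↑)) := by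
          rw [integral_subtype_comap (measurableSet_singleton _).compl F,
            restrict_compl_singleton]
      _ = ∫ p, H p ∂((surf n).prod ν) := by
          rw [← hmp.integral_comp hemb H]
          exact integral_congr_ae (Eventually.of_forall fun x => (hcomp x).symm)
      _ = _ := by
          rw [integral_prod_symm _ hHi]
          simp [sphInt, hH]
  constructor
  · rw [integrableOn_iff_comap_subtypeVal measurableSet_Ioi]
    rw [hν, Measure.volumeIoiPow, integrable_withDensity_iff_integrable_smul'] at hgi
    · refine hgi.congr (Eventually.of_forall fun t => ?_)
      have ht : (0 : ℝ) ≤ (t : ℝ) ^ (n - 1) := pow_nonneg t.2.out.le _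
      simp [ENNReal.toReal_ofReal ht]
    · exact (measurable_subtype_coe.pow_const _).ennreal_ofReal
    · simp
  · rw [hint, hν, Measure.volumeIoiPow]
    simp only [ENNReal.ofReal]
    rw [integral_withDensity_eq_integral_smul,
      ← integral_subtype_comap measurableSet_Ioi (fun t : ℝ => t ^ (n - 1) * sphInt F 0 t)]
    · refine integral_congr_ae (Eventually.of_forall fun t => ?_)
      have ht : (0 : ℝ) ≤ (t : ℝ) ^ (n - 1) := pow_nonneg t.2.out.le _
      simp [NNReal.smul_def, Real.coe_toNNReal _ ht]
    · exact (measurable_subtype_coe.pow_const _).real_toNNReal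

lemma continuousOn_sphere_integral {X W : Type*} [TopologicalSpace X] [FirstCountableTopology X]
    [LocallyCompactSpace X] [NormedAddCommGroup W] [NormedSpace ℝ W] {U : Set X} (hU : IsOpen U)
    {F : X → USphere n → W} (hF : ContinuousOn (Function.uncurry F) (U ×ˢ univ)) :
    ContinuousOn (fun x => ∫ θ, F x θ ∂(surf n)) U := by
  rw [continuousOn_iff_continuous_domRestrict]
  have : LocallyCompactSpace U := hU.locallyCompactSpace
  have h : Continuous (Function.uncurry fun (x : U) (θ : USphere n) => F x θ) := by
    have h1 : Continuous (fun p : U × USphere n => ((p.1 : X), p.2)) := by fun_prop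
    exact hF.comp_continuous h1 fun p => ⟨p.1.2, mem_univ _⟩
  have := continuous_parametric_integral_of_continuous (μ := surf n) h isCompact_univ
  simpa [Set.domRestrict_def] using this

lemma add_smul_sphere_mem_ball {t : ℝ} (ht : |t| < R) (θ : USphere n) :
    x₀ + t • (θ : Euc n) ∈ Metric.ball x₀ R := by
  rw [mem_ball_iff_norm, add_sub_cancel_left, norm_smul, USphere.norm_eq, mul_one]
  exact ht

/-- Negative radii are allowed so that the radius `0` is an interior point; this makes the value at
the centre available as the starting point of the monotonicity argument. -/
lemma continuousOn_sphInt {g : Euc n → ℝ} (hg : ContinuousOn g (Metric.ball x₀ R)) :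
    ContinuousOn (sphInt g x₀) (Ioo (-R) R) := by
  refine continuousOn_sphere_integral isOpen_Ioo ?_
  have h1 : Continuous (fun p : ℝ × USphere n => x₀ + p.1 • (p.2 : Euc n)) := by fun_prop
  exact hg.comp h1.continuousOn fun p hp =>
    add_smul_sphere_mem_ball (abs_lt.2 (mem_prod.1 hp).1) _

/-- The spherical integral of the radial derivative. -/
def sphRadial (f : Euc n → ℝ) (x₀ : Euc n) (t : ℝ) : ℝ :=
  ∫ θ : USphere n, ∑ j, pd j f (x₀ + t • (θ : Euc n)) * (θ : Euc n) j ∂(surf n)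

lemma continuousOn_radial_integrand (hf : ContDiffOn ℝ ∞ f (Metric.ball x₀ R)) :
    ContinuousOn (fun p : ℝ × USphere n =>
      ∑ j, pd j f (x₀ + p.1 • (p.2 : Euc n)) * (p.2 : Euc n) j) (Ioo (-R) R ×ˢ univ) := by
  refine continuousOn_finsetSum _ fun j _ => ContinuousOn.mul ?_ ?_
  · have h1 : Continuous (fun p : ℝ × USphere n => x₀ + p.1 • (p.2 : Euc n)) := by fun_prop
    exact (hf.pd Metric.isOpen_ball j).continuousOn.comp h1.continuousOn fun p hp =>
      add_smul_sphere_mem_ball (abs_lt.2 (mem_prod.1 hp).1) _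
  · exact Continuous.continuousOn (by fun_prop)

lemma continuousOn_sphRadial (hf : ContDiffOn ℝ ∞ f (Metric.ball x₀ R)) :
    ContinuousOn (sphRadial f x₀) (Ioo (-R) R) :=
  continuousOn_sphere_integral isOpen_Ioo (continuousOn_radial_integrand hf)

lemma fderiv_eq_sum_pd (f : Euc n → ℝ) (x v : Euc n) :
    fderiv ℝ f x v = ∑ j, pd j f x * v j := by
  conv_lhs => rw [← (EuclideanSpace.basisFun (Fin n) ℝ).sum_repr v]
  rw [map_sum]
  refine Finset.sum_congr rfl fun j _ => ?_
  simp [pd, mul_comm]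

lemma hasDerivAt_sphInt (hf : ContDiffOn ℝ ∞ f (Metric.ball x₀ R)) {t : ℝ}
    (ht : t ∈ Ioo (-R) R) : HasDerivAt (sphInt f x₀) (sphRadial f x₀ t) t := by
  obtain ⟨ε, hε, hball⟩ := Metric.nhds_basis_closedBall.mem_iff.1 (isOpen_Ioo.mem_nhds ht)
  have hK : IsCompact (Metric.closedBall t ε ×ˢ (univ : Set (USphere n))) :=
    (isCompact_closedBall t ε).prod isCompact_univ
  obtain ⟨C, hC⟩ := hK.exists_bound_of_continuousOn
    ((continuousOn_radial_integrand hf).mono (prod_mono hball subset_rfl))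
  have hcont : ∀ s ∈ Ioo (-R) R, Continuous fun θ : USphere n => f (x₀ + s • (θ : Euc n)) := by
    intro s hs
    exact hf.continuousOn.comp_continuous (by fun_prop) fun θ =>
      add_smul_sphere_mem_ball (abs_lt.2 hs) θ
  refine (hasDerivAt_integral_of_dominated_loc_of_deriv_le (μ := surf n)
    (F := fun s θ => f (x₀ + s • (θ : Euc n)))
    (F' := fun s θ => ∑ j, pd j f (x₀ + s • (θ : Euc n)) * (θ : Euc n) j) (bound := fun _ => C)
    (Metric.closedBall_mem_nhds t hε) ?_ ?_ ?_ ?_ (integrable_const C) ?_).2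
  · filter_upwards [isOpen_Ioo.mem_nhds ht] with s hs
    exact (hcont s hs).aestronglyMeasurable
  · exact (hcont t ht).integrable_of_hasCompactSupport (HasCompactSupport.of_compactSpace _)
  · have : Continuous fun θ : USphere n => ∑ j, pd j f (x₀ + t • (θ : Euc n)) * (θ : Euc n) j :=
      (continuousOn_radial_integrand hf).comp_continuous (f := fun θ : USphere n => (t, θ))
        (by fun_prop) fun θ => ⟨ht, mem_univ _⟩
    exact this.aestronglyMeasurable
  · exact Eventually.of_forall fun θ s hs => hC (s, θ) ⟨hs, mem_univ _⟩
  · refine Eventually.of_forall fun θ s hs => ?_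
    have hd := hf.diffAt Metric.isOpen_ball
      (add_smul_sphere_mem_ball (x₀ := x₀) (abs_lt.2 (hball hs)) θ)
    have h1 : HasDerivAt (fun s : ℝ => x₀ + s • (θ : Euc n)) (θ : Euc n) s := by
      simpa using ((hasDerivAt_id s).smul_const (θ : Euc n)).const_add x₀
    have := hd.hasFDerivAt.comp_hasDerivAt s h1
    rwa [fderiv_eq_sum_pd] at this

/-- A smooth radial cut-off profile, `1` on `(-∞, a²]` and `0` on `[b², ∞)`. -/
def cutoffProfile (a b s : ℝ) : ℝ := 1 - Real.smoothTransition ((s - a ^ 2) / (b ^ 2 - a ^ 2))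

lemma contDiff_cutoffProfile (a b : ℝ) : ContDiff ℝ ∞ (cutoffProfile a b) :=
  contDiff_const.sub (Real.smoothTransition.contDiff.comp
    ((contDiff_id.sub contDiff_const).div_const _))

lemma cutoffProfile_nonneg (a b s : ℝ) : 0 ≤ cutoffProfile a b s :=
  sub_nonneg.2 (Real.smoothTransition.le_one _)

lemma cutoffProfile_eq_zero {a b s : ℝ} (ha : 0 ≤ a) (hab : a < b) (hs : b ^ 2 ≤ s) :
    cutoffProfile a b s = 0 := by
  have : 0 < b ^ 2 - a ^ 2 := by nlinarith
  rw [cutoffProfile, Real.smoothTransition.one_of_one_le, sub_self]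
  rw [le_div_iff₀ this]; linarith

lemma cutoffProfile_eq_one {a b s : ℝ} (ha : 0 ≤ a) (hab : a < b) (hs : s ≤ a ^ 2) :
    cutoffProfile a b s = 1 := by
  have : 0 < b ^ 2 - a ^ 2 := by nlinarith
  rw [cutoffProfile, Real.smoothTransition.zero_of_nonpos, sub_zero]
  exact div_nonpos_of_nonpos_of_nonneg (by linarith) this.le

lemma antitone_cutoffProfile {a b : ℝ} (ha : 0 ≤ a) (hab : a < b) :
    Antitone (cutoffProfile a b) := by
  intro s t hst
  have : 0 < b ^ 2 - a ^ 2 := by nlinarith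
  refine sub_le_sub_left (Real.smoothTransition.monotone ?_) _
  exact div_le_div_of_nonneg_right (by linarith) this.le

lemma deriv_cutoffProfile_nonpos {a b : ℝ} (ha : 0 ≤ a) (hab : a < b) (s : ℝ) :
    deriv (cutoffProfile a b) s ≤ 0 := (antitone_cutoffProfile ha hab).deriv_nonpos

lemma deriv_cutoffProfile_eq_zero {a b s : ℝ} (ha : 0 ≤ a) (hab : a < b)
    (hs : s < a ^ 2 ∨ b ^ 2 < s) : deriv (cutoffProfile a b) s = 0 := by
  rcases hs with hs | hs
  · have : cutoffProfile a b =ᶠ[𝓝 s] fun _ => 1 := by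
      filter_upwards [Iio_mem_nhds hs] with y hy using cutoffProfile_eq_one ha hab (le_of_lt hy)
    rw [this.deriv_eq, deriv_const]
  · have : cutoffProfile a b =ᶠ[𝓝 s] fun _ => 0 := by
      filter_upwards [Ioi_mem_nhds hs] with y hy using cutoffProfile_eq_zero ha hab (le_of_lt hy)
    rw [this.deriv_eq, deriv_const]

lemma isTest_radial_cutoff {a b : ℝ} (ha : 0 ≤ a) (hab : a < b) :
    IsTest (Metric.closedBall x₀ b) (fun x => cutoffProfile a b (‖x - x₀‖ ^ 2)) := by
  have hs : tsupport (fun x => cutoffProfile a b (‖x - x₀‖ ^ 2)) ⊆ Metric.closedBall x₀ b := by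
    refine closure_minimal (fun x hx => ?_) Metric.isClosed_closedBall
    rw [mem_closedBall_iff_norm]
    by_contra! h
    exact hx (cutoffProfile_eq_zero ha hab (pow_le_pow_left₀ (ha.trans hab.le) h.le 2))
  refine ⟨(contDiff_cutoffProfile a b).comp ((contDiff_id.sub contDiff_const).norm_sq ℝ), ?_, hs⟩
  exact (isCompact_closedBall x₀ b).of_isClosed_subset (isClosed_tsupport _) hs

/-- This replaces the divergence theorem on balls. Were the radial flux negative at `t`, it would be
below some `-c < 0` for all radii in an interval `[a, b]`. Green's identity is tested against a
radial cut-off whose gradient lives in the shell `a ≤ |x - x₀| ≤ b`; in polar coordinates the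
pairing of the two gradients is at least `c a^(n-1) > 0`, whereas nonnegativity of the Laplacian
makes it at most `0`. -/
lemma sphRadial_nonneg (hn : 1 ≤ n) (hf : ContDiffOn ℝ ∞ f (Metric.ball x₀ R))
    (hlap : ∀ x ∈ Metric.ball x₀ R, 0 ≤ lap f x) {t : ℝ} (ht : t ∈ Ioo 0 R) :
    0 ≤ sphRadial f x₀ t := by
  by_contra! hneg
  have hk := (continuousOn_sphRadial hf).mono (Ioo_subset_Ioo_left (by linarith [ht.1, ht.2]) :
    Ioo 0 R ⊆ Ioo (-R) R)
  have hev : ∀ᶠ s in 𝓝 t, s ∈ Ioo 0 R ∧ sphRadial f x₀ s < sphRadial f x₀ t / 2 :=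
    (show ∀ᶠ s in 𝓝 t, s ∈ Ioo 0 R from isOpen_Ioo.mem_nhds ht).and
      ((hk.continuousAt (isOpen_Ioo.mem_nhds ht)).eventually_lt_const (by linarith))
  obtain ⟨ε, hε, hball⟩ := Metric.nhds_basis_closedBall.mem_iff.1 hev
  set c := -(sphRadial f x₀ t / 2) with hc
  have hcpos : 0 < c := by rw [hc]; linarith
  set a := t - ε with ha'
  set b := t + ε with hb'
  have hIcc : ∀ s ∈ Icc a b, s ∈ Ioo 0 R ∧ sphRadial f x₀ s < -c := by
    intro s hs
    have := hball (by rwa [Real.closedBall_eq_Icc] : s ∈ Metric.closedBall t ε)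
    exact ⟨this.1, by rw [hc, neg_neg]; exact this.2⟩
  have hab : a < b := by rw [ha', hb']; linarith
  have ha : 0 < a := (hIcc a (left_mem_Icc.2 hab.le)).1.1
  have hb : b < R := (hIcc b (right_mem_Icc.2 hab.le)).1.2
  have htest := (isTest_radial_cutoff (x₀ := x₀) ha.le hab).mono (Metric.closedBall_subset_ball hb)
  set ζ : Euc n → ℝ := fun x => cutoffProfile a b (‖x - x₀‖ ^ 2) with hζ
  have h0 : 0 ≤ ∫ x, ζ x * lap f x := by
    refine integral_nonneg fun x => ?_
    by_cases hx : x ∈ Metric.ball x₀ R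
    · exact mul_nonneg (cutoffProfile_nonneg _ _ _) (hlap x hx)
    · simp [htest.eq_zero hx]
  rw [integral_mul_lap Metric.isOpen_ball htest hf, neg_nonneg, ← integral_finsetSum] at h0
  swap
  · exact fun j _ => (htest.pd j).integrable_mul Metric.isOpen_ball
      (hf.pd Metric.isOpen_ball j).continuousOn
  have hFi : Integrable (fun x => ∑ j, pd j ζ x * pd j f x) :=
    integrable_finsetSum _ fun j _ => (htest.pd j).integrable_mul Metric.isOpen_ball
      (hf.pd Metric.isOpen_ball j).continuousOn
  have hpdζ : ∀ (j : Fin n) x, pd j ζ x =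
      deriv (cutoffProfile a b) (‖x - x₀‖ ^ 2) * (2 * (x j - x₀ j)) := by
    intro j x
    rw [hζ, pd_comp (((contDiff_cutoffProfile a b).differentiable (by simp)) _).hasDerivAt
      (differentiable_norm_sub_sq x₀ x), pd_norm_sub_sq]
  rw [← integral_add_left_eq_self _ x₀] at h0
  have hFi' := hFi.comp_add_left x₀
  obtain ⟨hi, he⟩ := integrable_and_integral_polar hn hFi'
  rw [he] at h0
  set ρ : ℝ → ℝ := fun s => cutoffProfile a b (s ^ 2) with hρ
  have hρc : ContDiff ℝ ∞ ρ := (contDiff_cutoffProfile a b).comp (contDiff_id.pow 2)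
  have hρd : ∀ s, deriv ρ s = deriv (cutoffProfile a b) (s ^ 2) * (2 * s) := by
    intro s
    have h1 := (((contDiff_cutoffProfile a b).differentiable (by simp)) (s ^ 2)).hasDerivAt
    have h2 : HasDerivAt (fun s : ℝ => s ^ 2) (2 * s) s := by simpa using hasDerivAt_pow 2 s
    exact (HasDerivAt.comp (h₂ := cutoffProfile a b) (h := fun s : ℝ => s ^ 2) s h1 h2).deriv
  have hρs : HasCompactSupport ρ := by
    refine HasCompactSupport.of_support_subset_isCompact (isCompact_Icc (a := -b) (b := b)) ?_
    intro s hs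
    rw [mem_Icc, ← abs_le]
    by_contra! h
    refine hs (cutoffProfile_eq_zero ha.le hab ?_)
    rw [← sq_abs s]
    exact pow_le_pow_left₀ (ha.le.trans hab.le) h.le 2
  have hint := hρs.integral_Ioi_deriv_eq (hρc.of_le (by simp)) 0
  have hρ0 : ρ 0 = 1 := cutoffProfile_eq_one ha.le hab (by simpa using sq_nonneg a)
  rw [hρ0] at hint
  have hdi : IntegrableOn (deriv ρ) (Ioi 0) :=
    ((hρc.continuous_deriv (by simp)).integrable_of_hasCompactSupport hρs.deriv).integrableOn
  have hsph : ∀ s : ℝ, sphInt (fun x => ∑ j, pd j ζ (x₀ + x) * pd j f (x₀ + x)) 0 s =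
      deriv ρ s * sphRadial f x₀ s := by
    intro s
    rw [sphInt, sphRadial, ← integral_const_mul]
    refine integral_congr_ae (Eventually.of_forall fun θ => ?_)
    have hθ : ‖(θ : Euc n)‖ = 1 := USphere.norm_eq θ
    simp only [hpdζ, hρd, zero_add, add_sub_cancel_left, Finset.mul_sum, norm_smul, hθ, mul_one,
      Real.norm_eq_abs, sq_abs]
    refine Finset.sum_congr rfl fun j _ => ?_
    simp; ring
  have hlow : ∫ s in Ioi (0 : ℝ), c * a ^ (n - 1) * -deriv ρ s ≤
      ∫ s in Ioi (0 : ℝ), s ^ (n - 1) *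
        sphInt (fun x => ∑ j, pd j ζ (x₀ + x) * pd j f (x₀ + x)) 0 s := by
    refine setIntegral_mono_on (hdi.neg.const_mul _) hi measurableSet_Ioi fun s hs => ?_
    have hs0 : (0 : ℝ) < s := hs
    rw [hsph]
    by_cases hsI : s ∈ Icc a b
    · have h1 : deriv ρ s ≤ 0 := by
        rw [hρd]
        exact mul_nonpos_of_nonpos_of_nonneg (deriv_cutoffProfile_nonpos ha.le hab _)
          (by linarith)
      have h2 := (hIcc s hsI).2
      have h3 : a ^ (n - 1) ≤ s ^ (n - 1) := by gcongr; exact hsI.1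
      have h4 : 0 < a ^ (n - 1) := pow_pos ha _
      calc c * a ^ (n - 1) * -deriv ρ s ≤ c * s ^ (n - 1) * -deriv ρ s := by
            refine mul_le_mul_of_nonneg_right ?_ (by linarith)
            exact mul_le_mul_of_nonneg_left h3 hcpos.le
        _ ≤ (-sphRadial f x₀ s) * s ^ (n - 1) * -deriv ρ s := by
            refine mul_le_mul_of_nonneg_right ?_ (by linarith)
            exact mul_le_mul_of_nonneg_right (by linarith) (h4.le.trans h3)
        _ = _ := by ring
    · have h1 : deriv ρ s = 0 := by
        rw [hρd, deriv_cutoffProfile_eq_zero ha.le hab, zero_mul]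
        rw [mem_Icc, not_and_or, not_le, not_le] at hsI
        rcases hsI with h | h
        · left; gcongr
        · right; gcongr; linarith
      simp [h1]
  rw [integral_const_mul, integral_neg, hint] at hlow
  have : 0 < c * a ^ (n - 1) := mul_pos hcpos (pow_pos ha _)
  linarith

/-- Spherical means of smooth subharmonic functions are nondecreasing in the radius. -/
lemma monotoneOn_sphInt (hn : 1 ≤ n) (hf : ContDiffOn ℝ ∞ f (Metric.ball x₀ R))
    (hlap : ∀ x ∈ Metric.ball x₀ R, 0 ≤ lap f x) : MonotoneOn (sphInt f x₀) (Ico 0 R) := by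
  have hsub : Ico 0 R ⊆ Ioo (-R) R := fun s hs => ⟨by linarith [hs.1, hs.2], hs.2⟩
  refine monotoneOn_of_deriv_nonneg (convex_Ico 0 R)
    ((continuousOn_sphInt hf.continuousOn).mono hsub) ?_ ?_
  · rw [interior_Ico]
    exact fun s hs => ((hasDerivAt_sphInt hf
      (hsub (Ioo_subset_Ico_self hs))).differentiableAt).differentiableWithinAt
  · rw [interior_Ico]
    intro s hs
    rw [(hasDerivAt_sphInt hf (hsub (Ioo_subset_Ico_self hs))).deriv]
    exact sphRadial_nonneg hn hf hlap hs

lemma sphInt_zero (f : Euc n → ℝ) (x₀ : Euc n) :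
    sphInt f x₀ 0 = (surf n).real univ * f x₀ := by
  simp [sphInt]

lemma sphInt_neg (f : Euc n → ℝ) (x₀ : Euc n) (t : ℝ) :
    sphInt (fun x => -f x) x₀ t = -sphInt f x₀ t := by
  simp [sphInt, integral_neg]

/-- The mean value property of harmonic functions. -/
lemma sphInt_eq_of_harmonic (hn : 1 ≤ n) (hf : ContDiffOn ℝ ∞ f (Metric.ball x₀ R))
    (hlap : ∀ x ∈ Metric.ball x₀ R, lap f x = 0) {t : ℝ} (ht : t ∈ Ico 0 R) :
    sphInt f x₀ t = (surf n).real univ * f x₀ := by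
  have h0 : (0 : ℝ) ∈ Ico 0 R := ⟨le_rfl, ht.1.trans_lt ht.2⟩
  have h1 := monotoneOn_sphInt hn hf (fun x hx => (hlap x hx).ge) h0 ht ht.1
  have h2 := monotoneOn_sphInt hn (f := fun x => -f x) hf.neg
    (fun x hx => by rw [lap_neg, hlap x hx, neg_zero]) h0 ht ht.1
  rw [sphInt_neg, sphInt_neg] at h2
  rw [← sphInt_zero]; linarith

end Sphere
end

/-! ### Smoothness of sphere integrals in a parameter. -/

noncomputable section

section Parametric

variable {n : ℕ}

/-- Smooth dependence on a parameter of an integral over the unit sphere. -/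
lemma contDiffOn_sphere_integral_nat {V : Set (Euc n × Euc n)} (hV : IsOpen V) {U : Set (Euc n)}
    (hU : IsOpen U) (hUV : ∀ x ∈ U, ∀ θ : USphere n, (x, (θ : Euc n)) ∈ V)
    {g : USphere n → ℝ} (hg : Continuous g) (k : ℕ) :
    ∀ {W : Type} [NormedAddCommGroup W] [NormedSpace ℝ W] [CompleteSpace W]
      {F : Euc n × Euc n → W}, ContDiffOn ℝ ∞ F V →
      ContDiffOn ℝ k (fun x => ∫ θ : USphere n, g θ • F (x, (θ : Euc n)) ∂(surf n)) U := by
  have hcont : ∀ {W : Type} [NormedAddCommGroup W] [NormedSpace ℝ W] {F : Euc n × Euc n → W},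
      ContDiffOn ℝ ∞ F V → ContinuousOn (fun p : Euc n × USphere n =>
        g p.2 • F (p.1, (p.2 : Euc n))) (U ×ˢ univ) := by
    intro W _ _ F hF
    refine (hg.comp continuous_snd).continuousOn.smul ?_
    have h1 : Continuous (fun p : Euc n × USphere n => (p.1, (p.2 : Euc n))) := by fun_prop
    exact hF.continuousOn.comp h1.continuousOn fun p hp => hUV p.1 hp.1 p.2
  -- The target space `W` varies in the induction: the derivative of the integral is again such an
  -- integral, whose integrand `F'` takes values in continuous linear maps to `W`.
  induction k with
  | zero =>
    intro W _ _ _ F hF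
    rw [Nat.cast_zero, contDiffOn_zero]
    exact continuousOn_sphere_integral hU (hcont hF)
  | succ k ih =>
    intro W _ _ _ F hF
    set F' : Euc n × Euc n → (Euc n →L[ℝ] W) := fun p =>
      (fderiv ℝ F p).comp (ContinuousLinearMap.inl ℝ (Euc n) (Euc n)) with hF'
    have hF'c : ContDiffOn ℝ ∞ F' V :=
      (hF.fderiv_of_isOpen hV (m := ∞) le_rfl).clm_comp contDiffOn_const
    have hder : ∀ x ∈ U, HasFDerivAt (fun x => ∫ θ : USphere n, g θ • F (x, (θ : Euc n)) ∂(surf n))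
        (∫ θ : USphere n, g θ • F' (x, (θ : Euc n)) ∂(surf n)) x := by
      intro x hx
      obtain ⟨ε, hε, hball⟩ := Metric.nhds_basis_closedBall.mem_iff.1 (hU.mem_nhds hx)
      have hK : IsCompact (Metric.closedBall x ε ×ˢ (univ : Set (USphere n))) :=
        (isCompact_closedBall x ε).prod isCompact_univ
      obtain ⟨C, hC⟩ := hK.exists_bound_of_continuousOn
        ((hcont hF'c).mono (prod_mono hball subset_rfl))
      have hc : ∀ {W : Type} [NormedAddCommGroup W] [NormedSpace ℝ W] {F : Euc n × Euc n → W},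
          ContDiffOn ℝ ∞ F V → ∀ y ∈ U,
          Continuous fun θ : USphere n => g θ • F (y, (θ : Euc n)) := by
        intro W _ _ F hF y hy
        exact (hcont hF).comp_continuous (f := fun θ : USphere n => (y, θ)) (by fun_prop)
          fun θ => ⟨hy, mem_univ _⟩
      refine hasFDerivAt_integral_of_dominated_of_fderiv_le (μ := surf n)
        (F := fun y (θ : USphere n) => g θ • F (y, (θ : Euc n)))
        (F' := fun y (θ : USphere n) => g θ • F' (y, (θ : Euc n)))
        (bound := fun _ => C) (Metric.closedBall_mem_nhds x hε) ?_ ?_ ?_ ?_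
        (integrable_const C) ?_
      · filter_upwards [hU.mem_nhds hx] with y hy
        exact (hc hF y hy).aestronglyMeasurable
      · exact (hc hF x hx).integrable_of_hasCompactSupport (HasCompactSupport.of_compactSpace _)
      · exact (hc hF'c x hx).aestronglyMeasurable
      · exact Eventually.of_forall fun θ y hy => hC (y, θ) ⟨hy, mem_univ _⟩
      · refine Eventually.of_forall fun θ y hy => ?_
        have hd : DifferentiableAt ℝ F (y, (θ : Euc n)) :=
          (hF.contDiffAt (hV.mem_nhds (hUV y (hball hy) θ))).differentiableAt (by simp)
        have h2 : HasFDerivAt (fun y : Euc n => (y, (θ : Euc n)))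
          (ContinuousLinearMap.inl ℝ (Euc n) (Euc n)) y := hasFDerivAt_prodMk_left y _
        exact (hd.hasFDerivAt.comp y h2).const_smul (g θ)
    rw [Nat.cast_add, Nat.cast_one, contDiffOn_succ_iff_fderiv_of_isOpen hU]
    refine ⟨fun x hx => (hder x hx).differentiableAt.differentiableWithinAt,
      fun h => by simp at h, ?_⟩
    exact (ih hF'c).congr fun x hx => (hder x hx).fderiv

lemma contDiffOn_sphere_integral {V : Set (Euc n × Euc n)} (hV : IsOpen V) {U : Set (Euc n)}
    (hU : IsOpen U) (hUV : ∀ x ∈ U, ∀ θ : USphere n, (x, (θ : Euc n)) ∈ V)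
    {g : USphere n → ℝ} (hg : Continuous g) {F : Euc n × Euc n → ℝ} (hF : ContDiffOn ℝ ∞ F V) :
    ContDiffOn ℝ ∞ (fun x => ∫ θ : USphere n, g θ • F (x, (θ : Euc n)) ∂(surf n)) U :=
  contDiffOn_infty.2 fun k => contDiffOn_sphere_integral_nat hV hU hUV hg k hF

end Parametric

/-! ### Poisson kernel and Poisson integral of a ball. -/

section Poisson

variable {n : ℕ}

/-- The (unnormalised) Poisson kernel of the ball `B_R(x₀)` with pole `p`. -/
def ballPoissonKernel (x₀ : Euc n) (R : ℝ) (p z : Euc n) : ℝ :=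
  (R ^ 2 - ‖z - x₀‖ ^ 2) * (‖z - p‖ ^ 2) ^ (-(n : ℝ) / 2)

/-- The Poisson integral on `B_R(x₀)` of the restriction of `f` to the sphere. -/
def poissonInt (f : Euc n → ℝ) (x₀ : Euc n) (R : ℝ) (z : Euc n) : ℝ :=
  ((surf n).real univ * (R ^ 2 * (R ^ 2) ^ (-(n : ℝ) / 2)))⁻¹ *
    ∫ θ : USphere n, f (x₀ + R • (θ : Euc n)) *
      ballPoissonKernel x₀ R (x₀ + R • (θ : Euc n)) z ∂(surf n)

lemma norm_sub_sphere_pos {x₀ z : Euc n} {R : ℝ} (hz : z ∈ Metric.ball x₀ R) (θ : USphere n) :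
    0 < ‖z - (x₀ + R • (θ : Euc n))‖ ^ 2 := by
  have hR := Metric.pos_of_mem_ball hz
  have : z ≠ x₀ + R • (θ : Euc n) := by
    rintro rfl
    rw [mem_ball_iff_norm, add_sub_cancel_left, norm_smul, USphere.norm_eq, mul_one,
      Real.norm_eq_abs, abs_of_pos hR] at hz
    exact lt_irrefl _ hz
  have := norm_pos_iff.2 (sub_ne_zero.2 this)
  positivity

lemma contDiffOn_ballPoissonKernel_joint (x₀ : Euc n) (R : ℝ) :
    ContDiffOn ℝ ∞ (fun q : Euc n × Euc n => ballPoissonKernel x₀ R (x₀ + R • q.2) q.1)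
      {q | ‖q.1 - (x₀ + R • q.2)‖ ^ 2 ≠ 0} := by
  unfold ballPoissonKernel
  refine ContDiffOn.mul ?_ ?_
  · exact (contDiff_const.sub ((contDiff_fst.sub contDiff_const).norm_sq ℝ)).contDiffOn
  · refine ContDiffOn.rpow_const_of_ne ?_ fun q hq => hq
    refine ContDiff.contDiffOn (ContDiff.norm_sq ℝ ?_)
    fun_prop

lemma continuousOn_ballPoissonKernel_joint (x₀ : Euc n) (R : ℝ) :
    ContinuousOn (fun q : Euc n × USphere n =>
      ballPoissonKernel x₀ R (x₀ + R • (q.2 : Euc n)) q.1) (Metric.ball x₀ R ×ˢ univ) := by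
  have h1 : Continuous (fun q : Euc n × USphere n => (q.1, (q.2 : Euc n))) := by fun_prop
  exact ContinuousOn.comp (g := fun q : Euc n × Euc n =>
    ballPoissonKernel x₀ R (x₀ + R • q.2) q.1) (f := fun q : Euc n × USphere n =>
    (q.1, (q.2 : Euc n))) (contDiffOn_ballPoissonKernel_joint x₀ R).continuousOn h1.continuousOn
    fun q hq => (norm_sub_sphere_pos hq.1 q.2).ne'

lemma contDiffOn_poissonInt {f : Euc n → ℝ} (hf : Continuous f) (x₀ : Euc n) (R : ℝ) :
    ContDiffOn ℝ ∞ (poissonInt f x₀ R) (Metric.ball x₀ R) := by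
  refine contDiffOn_const.mul ?_
  refine contDiffOn_sphere_integral (V := {q | ‖q.1 - (x₀ + R • q.2)‖ ^ 2 ≠ 0})
    (g := fun θ => f (x₀ + R • (θ : Euc n)))
    (F := fun q => ballPoissonKernel x₀ R (x₀ + R • q.2) q.1) ?_ Metric.isOpen_ball ?_ (by fun_prop)
    (contDiffOn_ballPoissonKernel_joint x₀ R)
  · exact isOpen_ne_fun (by fun_prop) (by fun_prop)
  · exact fun x hx θ => (norm_sub_sphere_pos hx θ).ne'

lemma contDiffOn_ballPoissonKernel (x₀ p : Euc n) (R : ℝ) :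
    ContDiffOn ℝ ∞ (ballPoissonKernel x₀ R p) {z | ‖z - p‖ ^ 2 ≠ 0} := by
  unfold ballPoissonKernel
  refine ContDiffOn.mul ?_ ?_
  · exact (contDiff_const.sub ((contDiff_id.sub contDiff_const).norm_sq ℝ)).contDiffOn
  · refine ContDiffOn.rpow_const_of_ne ?_ fun q hq => hq
    exact ContDiff.contDiffOn ((contDiff_id.sub contDiff_const).norm_sq ℝ)

lemma pd_rpow_norm_sub {p z : Euc n} (hz : ‖z - p‖ ^ 2 ≠ 0) (a : ℝ) (j : Fin n) :
    pd j (fun y => (‖y - p‖ ^ 2) ^ a) z =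
      a * (‖z - p‖ ^ 2) ^ (a - 1) * (2 * (z j - p j)) := by
  rw [pd_comp (Real.hasDerivAt_rpow_const (Or.inl hz)) (differentiable_norm_sub_sq p z),
    pd_norm_sub_sq]

lemma differentiableAt_rpow_norm_sub {p z : Euc n} (hz : ‖z - p‖ ^ 2 ≠ 0) (a : ℝ) :
    DifferentiableAt ℝ (fun y => (‖y - p‖ ^ 2) ^ a) z :=
  (differentiable_norm_sub_sq p z).rpow_const (Or.inl hz)

lemma pd_ballPoissonKernel {x₀ p z : Euc n} {R : ℝ} (hz : ‖z - p‖ ^ 2 ≠ 0) (j : Fin n) :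
    pd j (ballPoissonKernel x₀ R p) z =
      (R ^ 2 - ‖z - x₀‖ ^ 2) * (-(n : ℝ) * ((z j - p j) * (‖z - p‖ ^ 2) ^ (-(n : ℝ) / 2 - 1))) +
      (‖z - p‖ ^ 2) ^ (-(n : ℝ) / 2) * (-2 * (z j - x₀ j)) := by
  unfold ballPoissonKernel
  rw [pd_mul ((differentiable_norm_sub_sq x₀ z).const_sub _) (differentiableAt_rpow_norm_sub hz _),
    pd_rpow_norm_sub hz, pd_sub (by fun_prop) (differentiable_norm_sub_sq x₀ z), pd_norm_sub_sq,
    pd_const]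
  ring

/-- A direct computation. The pole being on the sphere enters through the polarization identity `2
(z - p)·(z - x₀) = |z - p|² + |z - x₀|² - R²`, and the exponent `a = -n/2` is what makes the
remaining terms cancel. -/
lemma lap_ballPoissonKernel {x₀ p z : Euc n} {R : ℝ} (hz : ‖z - p‖ ^ 2 ≠ 0) (hp : ‖p - x₀‖ = R) :
    lap (ballPoissonKernel x₀ R p) z = 0 := by
  set a : ℝ := -(n : ℝ) / 2 with ha
  have hU : IsOpen {z : Euc n | ‖z - p‖ ^ 2 ≠ 0} := isOpen_ne_fun (by fun_prop) (by fun_prop)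
  have hq0 : 0 < ‖z - p‖ ^ 2 := lt_of_le_of_ne (by positivity) hz.symm
  set q := ‖z - p‖ ^ 2 with hq
  have e1 : q ^ (a - 1) = q ^ (a - 2) * q := by
    rw [show a - 1 = (a - 2) + 1 by ring, Real.rpow_add_one hz]
  have e2 : q ^ a = q ^ (a - 2) * q ^ 2 := by
    rw [show q ^ a = q ^ ((a - 2) + (2 : ℕ)) by norm_num, Real.rpow_add_natCast hz]
  have h2 : ∀ j, pd j (pd j (ballPoissonKernel x₀ R p)) z =
      (R ^ 2 - ‖z - x₀‖ ^ 2) * (-(n : ℝ) * (q ^ (a - 1) +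
        2 * (a - 1) * q ^ (a - 2) * (z j - p j) ^ 2)) +
      4 * n * q ^ (a - 1) * ((z j - p j) * (z j - x₀ j)) - 2 * q ^ a := by
    intro j
    have heq : pd j (ballPoissonKernel x₀ R p) =ᶠ[𝓝 z] fun z =>
      (R ^ 2 - ‖z - x₀‖ ^ 2) * (-(n : ℝ) * ((z j - p j) * (‖z - p‖ ^ 2) ^ (a - 1))) +
      (‖z - p‖ ^ 2) ^ a * (-2 * (z j - x₀ j)) := by
      filter_upwards [hU.mem_nhds hz] with y hy using pd_ballPoissonKernel hy j
    rw [heq.pd_eq]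
    have d1 : DifferentiableAt ℝ (fun z : Euc n => R ^ 2 - ‖z - x₀‖ ^ 2) z :=
      (differentiable_norm_sub_sq x₀ z).const_sub _
    have d2 := differentiableAt_rpow_norm_sub hz (a - 1)
    have d3 := differentiableAt_rpow_norm_sub hz a
    have d4 := differentiable_coord_sub (p j) j z
    have d5 := differentiable_coord_sub (x₀ j) j z
    have d6 : DifferentiableAt ℝ (fun z : Euc n => (z j - p j) * (‖z - p‖ ^ 2) ^ (a - 1)) z :=
      d4.mul d2
    have d7 : DifferentiableAt ℝ
        (fun z : Euc n => -(n : ℝ) * ((z j - p j) * (‖z - p‖ ^ 2) ^ (a - 1))) z := d6.const_mul _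
    have d8 : DifferentiableAt ℝ (fun z : Euc n => -2 * (z j - x₀ j)) z := d5.const_mul _
    rw [pd_add (f := fun z : Euc n => (R ^ 2 - ‖z - x₀‖ ^ 2) *
        (-(n : ℝ) * ((z j - p j) * (‖z - p‖ ^ 2) ^ (a - 1))))
        (g := fun z : Euc n => (‖z - p‖ ^ 2) ^ a * (-2 * (z j - x₀ j))) (d1.mul d7) (d3.mul d8),
      pd_mul d1 d7, pd_mul d3 d8, pd_const_mul _ d5, pd_const_mul _ d6, pd_mul d4 d2,
      pd_coord_sub_self, pd_coord_sub_self, pd_rpow_norm_sub hz, pd_rpow_norm_sub hz,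
      pd_sub (by fun_prop) (differentiable_norm_sub_sq x₀ z), pd_norm_sub_sq, pd_const]
    rw [show a - 1 - 1 = a - 2 by ring]
    have : (n : ℝ) = -2 * a := by rw [ha]; ring
    rw [← hq, this]
    ring
  rw [lap, Finset.sum_congr rfl fun j _ => h2 j]
  simp only [Finset.sum_add_distrib, Finset.sum_sub_distrib, ← Finset.mul_sum, Finset.sum_const,
    Finset.card_univ, Fintype.card_fin, nsmul_eq_mul]
  have s1 : ∑ j, (z j - p j) ^ 2 = q := by rw [hq, norm_sq_eq_sum]; simp
  have s2 : 2 * ∑ j, (z j - p j) * (z j - x₀ j) = q + ‖z - x₀‖ ^ 2 - R ^ 2 := by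
    rw [hq, ← hp, norm_sq_eq_sum, norm_sq_eq_sum, norm_sq_eq_sum, ← Finset.sum_add_distrib,
      ← Finset.sum_sub_distrib, Finset.mul_sum]
    refine Finset.sum_congr rfl fun j _ => ?_
    simp; ring
  have hn : (n : ℝ) = -2 * a := by rw [ha]; ring
  rw [s1, e1, e2]
  linear_combination (2 * n * (q ^ (a - 2) * q)) * s2 +
    (2 * n * (R ^ 2 - ‖z - x₀‖ ^ 2) * q ^ (a - 2) * q * (-1 / 2)) * hn

lemma norm_pole_sub (x₀ : Euc n) {R : ℝ} (hR : 0 < R) (θ : USphere n) :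
    ‖x₀ + R • (θ : Euc n) - x₀‖ = R := by
  rw [add_sub_cancel_left, norm_smul, USphere.norm_eq, mul_one, Real.norm_eq_abs, abs_of_pos hR]

lemma ball_subset_ne_pole (x₀ : Euc n) (R : ℝ) (θ : USphere n) :
    Metric.ball x₀ R ⊆ {z | ‖z - (x₀ + R • (θ : Euc n))‖ ^ 2 ≠ 0} :=
  fun _ hz => (norm_sub_sphere_pos hz θ).ne'

lemma ballPoissonKernel_center (x₀ : Euc n) {R : ℝ} (hR : 0 < R) (θ : USphere n) :
    ballPoissonKernel x₀ R (x₀ + R • (θ : Euc n)) x₀ = R ^ 2 * (R ^ 2) ^ (-(n : ℝ) / 2) := by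
  rw [ballPoissonKernel, sub_self, norm_zero, norm_sub_rev, norm_pole_sub x₀ hR]; simp

/-- The total mass of the Poisson kernel does not depend on the point. -/
lemma integral_ballPoissonKernel (hn : 1 ≤ n) {x₀ z : Euc n} {R : ℝ} (hz : z ∈ Metric.ball x₀ R) :
    ∫ θ : USphere n, ballPoissonKernel x₀ R (x₀ + R • (θ : Euc n)) z ∂(surf n) =
      (surf n).real univ * (R ^ 2 * (R ^ 2) ^ (-(n : ℝ) / 2)) := by
  have hR := Metric.pos_of_mem_ball hz
  obtain ⟨ξ, s, hs0, hs⟩ : ∃ (ξ : USphere n) (s : ℝ), 0 ≤ s ∧ z = x₀ + s • (ξ : Euc n) := by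
    by_cases h : z = x₀
    · refine ⟨⟨EuclideanSpace.single ⟨0, hn⟩ 1, by simp⟩, 0, le_rfl, by simp [h]⟩
    · have h' : ‖z - x₀‖ ≠ 0 := norm_ne_zero_iff.2 (sub_ne_zero.2 h)
      refine ⟨⟨‖z - x₀‖⁻¹ • (z - x₀), by simp [norm_smul, h']⟩, ‖z - x₀‖, norm_nonneg _, ?_⟩
      simp [smul_smul, h']
  have hsR : s < R := by
    rw [mem_ball_iff_norm, hs, add_sub_cancel_left, norm_smul, USphere.norm_eq, mul_one,
      Real.norm_eq_abs, abs_of_nonneg hs0] at hz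
    exact hz
  -- Since `|sξ - Rθ| = |sθ - Rξ|`, pole and evaluation direction can be exchanged. The integral
  -- over poles becomes a spherical integral of one harmonic function over the sphere of radius `s`,
  -- and the mean value property applies.
  have hsym : ∀ θ : USphere n, ballPoissonKernel x₀ R (x₀ + R • (θ : Euc n)) z =
      ballPoissonKernel x₀ R (x₀ + R • (ξ : Euc n)) (x₀ + s • (θ : Euc n)) := by
    intro θ
    have h1 : ‖s • (ξ : Euc n)‖ ^ 2 = ‖s • (θ : Euc n)‖ ^ 2 := by simp [norm_smul]
    have h2 : ‖s • (ξ : Euc n) - R • (θ : Euc n)‖ ^ 2 =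
        ‖s • (θ : Euc n) - R • (ξ : Euc n)‖ ^ 2 := by
      rw [norm_sub_sq_real, norm_sub_sq_real]
      simp only [norm_smul, inner_smul_left, inner_smul_right, USphere.norm_eq]
      rw [real_inner_comm]
    rw [ballPoissonKernel, ballPoissonKernel, hs, add_sub_cancel_left, add_sub_cancel_left,
      add_sub_add_left_eq_sub, add_sub_add_left_eq_sub, h1, h2]
  simp only [hsym]
  have := sphInt_eq_of_harmonic (f := ballPoissonKernel x₀ R (x₀ + R • (ξ : Euc n))) (x₀ := x₀)
    (R := R) hn ((contDiffOn_ballPoissonKernel x₀ _ R).mono (ball_subset_ne_pole x₀ R ξ))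
    (fun x hx => lap_ballPoissonKernel (norm_sub_sphere_pos hx ξ).ne' (norm_pole_sub x₀ hR ξ))
    ⟨hs0, hsR⟩
  rw [sphInt, ballPoissonKernel_center x₀ hR] at this
  exact this

lemma ballPoissonKernel_nonneg {x₀ z : Euc n} {R : ℝ} (hz : z ∈ Metric.ball x₀ R) (p : Euc n) :
    0 ≤ ballPoissonKernel x₀ R p z := by
  rw [mem_ball_iff_norm] at hz
  refine mul_nonneg ?_ (Real.rpow_nonneg (by positivity) _)
  nlinarith [norm_nonneg (z - x₀)]

lemma continuous_ballPoissonKernel_pole {x₀ z : Euc n} {R : ℝ} (hz : z ∈ Metric.ball x₀ R) :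
    Continuous fun θ : USphere n => ballPoissonKernel x₀ R (x₀ + R • (θ : Euc n)) z := by
  have h := (contDiffOn_ballPoissonKernel_joint x₀ R).continuousOn
  exact h.comp_continuous (f := fun θ : USphere n => (z, (θ : Euc n))) (by fun_prop)
    fun θ => (norm_sub_sphere_pos hz θ).ne'

lemma integrable_sphere_of_continuous {g : USphere n → ℝ} (hg : Continuous g) :
    Integrable g (surf n) :=
  hg.integrable_of_hasCompactSupport (HasCompactSupport.of_compactSpace _)

lemma poisson_normalisation_pos (hn : 1 ≤ n) {R : ℝ} (hR : 0 < R) :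
    0 < (surf n).real univ * (R ^ 2 * (R ^ 2) ^ (-(n : ℝ) / 2)) := by
  have := surf_real_univ_pos hn
  positivity

/-- Lower bound for Poisson integrals of nonnegative functions. -/
lemma le_poissonInt (hn : 1 ≤ n) {f : Euc n → ℝ} (hf : Continuous f) {x₀ z : Euc n} {R : ℝ}
    (hf0 : ∀ θ : USphere n, 0 ≤ f (x₀ + R • (θ : Euc n))) (hz : z ∈ Metric.ball x₀ R) :
    (R ^ 2 - ‖z - x₀‖ ^ 2) / (2 ^ n * R ^ 2) * sphereMean f x₀ R ≤ poissonInt f x₀ R z := by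
  have hR := Metric.pos_of_mem_ball hz
  have hσ := surf_real_univ_pos hn
  have hN := poisson_normalisation_pos hn hR
  have hz' : ‖z - x₀‖ < R := mem_ball_iff_norm.1 hz
  have hD : 0 < R ^ 2 - ‖z - x₀‖ ^ 2 := by nlinarith [norm_nonneg (z - x₀)]
  have hfc : Continuous fun θ : USphere n => f (x₀ + R • (θ : Euc n)) := by fun_prop
  -- The distance from a point of the ball to the sphere's points is at most `2R`; this is the
  -- source of the factor `2 ^ n` and hence of the constant in the theorem.
  have hK : ∀ θ : USphere n, (R ^ 2 - ‖z - x₀‖ ^ 2) * ((2 * R) ^ 2) ^ (-(n : ℝ) / 2) ≤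
      ballPoissonKernel x₀ R (x₀ + R • (θ : Euc n)) z := by
    intro θ
    refine mul_le_mul_of_nonneg_left ?_ hD.le
    refine Real.rpow_le_rpow_of_nonpos (norm_sub_sphere_pos hz θ) ?_ ?_
    · refine pow_le_pow_left₀ (norm_nonneg _) ?_ 2
      have := norm_sub_le (z - x₀) (x₀ + R • (θ : Euc n) - x₀)
      rw [norm_pole_sub x₀ hR, sub_sub_sub_cancel_right] at this
      linarith
    · have : (0 : ℝ) ≤ n := Nat.cast_nonneg n
      linarith
  have hint : ((R ^ 2 - ‖z - x₀‖ ^ 2) * ((2 * R) ^ 2) ^ (-(n : ℝ) / 2)) * sphInt f x₀ R ≤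
      ∫ θ : USphere n, f (x₀ + R • (θ : Euc n)) *
        ballPoissonKernel x₀ R (x₀ + R • (θ : Euc n)) z ∂(surf n) := by
    rw [sphInt, ← integral_const_mul]
    refine integral_mono ((integrable_sphere_of_continuous hfc).const_mul _)
      (integrable_sphere_of_continuous (hfc.mul (continuous_ballPoissonKernel_pole hz))) fun θ => ?_
    simp only
    rw [mul_comm]
    exact mul_le_mul_of_nonneg_left (hK θ) (hf0 θ)
  have e : ((2 * R) ^ 2) ^ (-(n : ℝ) / 2) = (2 ^ n)⁻¹ * (R ^ 2) ^ (-(n : ℝ) / 2) := by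
    rw [mul_pow, Real.mul_rpow (by positivity) (by positivity)]
    congr 1
    rw [← Real.rpow_natCast 2 2, ← Real.rpow_mul (by norm_num), ← Real.rpow_natCast 2 n,
      ← Real.rpow_neg (by norm_num)]
    congr 1; push_cast; ring
  rw [poissonInt, sphereMean_eq]
  refine le_trans (le_of_eq ?_) (mul_le_mul_of_nonneg_left hint (inv_pos.2 hN).le)
  rw [e]
  have : (0 : ℝ) < (R ^ 2) ^ (-(n : ℝ) / 2) := by positivity
  field_simp

/-- Poisson integrals are weakly harmonic. -/
lemma integral_poissonInt_mul_lap {f : Euc n → ℝ} (hf : Continuous f) {x₀ : Euc n} {R : ℝ}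
    (hR : 0 < R) {φ : Euc n → ℝ} (hφ : IsTest (Metric.ball x₀ R) φ) :
    ∫ z, lap φ z * poissonInt f x₀ R z = 0 := by
  have hfc : Continuous fun θ : USphere n => f (x₀ + R • (θ : Euc n)) := by fun_prop
  have hl := hφ.lap
  set H : Euc n × USphere n → ℝ := fun q => lap φ q.1 *
    (f (x₀ + R • (q.2 : Euc n)) * ballPoissonKernel x₀ R (x₀ + R • (q.2 : Euc n)) q.1) with hH
  have hHs : ∀ q, H q ≠ 0 → q ∈ tsupport (lap φ) ×ˢ (univ : Set (USphere n)) := by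
    intro q hq
    refine ⟨subset_tsupport _ (left_ne_zero_of_mul hq), mem_univ _⟩
  have hcl : IsClosed (tsupport (lap φ) ×ˢ (univ : Set (USphere n))) :=
    (isClosed_tsupport _).prod isClosed_univ
  have hts : tsupport H ⊆ tsupport (lap φ) ×ˢ (univ : Set (USphere n)) :=
    closure_minimal hHs hcl
  have hHc : Continuous H := by
    refine ContinuousOn.continuous_of_tsupport_subset (s := Metric.ball x₀ R ×ˢ univ) ?_
      (Metric.isOpen_ball.prod isOpen_univ) (hts.trans (prod_mono hl.3 subset_rfl))
    refine (hl.1.continuous.comp continuous_fst).continuousOn.mul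
      ((hfc.comp continuous_snd).continuousOn.mul
        (continuousOn_ballPoissonKernel_joint x₀ R))
  have hHi : Integrable H ((volume : Measure (Euc n)).prod (surf n)) :=
    hHc.integrable_of_hasCompactSupport
      ((hl.2.isCompact.prod isCompact_univ).of_isClosed_subset (isClosed_tsupport _) hts)
  have e1 : ∀ z, lap φ z * poissonInt f x₀ R z =
      ((surf n).real univ * (R ^ 2 * (R ^ 2) ^ (-(n : ℝ) / 2)))⁻¹ *
        ∫ θ : USphere n, H (z, θ) ∂(surf n) := by
    intro z
    simp only [poissonInt, hH, integral_const_mul]; ring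
  simp only [e1]
  -- By Fubini it suffices to treat a fixed pole, where the kernel is harmonic in the ball.
  rw [integral_const_mul, integral_integral_swap hHi, mul_eq_zero]
  right
  refine integral_eq_zero_of_ae (Eventually.of_forall fun θ => ?_)
  have hk := (contDiffOn_ballPoissonKernel x₀ (x₀ + R • (θ : Euc n)) R).mono
    (ball_subset_ne_pole x₀ R θ)
  have e2 : ∫ z, lap φ z * ballPoissonKernel x₀ R (x₀ + R • (θ : Euc n)) z = 0 := by
    rw [integral_lap_mul Metric.isOpen_ball hφ hk, ← integral_mul_lap Metric.isOpen_ball hφ hk]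
    refine integral_eq_zero_of_ae (Eventually.of_forall fun z => ?_)
    by_cases hz : z ∈ Metric.ball x₀ R
    · simp [lap_ballPoissonKernel (norm_sub_sphere_pos hz θ).ne' (norm_pole_sub x₀ hR θ)]
    · simp [hφ.eq_zero hz]
  simp only [hH, Pi.zero_apply]
  rw [← mul_zero (f (x₀ + R • (θ : Euc n))), ← e2, ← integral_const_mul]
  refine integral_congr_ae (Eventually.of_forall fun z => ?_)
  simp only; ring

/-- Near the sphere, the Poisson integral of `f` is not much larger than `f`. -/
lemma poissonInt_lt_add (hn : 1 ≤ n) {f : Euc n → ℝ} (hf : Continuous f) (x₀ : Euc n) {R : ℝ}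
    (hR : 0 < R) {δ : ℝ} (hδ : 0 < δ) :
    ∃ s, 0 ≤ s ∧ s < R ∧ ∀ z ∈ Metric.ball x₀ R, s < ‖z - x₀‖ →
      poissonInt f x₀ R z < f z + δ := by
  have hN := poisson_normalisation_pos hn hR
  set N := (surf n).real univ * (R ^ 2 * (R ^ 2) ^ (-(n : ℝ) / 2)) with hNdef
  have hcpt := isCompact_closedBall x₀ R
  obtain ⟨M, hM⟩ := hcpt.exists_bound_of_continuousOn hf.continuousOn
  have huc := hcpt.uniformContinuousOn_of_continuous hf.continuousOn
  obtain ⟨η, hη, huc⟩ := Metric.uniformContinuousOn_iff.1 huc (δ / 2) (by positivity)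
  have hM0 : 0 ≤ M := (norm_nonneg _).trans (hM x₀ (Metric.mem_closedBall_self hR.le))
  -- Poles within `η` of `z` are handled by uniform continuity of `f`. `B` controls the others,
  -- where the kernel is at most `(R² - |z - x₀|²) η⁻ⁿ` and `f` exceeds `f z` by at most `2M`; the
  -- factor `R² - |z - x₀|²` makes this contribution small near the sphere.
  set B := (surf n).real univ * (2 * M * (η ^ 2) ^ (-(n : ℝ) / 2)) with hB
  have hlim : Tendsto (fun s : ℝ => N⁻¹ * ((R ^ 2 - s ^ 2) * B)) (𝓝[<] R) (𝓝 0) := by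
    have : Continuous fun s : ℝ => N⁻¹ * ((R ^ 2 - s ^ 2) * B) := by fun_prop
    have h := this.tendsto R
    simp only [sub_self, zero_mul, mul_zero] at h
    exact h.mono_left nhdsWithin_le_nhds
  have hev := (hlim.eventually_lt_const (show (0 : ℝ) < δ / 2 by positivity)).and
    ((Ioo_mem_nhdsLT hR : ∀ᶠ s in 𝓝[<] R, s ∈ Ioo 0 R))
  obtain ⟨s, hs1, hs2⟩ := hev.exists
  refine ⟨s, hs2.1.le, hs2.2, fun z hz hzs => ?_⟩
  have hfc : Continuous fun θ : USphere n => f (x₀ + R • (θ : Euc n)) := by fun_prop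
  have hkc := continuous_ballPoissonKernel_pole hz
  have hz' : ‖z - x₀‖ < R := mem_ball_iff_norm.1 hz
  have hD : 0 < R ^ 2 - ‖z - x₀‖ ^ 2 := by nlinarith [norm_nonneg (z - x₀)]
  have hpt : ∀ θ : USphere n, f (x₀ + R • (θ : Euc n)) *
      ballPoissonKernel x₀ R (x₀ + R • (θ : Euc n)) z ≤
      (f z + δ / 2) * ballPoissonKernel x₀ R (x₀ + R • (θ : Euc n)) z +
        (R ^ 2 - ‖z - x₀‖ ^ 2) * (2 * M * (η ^ 2) ^ (-(n : ℝ) / 2)) := by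
    intro θ
    set p := x₀ + R • (θ : Euc n) with hp
    have hp' : p ∈ Metric.closedBall x₀ R := by
      rw [mem_closedBall_iff_norm, hp, norm_pole_sub x₀ hR]
    have hzc : z ∈ Metric.closedBall x₀ R := Metric.ball_subset_closedBall hz
    have hk0 := ballPoissonKernel_nonneg hz p
    by_cases hd : dist p z < η
    · have := huc p hp' z hzc hd
      rw [Real.dist_eq] at this
      have := (abs_lt.1 this).2
      have h2 : f p * ballPoissonKernel x₀ R p z ≤ (f z + δ / 2) * ballPoissonKernel x₀ R p z :=
        mul_le_mul_of_nonneg_right (by linarith) hk0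
      have : 0 ≤ (R ^ 2 - ‖z - x₀‖ ^ 2) * (2 * M * (η ^ 2) ^ (-(n : ℝ) / 2)) := by positivity
      linarith
    · rw [not_lt, dist_comm, dist_eq_norm] at hd
      have hkk : ballPoissonKernel x₀ R p z ≤
          (R ^ 2 - ‖z - x₀‖ ^ 2) * (η ^ 2) ^ (-(n : ℝ) / 2) := by
        refine mul_le_mul_of_nonneg_left ?_ hD.le
        refine Real.rpow_le_rpow_of_nonpos (by positivity) (pow_le_pow_left₀ hη.le hd 2) ?_
        have : (0 : ℝ) ≤ n := Nat.cast_nonneg n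
        linarith
      have h1 := (abs_le.1 (hM p hp')).2
      have h2 := (abs_le.1 (hM z hzc)).1
      calc f p * ballPoissonKernel x₀ R p z ≤ (f z + δ / 2 + 2 * M) * ballPoissonKernel x₀ R p z :=
            mul_le_mul_of_nonneg_right (by linarith) hk0
        _ = (f z + δ / 2) * ballPoissonKernel x₀ R p z + 2 * M * ballPoissonKernel x₀ R p z := by ring
        _ ≤ (f z + δ / 2) * ballPoissonKernel x₀ R p z +
            2 * M * ((R ^ 2 - ‖z - x₀‖ ^ 2) * (η ^ 2) ^ (-(n : ℝ) / 2)) := by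
            gcongr
        _ = _ := by ring
  have hint : ∫ θ : USphere n, f (x₀ + R • (θ : Euc n)) *
      ballPoissonKernel x₀ R (x₀ + R • (θ : Euc n)) z ∂(surf n) ≤
      (f z + δ / 2) * N + (R ^ 2 - ‖z - x₀‖ ^ 2) * B := by
    have i1 := integrable_sphere_of_continuous hkc
    refine (integral_mono (integrable_sphere_of_continuous (hfc.mul hkc))
      ((i1.const_mul (f z + δ / 2)).add (integrable_const _)) hpt).trans (le_of_eq ?_)
    simp only [Pi.add_apply]
    rw [integral_add (i1.const_mul _) (integrable_const _), integral_const_mul,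
      integral_ballPoissonKernel hn hz, integral_const, smul_eq_mul, hB]
    ring
  rw [poissonInt, ← hNdef]
  have h3 : N⁻¹ * ((f z + δ / 2) * N + (R ^ 2 - ‖z - x₀‖ ^ 2) * B) =
      f z + δ / 2 + N⁻¹ * ((R ^ 2 - ‖z - x₀‖ ^ 2) * B) := by
    field_simp
  have h4 : N⁻¹ * ((R ^ 2 - ‖z - x₀‖ ^ 2) * B) ≤ N⁻¹ * ((R ^ 2 - s ^ 2) * B) := by
    have hB0 : 0 ≤ B := by positivity
    refine mul_le_mul_of_nonneg_left (mul_le_mul_of_nonneg_right ?_ hB0) (inv_pos.2 hN).le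
    have := pow_le_pow_left₀ hs2.1.le hzs.le 2
    linarith
  have h5 := mul_le_mul_of_nonneg_left hint (inv_pos.2 hN).le
  rw [h3] at h5
  linarith

end Poisson
end

/-! ### Mollification and its convergence in `L²`. -/

noncomputable section

section Mollifier

variable {n : ℕ}

/-- Convolution with a kernel, `∫ K(x - y) F(y) dy`. -/
def convK (K F : Euc n → ℝ) (x : Euc n) : ℝ := ∫ y, K (x - y) * F y

lemma convK_eq_convolution (K F : Euc n → ℝ) :
    convK K F = convolution K F (ContinuousLinearMap.mul ℝ ℝ) volume := by
  ext x; rw [convolution_mul_swap]; rfl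

lemma contDiff_convK {K F : Euc n → ℝ} {U : Set (Euc n)} (hK : IsTest U K)
    (hF : LocallyIntegrable F) : ContDiff ℝ ∞ (convK K F) := by
  rw [convK_eq_convolution]
  exact hK.2.contDiff_convolution_left (n := ⊤) _ hK.1 hF

lemma integrable_convK_integrand {K F : Euc n → ℝ} (hK : Continuous K)
    (hKs : HasCompactSupport K) (hF : LocallyIntegrable F) (x : Euc n) :
    Integrable (fun y => K (x - y) * F y) := by
  have h : HasCompactSupport (fun y => K (x - y)) :=
    hKs.comp_homeomorph (Homeomorph.subLeft x)
  have h2 := hF.integrable_smul_left_of_hasCompactSupport (f := F) (g := fun y => K (x - y))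
    (hK.comp (continuous_const.sub continuous_id)) h
  exact h2

lemma pd_convK {K F : Euc n → ℝ} {U : Set (Euc n)} (hK : IsTest U K)
    (hF : LocallyIntegrable F) (j : Fin n) : pd j (convK K F) = convK (pd j K) F := by
  ext x
  have h := hK.2.hasFDerivAt_convolution_left (ContinuousLinearMap.mul ℝ ℝ)
    (hK.1.of_le (by simp)) hF x
  rw [pd, convK_eq_convolution, h.fderiv, convolution_eq_swap, convK,
    ContinuousLinearMap.integral_apply]
  · rfl
  · have := (hK.2.fderiv ℝ).convolutionExists_left (μ := volume)
      ((ContinuousLinearMap.mul ℝ ℝ).precompL (Euc n)) (hK.1.continuous_fderiv (by simp)) hF x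
    exact this.integrable_swap

/-- The reflected and translated kernel `y ↦ K(x - y)`. -/
lemma IsTest.reflect {K : Euc n → ℝ} {r : ℝ} (hK : IsTest (Metric.closedBall 0 r) K)
    (x : Euc n) : IsTest (Metric.closedBall x r) (fun y => K (x - y)) := by
  have hs : HasCompactSupport (fun y => K (x - y)) := hK.2.comp_homeomorph (Homeomorph.subLeft x)
  refine ⟨hK.1.comp (contDiff_const.sub contDiff_id), hs, ?_⟩
  have : tsupport (fun y => K (x - y)) = (Homeomorph.subLeft x) ⁻¹' tsupport K :=
    tsupport_comp_eq_preimage K (Homeomorph.subLeft x)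
  rw [this]
  intro y hy
  have := hK.3 hy
  rw [mem_closedBall_iff_norm, sub_zero] at this
  rw [mem_closedBall_iff_norm, norm_sub_rev]
  exact this

lemma pd_reflect {K : Euc n → ℝ} (hK : Differentiable ℝ K) (x y : Euc n) (j : Fin n) :
    pd j (fun y => K (x - y)) y = -pd j K (x - y) := by
  have h : HasFDerivAt (fun y : Euc n => x - y) (-ContinuousLinearMap.id ℝ (Euc n)) y :=
    (hasFDerivAt_id y).const_sub x
  have := ((hK (x - y)).hasFDerivAt.comp y h).fderiv
  simp only [Function.comp_def] at this
  simp [pd, this]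

lemma lap_reflect {K : Euc n → ℝ} (hK : ContDiff ℝ ∞ K) (x y : Euc n) :
    lap (fun y => K (x - y)) y = lap K (x - y) := by
  refine Finset.sum_congr rfl fun j _ => ?_
  have h : pd j (fun y => K (x - y)) = fun y => -pd j K (x - y) := by
    ext y; exact pd_reflect (hK.differentiable (by simp)) x y j
  rw [h, pd_neg, pd_reflect ((hK.pd j).differentiable (by simp)), neg_neg]

/-- The radial mollification kernel supported in the ball of radius `ε`. -/
def molk (ε : ℝ) (x : Euc n) : ℝ :=
  (∫ y : Euc n, cutoffProfile (ε / 2) ε (‖y‖ ^ 2))⁻¹ * cutoffProfile (ε / 2) ε (‖x‖ ^ 2)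

/-- Mollification at scale `ε`. -/
def moll (ε : ℝ) (F : Euc n → ℝ) : Euc n → ℝ := convK (molk ε) F

variable {ε : ℝ}

lemma isTest_rawBump (hε : 0 < ε) :
    IsTest (Metric.closedBall (0 : Euc n) ε) (fun x => cutoffProfile (ε / 2) ε (‖x‖ ^ 2)) := by
  simpa using isTest_radial_cutoff (x₀ := (0 : Euc n)) (half_pos hε).le (half_lt_self hε)

lemma integral_rawBump_pos (hε : 0 < ε) :
    0 < ∫ y : Euc n, cutoffProfile (ε / 2) ε (‖y‖ ^ 2) := by
  have h := isTest_rawBump (n := n) hε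
  refine h.1.continuous.integral_pos_of_hasCompactSupport_nonneg_nonzero h.2
    (fun x => cutoffProfile_nonneg _ _ _) (x := 0) ?_
  rw [cutoffProfile_eq_one (half_pos hε).le (half_lt_self hε) (by simp; positivity)]
  exact one_ne_zero

lemma isTest_molk (hε : 0 < ε) :
    IsTest (Metric.closedBall (0 : Euc n) ε) (molk ε) := by
  have h := isTest_rawBump (n := n) hε
  exact ⟨contDiff_const.mul h.1, h.2.mul_left, tsupport_mul_subset_right.trans h.3⟩

lemma molk_nonneg (hε : 0 < ε) (x : Euc n) : 0 ≤ molk ε x :=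
  mul_nonneg (inv_pos.2 (integral_rawBump_pos hε)).le (cutoffProfile_nonneg _ _ _)

lemma molk_eq_zero (hε : 0 < ε) {x : Euc n} (hx : ε ≤ ‖x‖) : molk ε x = 0 := by
  rw [molk, cutoffProfile_eq_zero (half_pos hε).le (half_lt_self hε)
    (pow_le_pow_left₀ hε.le hx 2), mul_zero]

lemma integral_molk (hε : 0 < ε) : ∫ x : Euc n, molk ε x = 1 := by
  simp only [molk]
  rw [integral_const_mul, inv_mul_cancel₀ (integral_rawBump_pos hε).ne']

lemma continuous_molk (hε : 0 < ε) : Continuous (molk (n := n) ε) :=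
  (isTest_molk hε).1.continuous

lemma integrable_molk (hε : 0 < ε) : Integrable (molk (n := n) ε) :=
  (isTest_molk hε).integrable

lemma molk_neg (x : Euc n) : molk ε (-x) = molk ε x := by simp [molk]

lemma contDiff_moll (hε : 0 < ε) {F : Euc n → ℝ} (hF : LocallyIntegrable F) :
    ContDiff ℝ ∞ (moll ε F) := contDiff_convK (isTest_molk hε) hF

lemma integrable_moll_integrand (hε : 0 < ε) {F : Euc n → ℝ} (hF : LocallyIntegrable F)
    (x : Euc n) : Integrable (fun y => molk ε (x - y) * F y) :=
  integrable_convK_integrand (continuous_molk hε) (isTest_molk hε).2 hF x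

lemma moll_eq_integral_add (ε : ℝ) (F : Euc n → ℝ) (x : Euc n) :
    moll ε F x = ∫ y, molk ε y * F (x + y) := by
  rw [moll, convK, ← integral_add_left_eq_self (fun y => molk ε (x - y) * F y) x]
  simp [molk_neg]

lemma moll_nonneg (hε : 0 < ε) {F : Euc n → ℝ} (hF : ∀ᵐ x, 0 ≤ F x) (x : Euc n) :
    0 ≤ moll ε F x := by
  refine integral_nonneg_of_ae ?_
  filter_upwards [hF] with y hy using mul_nonneg (molk_nonneg hε _) hy

lemma moll_congr {F G : Euc n → ℝ} (h : F =ᵐ[volume] G) : moll ε F = moll ε G := by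
  ext x
  refine integral_congr_ae ?_
  filter_upwards [h] with y hy
  rw [hy]

lemma locallyIntegrable_of_memLp_two {F : Euc n → ℝ} (hF : MemLp F 2) : LocallyIntegrable F :=
  hF.locallyIntegrable (by norm_num)

/-- Translations act continuously on `L²`. -/
lemma tendsto_eLpNorm_translate_sub {F : Euc n → ℝ} (hF : MemLp F 2) :
    Tendsto (fun y : Euc n => eLpNorm (fun x => F (x + y) - F x) 2 volume) (𝓝 0) (𝓝 0) := by
  set g : Euc n → C(Euc n, Euc n) := fun y => ⟨fun x => x + y, by fun_prop⟩ with hg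
  have hgc : Continuous g :=
    ContinuousMap.continuous_of_continuous_uncurry g (by
      simp only [hg, Function.uncurry_def, ContinuousMap.coe_mk]; fun_prop)
  have hgm : ∀ y, MeasurePreserving (g y) volume volume := fun y =>
    measurePreserving_add_right volume y
  have h0 : g 0 = ContinuousMap.id _ := by ext x; simp [hg]
  have : Fact ((1 : ENNReal) ≤ 2) := ⟨by norm_num⟩
  have h := (continuous_const (y := hF.toLp F)).compMeasurePreservingLp hgc hgm (by norm_num)
  have ht := (tendsto_iff_edist_tendsto_0.1 (h.tendsto 0))
  refine ht.congr fun y => ?_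
  rw [Lp.edist_def]
  refine eLpNorm_congr_ae ?_
  have e1 : ∀ y, Lp.compMeasurePreserving (g y) (hgm y) (hF.toLp F) =ᵐ[volume]
      fun x => F (x + y) := fun y =>
    (Lp.coeFn_compMeasurePreserving _ (hgm y)).trans
      ((hgm y).quasiMeasurePreserving.ae_eq_comp hF.coeFn_toLp)
  filter_upwards [e1 y, e1 0] with x h1 h2
  rw [Pi.sub_apply, h1, h2, add_zero]

/-- Cauchy–Schwarz against the constant `1`, in the role of Jensen's inequality for the measure with
density `molk ε`. -/
lemma sq_lintegral_le {α : Type*} [MeasurableSpace α] {ν : Measure α} (hν : ν univ ≤ 1)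
    {g : α → ENNReal} (hg : AEMeasurable g ν) : (∫⁻ a, g a ∂ν) ^ 2 ≤ ∫⁻ a, g a ^ 2 ∂ν := by
  have h := ENNReal.lintegral_mul_le_Lp_mul_Lq ν Real.HolderConjugate.two_two hg
    (aemeasurable_const (b := (1 : ENNReal)))
  simp only [Pi.mul_apply, mul_one, ENNReal.one_rpow, lintegral_one] at h
  have h2 : (∫⁻ a, g a ∂ν) ≤ (∫⁻ a, g a ^ (2 : ℝ) ∂ν) ^ (1 / 2 : ℝ) := by
    refine h.trans ?_
    calc _ ≤ (∫⁻ a, g a ^ (2 : ℝ) ∂ν) ^ (1 / 2 : ℝ) * 1 := by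
          gcongr
          exact ENNReal.rpow_le_one hν (by norm_num)
      _ = _ := mul_one _
  have h3 := pow_le_pow_left' h2 2
  rw [← ENNReal.rpow_natCast (_ ^ (1 / 2 : ℝ)) 2, ← ENNReal.rpow_mul] at h3
  simpa using h3

lemma eLpNorm_two_sq {α : Type*} [MeasurableSpace α] {ν : Measure α} (f : α → ℝ) :
    eLpNorm f 2 ν ^ 2 = ∫⁻ a, ‖f a‖ₑ ^ 2 ∂ν := by
  have := eLpNorm_nnreal_pow_eq_lintegral (f := f) (μ := ν) (p := 2) (by norm_num)
  simpa using this

/-- The mollifications of an `L²` function converge to it in `L²`. -/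
lemma tendsto_eLpNorm_moll_sub {F : Euc n → ℝ} (hF : MemLp F 2) :
    Tendsto (fun ε : ℝ => eLpNorm (fun x => moll ε F x - F x) 2 volume) (𝓝[>] 0) (𝓝 0) := by
  -- Mollification sees only the a.e. class of `F`, and a measurable representative makes `F (x + y)
  -- - F x` jointly measurable, as Tonelli requires.
  wlog hm : StronglyMeasurable F generalizing F
  · have hae := hF.1.ae_eq_mk
    have h1 := this ((memLp_congr_ae hae).1 hF) hF.1.stronglyMeasurable_mk
    refine h1.congr fun ε => ?_
    refine eLpNorm_congr_ae ?_
    filter_upwards [hae] with x hx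
    rw [moll_congr hae, hx]
  have hloc := locallyIntegrable_of_memLp_two hF
  rw [ENNReal.tendsto_nhds_zero]
  intro η hη
  have h1 := (ENNReal.tendsto_nhds_zero.1 (tendsto_eLpNorm_translate_sub hF)) η hη
  obtain ⟨r, hr, hball⟩ := Metric.eventually_nhds_iff.1 h1
  have hr' : ∀ᶠ ε : ℝ in 𝓝[>] 0, ε ∈ Ioo 0 r := Ioo_mem_nhdsGT hr
  filter_upwards [hr'] with ε hε
  have hε0 : 0 < ε := hε.1
  -- `moll ε F x - F x` is the `ν`-average of `F (x + y) - F x`. Jensen and Tonelli bound its `L²`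
  -- norm by the translation errors with `|y| < ε`, all at most `η`.
  set ν := (volume : Measure (Euc n)).withDensity (fun y => ENNReal.ofReal (molk ε y)) with hν
  have hmk : Measurable fun y : Euc n => ENNReal.ofReal (molk ε y) :=
    (continuous_molk hε0).measurable.ennreal_ofReal
  have hν1 : ν univ ≤ 1 := by
    rw [hν, withDensity_apply _ MeasurableSet.univ, Measure.restrict_univ,
      ← ofReal_integral_eq_lintegral_ofReal (integrable_molk hε0)
        (Eventually.of_forall (molk_nonneg hε0)), integral_molk hε0, ENNReal.ofReal_one]
  have hpt : ∀ x, ‖moll ε F x - F x‖ₑ ^ 2 ≤ ∫⁻ y, ‖F (x + y) - F x‖ₑ ^ 2 ∂ν := by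
    intro x
    have e1 : moll ε F x - F x = ∫ y, molk ε y * (F (x + y) - F x) := by
      have i1 : Integrable (fun y => molk ε y * F (x + y)) := by
        have := (integrable_moll_integrand hε0 hloc x).comp_add_left x
        simpa [molk_neg] using this
      have i2 := (integrable_molk (n := n) hε0).mul_const (F x)
      simp only [mul_sub]
      rw [integral_sub i1 i2, moll_eq_integral_add, integral_mul_const, integral_molk hε0,
        one_mul]
    have e2 : ‖moll ε F x - F x‖ₑ ≤ ∫⁻ y, ‖F (x + y) - F x‖ₑ ∂ν := by
      rw [e1]
      refine (enorm_integral_le_lintegral_enorm _).trans (le_of_eq ?_)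
      rw [hν, lintegral_withDensity_eq_lintegral_mul _ hmk]
      · refine lintegral_congr fun y => ?_
        rw [enorm_mul, Pi.mul_apply, Real.enorm_of_nonneg (molk_nonneg hε0 y)]
      · exact ((hm.measurable.comp (measurable_const_add x)).sub_const _).enorm
    refine (pow_le_pow_left' e2 2).trans (sq_lintegral_le hν1 ?_)
    exact ((hm.measurable.comp (measurable_const_add x)).sub_const _).enorm.aemeasurable
  have hsq : eLpNorm (fun x => moll ε F x - F x) 2 volume ^ 2 ≤ η ^ 2 := by
    rw [eLpNorm_two_sq]
    refine (lintegral_mono hpt).trans ?_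
    have hsf : SFinite ν := by rw [hν]; infer_instance
    rw [lintegral_lintegral_swap]
    · calc ∫⁻ y, ∫⁻ x, ‖F (x + y) - F x‖ₑ ^ 2 ∂volume ∂ν
          ≤ ∫⁻ y, η ^ 2 ∂ν := by
            rw [hν, lintegral_withDensity_eq_lintegral_mul₀' hmk.aemeasurable,
              lintegral_withDensity_eq_lintegral_mul₀' hmk.aemeasurable]
            · refine lintegral_mono fun y => ?_
              simp only [Pi.mul_apply]
              by_cases hy : ε ≤ ‖y‖
              · simp [molk_eq_zero hε0 hy]
              · gcongr
                rw [← eLpNorm_two_sq]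
                have := hball (y := y) (by rw [dist_zero_right]; linarith [hε.2])
                gcongr
            · exact aemeasurable_const
            · refine Measurable.aemeasurable (Measurable.lintegral_prod_right ?_)
              have : Measurable fun p : Euc n × Euc n => F (p.2 + p.1) - F p.2 :=
                (hm.measurable.comp (measurable_snd.add measurable_fst)).sub
                  (hm.measurable.comp measurable_snd)
              exact this.enorm.pow_const 2
        _ ≤ η ^ 2 := by
            rw [lintegral_const]
            calc η ^ 2 * ν univ ≤ η ^ 2 * 1 := by gcongr
              _ = _ := mul_one _
    · have : Measurable fun p : Euc n × Euc n => F (p.1 + p.2) - F p.1 :=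
        (hm.measurable.comp (measurable_fst.add measurable_snd)).sub
          (hm.measurable.comp measurable_fst)
      exact (this.enorm.pow_const 2).aemeasurable
  exact (ENNReal.pow_le_pow_left_iff two_ne_zero).1 hsq

end Mollifier
end

/-! ### Distributional subharmonicity, ball averages and pointwise values. -/

noncomputable section

section WeakSubharmonic

variable {n : ℕ} {Ω : Set (Euc n)} {f : Euc n → ℝ} {x : Euc n}

/-- `f` is subharmonic in `Ω` in the sense of distributions. -/
def WeaklySubharmonic (Ω : Set (Euc n)) (f : Euc n → ℝ) : Prop :=
  ∀ φ, IsTest Ω φ → (∀ x, 0 ≤ φ x) → 0 ≤ ∫ x in Ω, f x * lap φ x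

lemma exists_closedBall_subset (hΩ : IsOpen Ω) {r : ℝ} (hr : 0 ≤ r)
    (h : Metric.closedBall x r ⊆ Ω) : ∃ η > 0, Metric.closedBall x (r + η) ⊆ Ω := by
  obtain ⟨η, hη, hs⟩ := (isCompact_closedBall x r).exists_cthickening_subset_open hΩ h
  rw [cthickening_closedBall hη.le hr, add_comm] at hs
  exact ⟨η, hη, hs⟩

lemma closedBall_subset_of_mem {y : Euc n} {r s t : ℝ} (hy : y ∈ Metric.closedBall x r)
    (h : Metric.closedBall x t ⊆ Ω) (hst : r + s ≤ t) : Metric.closedBall y s ⊆ Ω := by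
  refine (Metric.closedBall_subset_closedBall' ?_).trans h
  rw [Metric.mem_closedBall] at hy
  linarith

lemma memLp_ext (hΩ : IsOpen Ω) (hf : MemLp f 2 (volume.restrict Ω)) :
    MemLp (Ω.indicator f) 2 :=
  (memLp_indicator_iff_restrict hΩ.measurableSet).2 hf

lemma integral_mul_indicator (hΩ : IsOpen Ω) (f g : Euc n → ℝ) :
    ∫ x, g x * Ω.indicator f x = ∫ x in Ω, f x * g x := by
  rw [← integral_indicator hΩ.measurableSet]
  refine integral_congr_ae (Eventually.of_forall fun x => ?_)
  by_cases hx : x ∈ Ω <;> simp [hx, mul_comm]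

/-- Mollification commutes with weak differentiation. -/
lemma pd_moll (hΩ : IsOpen Ω) {G : Euc n → Euc n} (hf : MemLp f 2 (volume.restrict Ω))
    (hG : IsWeakGradient Ω f G) {ε : ℝ} (hε : 0 < ε) (hx : Metric.closedBall x ε ⊆ Ω)
    (j : Fin n) :
    pd j (moll ε (Ω.indicator f)) x = moll ε (Ω.indicator fun y => G y j) x := by
  have hk := isTest_molk (n := n) hε
  have hloc := locallyIntegrable_of_memLp_two (memLp_ext hΩ hf)
  have hr := (hk.reflect x).mono hx
  have h := hG _ hr.1 hr.2 hr.3 j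
  simp only [gradient_apply_eq_pd, pd_reflect (hk.1.differentiable (by simp)), mul_neg] at h
  rw [integral_neg, neg_inj] at h
  rw [moll, pd_convK hk hloc, moll, convK, convK, integral_mul_indicator hΩ,
    integral_mul_indicator hΩ, h]

/-- The Laplacian falls on the kernel, so the value at `x` is the distributional Laplacian of `f`
tested against `y ↦ molk ε (x - y)`, an admissible nonnegative test function because the closed
`ε`-ball lies in `Ω`. -/
lemma lap_moll_nonneg (hΩ : IsOpen Ω) (hf : MemLp f 2 (volume.restrict Ω))
    (hsub : WeaklySubharmonic Ω f) {ε : ℝ} (hε : 0 < ε) (hx : Metric.closedBall x ε ⊆ Ω) :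
    0 ≤ lap (moll ε (Ω.indicator f)) x := by
  have hk := isTest_molk (n := n) hε
  have hloc := locallyIntegrable_of_memLp_two (memLp_ext hΩ hf)
  have hr := (hk.reflect x).mono hx
  have e : lap (moll ε (Ω.indicator f)) x = ∫ y in Ω, f y * lap (fun y => molk ε (x - y)) y := by
    simp only [lap_reflect hk.1]
    rw [← integral_mul_indicator hΩ]
    simp only [lap, moll, Finset.sum_mul]
    rw [integral_finsetSum]
    · refine Finset.sum_congr rfl fun j _ => ?_
      rw [pd_convK hk hloc, pd_convK (hk.pd j) hloc, convK]
    · intro j _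
      exact integrable_convK_integrand ((hk.pd j).pd j).1.continuous ((hk.pd j).pd j).2 hloc x
  rw [e]
  exact hsub _ hr fun y => molk_nonneg hε _

/-- Means with respect to a radial kernel are nondecreasing in the scale. -/
lemma radial_mean_mono (hn : 1 ≤ n) {g : Euc n → ℝ} {R : ℝ}
    (hg : ContDiffOn ℝ ∞ g (Metric.ball x R)) (hlap : ∀ y ∈ Metric.ball x R, 0 ≤ lap g y)
    {k : Euc n → ℝ} {κ : ℝ → ℝ} (hk : ∀ y, k y = κ ‖y‖) (hk0 : ∀ y, 0 ≤ k y)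
    (hki : Integrable k) {L : ℝ} (hkL : ∀ y, L < ‖y‖ → k y = 0) {ρ₁ ρ₂ : ℝ}
    (h1 : 0 ≤ ρ₁) (h12 : ρ₁ ≤ ρ₂) (h2 : ρ₂ * L < R) :
    ∫ y, k y * g (x + ρ₁ • y) ≤ ∫ y, k y * g (x + ρ₂ • y) := by
  have hint : ∀ ρ, 0 ≤ ρ → ρ ≤ ρ₂ → Integrable (fun y => k y * g (x + ρ • y)) := by
    intro ρ h0 hρ
    refine (integrableOn_iff_integrable_of_support_subset
      (s := Metric.closedBall (0 : Euc n) L) ?_).1 ?_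
    · intro y hy
      rw [mem_closedBall_zero_iff]
      by_contra! h
      exact hy (by simp [hkL y h])
    · refine hki.integrableOn.mul_continuousOn ?_ (isCompact_closedBall _ _)
      refine hg.continuousOn.comp (Continuous.continuousOn (by fun_prop)) fun y hy => ?_
      rw [mem_closedBall_zero_iff] at hy
      rw [mem_ball_iff_norm, add_sub_cancel_left, norm_smul, Real.norm_eq_abs, abs_of_nonneg h0]
      exact (mul_le_mul hρ hy (norm_nonneg _) (h0.trans hρ)).trans_lt h2
  obtain ⟨i1, e1⟩ := integrable_and_integral_polar hn (hint ρ₁ h1 h12)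
  obtain ⟨i2, e2⟩ := integrable_and_integral_polar hn (hint ρ₂ (h1.trans h12) le_rfl)
  rw [e1, e2]
  refine setIntegral_mono_on i1 i2 measurableSet_Ioi fun t ht => ?_
  have ht0 : (0 : ℝ) < t := ht
  -- A radial kernel is constant on each sphere, so in polar coordinates the claim reduces to
  -- comparing spherical integrals at radii `ρ₁ t ≤ ρ₂ t`.
  have hs : ∀ ρ, sphInt (fun y => k y * g (x + ρ • y)) 0 t = κ t * sphInt g x (ρ * t) := by
    intro ρ
    rw [sphInt, sphInt, ← integral_const_mul]
    refine integral_congr_ae (Eventually.of_forall fun θ => ?_)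
    simp [hk, norm_smul, abs_of_pos ht0, smul_smul]
  rw [hs, hs]
  refine mul_le_mul_of_nonneg_left ?_ (pow_nonneg ht0.le _)
  have ⟨θ⟩ : Nonempty (USphere n) := ⟨⟨EuclideanSpace.single ⟨0, hn⟩ 1, by simp⟩⟩
  have hkt : κ t = k (t • (θ : Euc n)) := by simp [hk, norm_smul, abs_of_pos ht0]
  by_cases htL : L < t
  · rw [hkt, hkL _ (by simpa [norm_smul, abs_of_pos ht0] using htL)]; simp
  · rw [not_lt] at htL
    refine mul_le_mul_of_nonneg_left ?_ (hkt ▸ hk0 _)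
    have h3 : ρ₁ * t ≤ ρ₂ * t := mul_le_mul_of_nonneg_right h12 ht0.le
    have h4 : ρ₂ * t < R := (mul_le_mul_of_nonneg_left htL (h1.trans h12)).trans_lt h2
    exact monotoneOn_sphInt hn hg hlap ⟨by positivity, h3.trans_lt h4⟩
      ⟨by have := h1.trans h12; positivity, h4⟩ h3

/-- Monotonicity of radial means between scale `0`, where the mean is the value at the centre
because the kernel has mass one, and scale `1`, where it is the mollification. -/
lemma le_moll_of_subharmonic (hn : 1 ≤ n) {g : Euc n → ℝ} {R : ℝ}
    (hg : ContDiffOn ℝ ∞ g (Metric.ball x R)) (hlap : ∀ y ∈ Metric.ball x R, 0 ≤ lap g y)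
    {ε : ℝ} (hε : 0 < ε) (hεR : ε < R) : g x ≤ moll ε g x := by
  have h := radial_mean_mono hn hg hlap (k := molk ε) (κ := fun t =>
    (∫ y : Euc n, cutoffProfile (ε / 2) ε (‖y‖ ^ 2))⁻¹ * cutoffProfile (ε / 2) ε (t ^ 2))
    (fun y => rfl) (molk_nonneg hε) (integrable_molk hε)
    (fun y hy => molk_eq_zero hε hy.le) (ρ₁ := 0) (ρ₂ := 1) le_rfl zero_le_one
    (by simpa using hεR)
  simp only [zero_smul, add_zero, one_smul] at h
  rwa [integral_mul_const, integral_molk hε, one_mul, ← moll_eq_integral_add] at h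

lemma setAverage_ball_eq (hn : 1 ≤ n) (g : Euc n → ℝ) (x : Euc n) {ρ : ℝ} (hρ : 0 < ρ) :
    ⨍ y in Metric.ball x ρ, g y = (volume.real (Metric.ball (0 : Euc n) 1))⁻¹ *
      ∫ y, (Metric.ball (0 : Euc n) 1).indicator (fun _ => 1) y * g (x + ρ • y) := by
  have : Nonempty (Fin n) := ⟨⟨0, hn⟩⟩
  have : Nontrivial (Euc n) := inferInstance
  have e1 : ∀ y, (Metric.ball (0 : Euc n) 1).indicator (fun _ => (1 : ℝ)) y * g (x + ρ • y) =
      (Metric.ball x ρ).indicator g (x + ρ • y) := by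
    intro y
    have : x + ρ • y ∈ Metric.ball x ρ ↔ y ∈ Metric.ball (0 : Euc n) 1 := by
      rw [mem_ball_iff_norm, add_sub_cancel_left, norm_smul, Real.norm_eq_abs, abs_of_pos hρ,
        mem_ball_zero_iff, mul_lt_iff_lt_one_right hρ]
    by_cases hy : y ∈ Metric.ball (0 : Euc n) 1
    · rw [indicator_of_mem hy, indicator_of_mem (this.2 hy), one_mul]
    · rw [indicator_of_notMem hy, indicator_of_notMem (fun h => hy (this.1 h)), zero_mul]
  simp only [e1]
  rw [Measure.integral_comp_smul volume (fun y => (Metric.ball x ρ).indicator g (x + y)),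
    integral_add_left_eq_self, integral_indicator measurableSet_ball, setAverage_eq, measureReal_def,
    Measure.addHaar_ball volume x hρ.le, ENNReal.toReal_mul, ENNReal.toReal_ofReal (by positivity),
    ← measureReal_def, abs_of_pos (by positivity), mul_inv, smul_eq_mul, smul_eq_mul]
  ring

lemma setAverage_ball_mono_of_subharmonic (hn : 1 ≤ n) {g : Euc n → ℝ} {R : ℝ}
    (hg : ContDiffOn ℝ ∞ g (Metric.ball x R)) (hlap : ∀ y ∈ Metric.ball x R, 0 ≤ lap g y)
    {ρ₁ ρ₂ : ℝ} (h1 : 0 < ρ₁) (h12 : ρ₁ ≤ ρ₂) (h2 : ρ₂ < R) :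
    ⨍ y in Metric.ball x ρ₁, g y ≤ ⨍ y in Metric.ball x ρ₂, g y := by
  rw [setAverage_ball_eq hn g x h1, setAverage_ball_eq hn g x (h1.trans_le h12)]
  refine mul_le_mul_of_nonneg_left ?_ (inv_nonneg.2 measureReal_nonneg)
  refine radial_mean_mono hn hg hlap (κ := fun t => if t < 1 then 1 else 0) ?_ ?_ ?_ (L := 1) ?_
    h1.le h12 (by simpa using h2)
  · intro y; simp [indicator]
  · exact fun y => indicator_nonneg (fun _ _ => zero_le_one) y
  · exact (integrable_indicator_iff measurableSet_ball).2 (integrableOn_const (by finiteness))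
  · intro y hy
    rw [indicator_of_notMem]
    rw [mem_ball_zero_iff, not_lt]; exact hy.le

/-- Strong `L²` convergence implies weak convergence, by Hölder. Identities and inequalities for
mollifications or test functions pass to the limit through pairings of this kind. -/
lemma tendsto_integral_mul_of_tendsto_eLpNorm {ι : Type*} {l : Filter ι} {g : ι → Euc n → ℝ}
    {F k : Euc n → ℝ} {μ : Measure (Euc n)} (hF : MemLp F 2 μ) (hk : MemLp k 2 μ)
    (hg : ∀ᶠ i in l, AEStronglyMeasurable (g i) μ)
    (h : Tendsto (fun i => eLpNorm (fun x => g i x - F x) 2 μ) l (𝓝 0)) :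
    Tendsto (fun i => ∫ x, k x * g i x ∂μ) l (𝓝 (∫ x, k x * F x ∂μ)) := by
  have hfin : eLpNorm k 2 μ ≠ ⊤ := hk.2.ne
  have h2 : Tendsto (fun i => eLpNorm k 2 μ * eLpNorm (fun x => g i x - F x) 2 μ) l (𝓝 0) := by
    have := ENNReal.Tendsto.const_mul (a := eLpNorm k 2 μ) h (Or.inr hfin)
    rwa [mul_zero] at this
  rw [tendsto_iff_edist_tendsto_0]
  refine tendsto_of_tendsto_of_tendsto_of_le_of_le' tendsto_const_nhds h2
    (Eventually.of_forall fun _ => zero_le) ?_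
  filter_upwards [hg, h.eventually_lt_const (zero_lt_one)] with i hm hlt
  have hd : MemLp (fun x => g i x - F x) 2 μ := ⟨hm.sub hF.1, hlt.trans ENNReal.one_lt_top⟩
  have hgi : MemLp (g i) 2 μ := by
    have := hd.add hF
    refine (memLp_congr_ae (Eventually.of_forall fun x => ?_)).1 this
    simp
  have i1 : Integrable (fun x => k x * g i x) μ := hk.integrable_mul hgi
  have i2 : Integrable (fun x => k x * F x) μ := hk.integrable_mul hF
  have h3 : eLpNorm (fun x => k x * (g i x - F x)) 1 μ ≤
      eLpNorm k 2 μ * eLpNorm (fun x => g i x - F x) 2 μ :=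
    eLpNorm_smul_le_mul_eLpNorm (p := 2) (q := 2) (r := 1) (f := fun x => g i x - F x) (φ := k)
      hd.1 hk.1
  rw [edist_eq_enorm_sub, ← integral_sub i1 i2]
  simp only [← mul_sub]
  rw [eLpNorm_one_eq_lintegral_enorm] at h3
  exact (enorm_integral_le_lintegral_enorm _).trans h3

lemma tendsto_integral_mul_moll {F k : Euc n → ℝ} (hF : MemLp F 2) (hk : MemLp k 2) :
    Tendsto (fun ε : ℝ => ∫ x, k x * moll ε F x) (𝓝[>] 0) (𝓝 (∫ x, k x * F x)) := by
  refine tendsto_integral_mul_of_tendsto_eLpNorm hF hk ?_ (tendsto_eLpNorm_moll_sub hF)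
  filter_upwards [self_mem_nhdsWithin] with ε hε
  exact (contDiff_moll hε (locallyIntegrable_of_memLp_two hF)).continuous.aestronglyMeasurable

lemma IsTest.memLp {U : Set (Euc n)} {g : Euc n → ℝ} (hg : IsTest U g) (p : ENNReal) : MemLp g p :=
  hg.1.continuous.memLp_of_hasCompactSupport hg.2

/-- The smooth case applies to the mollifications, which are subharmonic on a slightly larger ball;
averages converge because averaging is a pairing with an `L²` indicator. -/
lemma setAverage_ball_mono (hn : 1 ≤ n) (hΩ : IsOpen Ω) (hf : MemLp f 2 (volume.restrict Ω))
    (hsub : WeaklySubharmonic Ω f) {ρ₁ ρ₂ : ℝ} (h1 : 0 < ρ₁) (h12 : ρ₁ ≤ ρ₂)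
    (h2 : Metric.closedBall x ρ₂ ⊆ Ω) :
    ⨍ y in Metric.ball x ρ₁, f y ≤ ⨍ y in Metric.ball x ρ₂, f y := by
  obtain ⟨η, hη, hball⟩ := exists_closedBall_subset hΩ (h1.le.trans h12) h2
  have hF := memLp_ext hΩ hf
  have hlim : ∀ ρ, ρ ≤ ρ₂ →
      Tendsto (fun ε : ℝ => ⨍ y in Metric.ball x ρ, moll ε (Ω.indicator f) y) (𝓝[>] 0)
        (𝓝 (⨍ y in Metric.ball x ρ, f y)) := by
    intro ρ hρ
    have hk : MemLp ((Metric.ball x ρ).indicator fun _ => (1 : ℝ)) 2 :=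
      memLp_indicator_const 2 measurableSet_ball 1 (Or.inr (by finiteness))
    have e : ∀ g : Euc n → ℝ, ⨍ y in Metric.ball x ρ, g y =
        (volume.real (Metric.ball x ρ))⁻¹ *
          ∫ y, (Metric.ball x ρ).indicator (fun _ => (1 : ℝ)) y * g y := by
      intro g
      rw [setAverage_eq, smul_eq_mul, ← integral_indicator measurableSet_ball]
      congr 1
      refine integral_congr_ae (Eventually.of_forall fun y => ?_)
      by_cases hy : y ∈ Metric.ball x ρ <;> simp [hy]
    have e2 : ⨍ y in Metric.ball x ρ, f y = ⨍ y in Metric.ball x ρ, Ω.indicator f y := by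
      rw [setAverage_eq, setAverage_eq]
      congr 1
      refine setIntegral_congr_fun measurableSet_ball fun y hy => ?_
      have : y ∈ Ω := h2 ((Metric.ball_subset_closedBall.trans
        (Metric.closedBall_subset_closedBall hρ)) hy)
      simp [this]
    rw [e2]
    simp only [e]
    exact (tendsto_integral_mul_moll hF hk).const_mul _
  refine le_of_tendsto_of_tendsto (hlim ρ₁ h12) (hlim ρ₂ le_rfl) ?_
  filter_upwards [Ioo_mem_nhdsGT (half_pos hη)] with ε hε
  refine setAverage_ball_mono_of_subharmonic hn (R := ρ₂ + η / 2)
    (contDiff_moll hε.1 (locallyIntegrable_of_memLp_two hF)).contDiffOn ?_ h1 h12 (by linarith)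
  intro y hy
  refine lap_moll_nonneg hΩ hf hsub hε.1 (closedBall_subset_of_mem
    (Metric.ball_subset_closedBall hy) hball ?_)
  linarith [hε.2]

/-- `L²` convergence gives convergence in measure, hence an a.e. convergent subsequence of scales.
-/
lemma exists_seq_tendsto_zero_ae {F : Euc n → ℝ} (hF : MemLp F 2) :
    ∃ u : ℕ → ℝ, Tendsto u atTop (𝓝[>] 0) ∧ (∀ k, 0 < u k) ∧
      ∀ᵐ x, Tendsto (fun k => moll (u k) F x) atTop (𝓝 (F x)) := by
  obtain ⟨v, -, hv0, hv⟩ := exists_seq_strictAnti_tendsto (0 : ℝ)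
  have hv' : Tendsto v atTop (𝓝[>] 0) :=
    tendsto_nhdsWithin_iff.2 ⟨hv, Eventually.of_forall hv0⟩
  have hloc := locallyIntegrable_of_memLp_two hF
  have hm : TendstoInMeasure volume (fun k => moll (v k) F) atTop F :=
    tendstoInMeasure_of_tendsto_eLpNorm (p := 2) two_ne_zero
      (fun k => (contDiff_moll (hv0 k) hloc).continuous.aestronglyMeasurable) hF.1
      ((tendsto_eLpNorm_moll_sub hF).comp hv')
  obtain ⟨ns, hns, hae⟩ := hm.exists_seq_tendsto_ae
  exact ⟨v ∘ ns, hv'.comp hns.tendsto_atTop, fun k => hv0 _, hae⟩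

/-- Mollification does not decrease a subharmonic function. -/
lemma ae_le_moll (hn : 1 ≤ n) (hΩ : IsOpen Ω) (hf : MemLp f 2 (volume.restrict Ω))
    (hsub : WeaklySubharmonic Ω f) {ε : ℝ} (hε : 0 < ε) :
    ∀ᵐ x, Metric.closedBall x ε ⊆ Ω → f x ≤ moll ε (Ω.indicator f) x := by
  have hF := memLp_ext hΩ hf
  have hloc := locallyIntegrable_of_memLp_two hF
  obtain ⟨u, hu, hu0, hae⟩ := exists_seq_tendsto_zero_ae hF
  filter_upwards [hae] with x hx hball
  have hxΩ : x ∈ Ω := hball (Metric.mem_closedBall_self hε.le)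
  obtain ⟨η, hη, hball'⟩ := exists_closedBall_subset hΩ hε.le hball
  rw [indicator_of_mem hxΩ] at hx
  -- The function is first smoothed at the small scale `u k`, where the pointwise inequality between
  -- it and its `ε`-mollification is known; then `k → ∞`, using a.e. convergence on the left and
  -- weak convergence on the right.
  have hlim : Tendsto (fun k => moll ε (moll (u k) (Ω.indicator f)) x) atTop
      (𝓝 (moll ε (Ω.indicator f) x)) :=
    (tendsto_integral_mul_moll hF (((isTest_molk hε).reflect x).memLp 2)).comp hu
  refine le_of_tendsto_of_tendsto hx hlim ?_
  filter_upwards [hu.eventually (Ioo_mem_nhdsGT (half_pos hη))] with k hk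
  refine le_moll_of_subharmonic hn (R := ε + η / 2)
    (contDiff_moll (hu0 k) hloc).contDiffOn ?_ hε (by linarith)
  intro y hy
  refine lap_moll_nonneg hΩ hf hsub (hu0 k) (closedBall_subset_of_mem
    (Metric.ball_subset_closedBall hy) hball' ?_)
  linarith [hk.2]

/-- The limit of ball averages of a subharmonic function is dominated by the mollifications. -/
lemma precise_le_moll (hn : 1 ≤ n) (hΩ : IsOpen Ω) (hf : MemLp f 2 (volume.restrict Ω))
    (hsub : WeaklySubharmonic Ω f) {ε : ℝ} (hε : 0 < ε) (hx : Metric.closedBall x ε ⊆ Ω) {c : ℝ}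
    (hc : Tendsto (fun ρ : ℝ => ⨍ y in Metric.ball x ρ, f y) (𝓝[>] 0) (𝓝 c)) :
    c ≤ moll ε (Ω.indicator f) x := by
  have hF := memLp_ext hΩ hf
  have hloc := locallyIntegrable_of_memLp_two hF
  obtain ⟨η, hη, hball⟩ := exists_closedBall_subset hΩ hε.le hx
  refine le_of_forall_gt fun b hb => ?_
  obtain ⟨b', hb', hb'b⟩ := exists_between hb
  refine lt_of_le_of_lt ?_ hb'b
  -- The bound of `f` by its mollification is only a.e., but it can be averaged over small balls
  -- around `x`, where continuity keeps the mollification below `b'`.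
  have hev := (contDiff_moll hε hloc).continuous.continuousAt.eventually_lt_const hb'
  obtain ⟨r, hr, hrb⟩ := Metric.eventually_nhds_iff_ball.1 hev
  refine le_of_tendsto hc ?_
  filter_upwards [Ioo_mem_nhdsGT (lt_min hr hη)] with ρ hρ
  have hρr := hρ.2.trans_le (min_le_left _ _)
  have hρη := hρ.2.trans_le (min_le_right _ _)
  have hsubΩ : Metric.ball x ρ ⊆ Ω := (Metric.ball_subset_closedBall.trans
    (Metric.closedBall_subset_closedBall (by linarith))).trans hball
  have hpos : 0 < volume.real (Metric.ball x ρ) :=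
    ENNReal.toReal_pos (Metric.measure_ball_pos volume x hρ.1).ne' (by finiteness)
  have : IsFiniteMeasure (volume.restrict (Metric.ball x ρ)) := ⟨by
    rw [Measure.restrict_apply_univ]; exact measure_ball_lt_top⟩
  have hfi : IntegrableOn f (Metric.ball x ρ) :=
    ((hf.mono_measure (Measure.restrict_mono hsubΩ le_rfl)).integrable (by norm_num))
  rw [setAverage_eq, smul_eq_mul, inv_mul_le_iff₀ hpos]
  calc ∫ y in Metric.ball x ρ, f y ≤ ∫ y in Metric.ball x ρ, b' := by
        refine setIntegral_mono_on_ae hfi (integrableOn_const (by finiteness)) measurableSet_ball ?_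
        filter_upwards [ae_le_moll hn hΩ hf hsub hε] with y hy hyb
        refine (hy (closedBall_subset_of_mem (Metric.ball_subset_closedBall hyb) hball
          (by linarith))).trans (hrb y (Metric.ball_subset_ball hρr.le hyb)).le
    _ = _ := by rw [setIntegral_const, smul_eq_mul]

/-- Ball averages of nonnegative subharmonic functions converge at every point. -/
lemma exists_tendsto_setAverage_ball (hn : 1 ≤ n) (hΩ : IsOpen Ω)
    (hf : MemLp f 2 (volume.restrict Ω)) (hsub : WeaklySubharmonic Ω f)
    (hf0 : ∀ᵐ y ∂(volume.restrict Ω), 0 ≤ f y) (hx : x ∈ Ω) :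
    ∃ c, 0 ≤ c ∧ Tendsto (fun ρ : ℝ => ⨍ y in Metric.ball x ρ, f y) (𝓝[>] 0) (𝓝 c) := by
  obtain ⟨r, hr, hball⟩ := Metric.nhds_basis_closedBall.mem_iff.1 (hΩ.mem_nhds hx)
  have hnn : ∀ ρ ∈ Ioo 0 r, 0 ≤ ⨍ y in Metric.ball x ρ, f y := by
    intro ρ hρ
    rw [setAverage_eq]
    refine smul_nonneg (inv_nonneg.2 measureReal_nonneg) (integral_nonneg_of_ae ?_)
    refine ae_restrict_of_ae_restrict_of_subset ?_ hf0
    exact (Metric.ball_subset_closedBall.trans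
      (Metric.closedBall_subset_closedBall hρ.2.le)).trans hball
  have hmono : MonotoneOn (fun ρ : ℝ => ⨍ y in Metric.ball x ρ, f y) (Ioo 0 r) := by
    intro a ha b hb hab
    exact setAverage_ball_mono hn hΩ hf hsub ha.1 hab
      ((Metric.closedBall_subset_closedBall hb.2.le).trans hball)
  have hlim := hmono.tendsto_nhdsWithin_Ioo_right (nonempty_Ioo.2 hr)
    ⟨0, by rintro _ ⟨ρ, hρ, rfl⟩; exact hnn ρ hρ⟩
  refine ⟨_, ge_of_tendsto hlim ?_, hlim⟩
  filter_upwards [Ioo_mem_nhdsGT hr] with ρ hρ using hnn ρ hρ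

/-- Lebesgue's differentiation theorem for open balls. -/
lemma ae_tendsto_setAverage_ball (hn : 1 ≤ n) (hΩ : IsOpen Ω)
    (hf : MemLp f 2 (volume.restrict Ω)) :
    ∀ᵐ x ∂(volume.restrict Ω),
      Tendsto (fun ρ : ℝ => ⨍ y in Metric.ball x ρ, f y) (𝓝[>] 0) (𝓝 (f x)) := by
  have : Nonempty (Fin n) := ⟨⟨0, hn⟩⟩
  have : Nontrivial (Euc n) := inferInstance
  have hloc := locallyIntegrable_of_memLp_two (memLp_ext hΩ hf)
  rw [ae_restrict_iff' hΩ.measurableSet]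
  filter_upwards [(Besicovitch.vitaliFamily volume).ae_tendsto_average hloc] with x hx hxΩ
  have h := hx.comp (Besicovitch.tendsto_filterAt volume x)
  rw [indicator_of_mem hxΩ] at h
  refine h.congr' ?_
  obtain ⟨r, hr, hball⟩ := Metric.nhds_basis_closedBall.mem_iff.1 (hΩ.mem_nhds hxΩ)
  filter_upwards [Ioo_mem_nhdsGT hr] with ρ hρ
  -- The Besicovitch differentiation theorem concerns closed balls; spheres are null, so open balls
  -- have the same averages.
  have hae : Metric.ball x ρ =ᵐ[volume] Metric.closedBall x ρ :=
    ae_eq_of_subset_of_measure_ge Metric.ball_subset_closedBall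
      (Measure.addHaar_closedBall_eq_addHaar_ball volume x ρ).le
      measurableSet_ball.nullMeasurableSet measure_closedBall_lt_top.ne
  rw [Function.comp_apply, Measure.restrict_congr_set hae]
  refine integral_congr_ae ?_
  refine (Measure.ae_smul_measure ?_ _)
  refine (ae_restrict_iff' measurableSet_closedBall).2 ?_
  refine Eventually.of_forall fun y hy => ?_
  exact indicator_of_mem (hball (Metric.closedBall_subset_closedBall hρ.2.le hy)) f

end WeakSubharmonic
end

/-! ### Functions with zero boundary values and the chain rule. -/

noncomputable section

section SobolevZero

variable {n : ℕ} {Ω : Set (Euc n)}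

/-- `θ ∈ H¹₀(Ω)` with weak partial derivatives `Γ j`: the pair is the `L²`-limit of test functions
and their partial derivatives. -/
structure IsH10 (Ω : Set (Euc n)) (θ : Euc n → ℝ) (Γ : Fin n → Euc n → ℝ) : Prop where
  memLp : MemLp θ 2 (volume.restrict Ω)
  memLp_grad : ∀ j, MemLp (Γ j) 2 (volume.restrict Ω)
  exists_approx : ∃ φ : ℕ → Euc n → ℝ, (∀ k, IsTest Ω (φ k)) ∧
    Tendsto (fun k => eLpNorm (fun x => φ k x - θ x) 2 (volume.restrict Ω)) atTop (𝓝 0) ∧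
    ∀ j, Tendsto (fun k => eLpNorm (fun x => pd j (φ k) x - Γ j x) 2 (volume.restrict Ω))
      atTop (𝓝 0)

lemma IsTest.isH10 {φ : Euc n → ℝ} (hφ : IsTest Ω φ) : IsH10 Ω φ fun j => _root_.pd j φ :=
  ⟨(hφ.memLp 2).restrict _, fun j => ((hφ.pd j).memLp 2).restrict _,
    fun _ => φ, fun _ => hφ, by simp, by simp⟩

lemma IsTest.const_mul {φ : Euc n → ℝ} (hφ : IsTest Ω φ) (c : ℝ) :
    IsTest Ω (fun x => c * φ x) :=
  ⟨contDiff_const.mul hφ.1, hφ.2.mul_left, tsupport_mul_subset_right.trans hφ.3⟩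

lemma IsH10.const_mul {θ : Euc n → ℝ} {Γ : Fin n → Euc n → ℝ} (h : IsH10 Ω θ Γ) (c : ℝ) :
    IsH10 Ω (fun x => c * θ x) fun j x => c * Γ j x := by
  obtain ⟨φ, h1, h2, h3⟩ := h.exists_approx
  have key : ∀ (a : ℕ → Euc n → ℝ) (b : Euc n → ℝ),
      Tendsto (fun k => eLpNorm (fun x => a k x - b x) 2 (volume.restrict Ω)) atTop (𝓝 0) →
      Tendsto (fun k => eLpNorm (fun x => c * a k x - c * b x) 2 (volume.restrict Ω))
        atTop (𝓝 0) := by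
    intro a b hab
    have h4 := ENNReal.Tendsto.const_mul (a := ‖c‖ₑ) hab (Or.inr enorm_ne_top)
    rw [mul_zero] at h4
    refine h4.congr fun k => ?_
    rw [← eLpNorm_const_smul]
    congr 1; ext x; simp [mul_sub]
  refine ⟨h.memLp.const_mul c, fun j => (h.memLp_grad j).const_mul c,
    fun k x => c * φ k x, fun k => (h1 k).const_mul c, key _ _ h2, fun j => ?_⟩
  refine (key _ _ (h3 j)).congr fun k => ?_
  congr 1; ext x
  rw [pd_const_mul _ (h1 k).1.diffAt]

lemma IsTest.setIntegral_eq {φ : Euc n → ℝ} (hφ : IsTest Ω φ) (g : Euc n → ℝ) :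
    ∫ x in Ω, g x * φ x = ∫ x, g x * φ x :=
  setIntegral_eq_integral_of_forall_compl_eq_zero fun x hx => by rw [hφ.eq_zero hx, mul_zero]

lemma IsTest.integral_pd {φ : Euc n → ℝ} (hφ : IsTest Ω φ) (j : Fin n) : ∫ x, _root_.pd j φ x = 0 := by
  have h := integral_pd_mul isOpen_univ (hφ.mono (subset_univ _))
    (contDiffOn_const (c := (1 : ℝ))) j
  simpa [pd_const] using h

/-- The identity holds for the approximating test functions, and finite measure makes `1` an `L²`
function to pair with. This serves as the divergence theorem for products with test functions. -/
lemma IsH10.integral_grad_eq_zero {θ : Euc n → ℝ} {Γ : Fin n → Euc n → ℝ} (h : IsH10 Ω θ Γ)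
    [IsFiniteMeasure (volume.restrict Ω)] (j : Fin n) : ∫ x in Ω, Γ j x = 0 := by
  obtain ⟨φ, h1, -, h3⟩ := h.exists_approx
  have hlim := tendsto_integral_mul_of_tendsto_eLpNorm (k := fun _ => 1) (h.memLp_grad j)
    (memLp_const 1) (Eventually.of_forall fun k =>
      ((h1 k).pd j).1.continuous.aestronglyMeasurable) (h3 j)
  have h0 : ∀ k, ∫ x in Ω, pd j (φ k) x = 0 := fun k => by
    have := ((h1 k).pd j).setIntegral_eq (fun _ => 1)
    simp only [one_mul] at this
    rw [this, (h1 k).integral_pd j]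
  simp only [one_mul, h0] at hlim
  exact tendsto_nhds_unique hlim tendsto_const_nhds

/-- The vector field with given coordinates. -/
def vec (Γ : Fin n → Euc n → ℝ) (x : Euc n) : Euc n := WithLp.toLp 2 fun j => Γ j x

lemma IsH10.isWeakGradient {θ : Euc n → ℝ} {Γ : Fin n → Euc n → ℝ} (h : IsH10 Ω θ Γ) :
    IsWeakGradient Ω θ (vec Γ) := by
  intro ψ hψ1 hψ2 hψ3 j
  have hψ : IsTest Ω ψ := ⟨hψ1, hψ2, hψ3⟩
  obtain ⟨φ, h1, h2, h3⟩ := h.exists_approx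
  have l1 := tendsto_integral_mul_of_tendsto_eLpNorm h.memLp (((hψ.pd j).memLp 2).restrict Ω)
    (Eventually.of_forall fun k => (h1 k).1.continuous.aestronglyMeasurable) h2
  have l2 := tendsto_integral_mul_of_tendsto_eLpNorm (h.memLp_grad j) ((hψ.memLp 2).restrict Ω)
    (Eventually.of_forall fun k => ((h1 k).pd j).1.continuous.aestronglyMeasurable) (h3 j)
  have e : ∀ k, ∫ x in Ω, pd j ψ x * φ k x = -∫ x in Ω, ψ x * pd j (φ k) x := fun k => by
    rw [(h1 k).setIntegral_eq, ((h1 k).pd j).setIntegral_eq]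
    exact integral_pd_mul isOpen_univ (hψ.mono (subset_univ _)) (h1 k).1.contDiffOn j
  simp only [e] at l1
  have := tendsto_nhds_unique l1 l2.neg
  simp only [gradient_apply_eq_pd, vec]
  simpa only [mul_comm] using this

lemma tendsto_integral_sq_of_tendsto_eLpNorm {α : Type*} [MeasurableSpace α] {μ : Measure α}
    {h : ℕ → α → ℝ} (hm : ∀ k, AEStronglyMeasurable (h k) μ)
    (hlim : Tendsto (fun k => eLpNorm (h k) 2 μ) atTop (𝓝 0)) :
    Tendsto (fun k => ∫ x, h k x ^ 2 ∂μ) atTop (𝓝 0) := by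
  have e : ∀ k, ∫ x, h k x ^ 2 ∂μ = (eLpNorm (h k) 2 μ ^ 2).toReal := by
    intro k
    rw [integral_eq_lintegral_of_nonneg_ae (Eventually.of_forall fun x => sq_nonneg _)
      ((hm k).pow 2), eLpNorm_two_sq]
    congr 1
    refine lintegral_congr fun x => ?_
    rw [← enorm_pow, Real.enorm_of_nonneg (sq_nonneg _)]
  simp only [e]
  have h2 := ENNReal.Tendsto.pow (n := 2) hlim
  have := (ENNReal.tendsto_toReal (by simp)).comp h2
  simpa [Function.comp_def] using this

/-- Dominated convergence in `L²`. -/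
lemma tendsto_eLpNorm_two_of_dominated {α : Type*} [MeasurableSpace α] {μ : Measure α}
    {h : ℕ → α → ℝ} {b : α → ℝ} (hm : ∀ k, AEStronglyMeasurable (h k) μ) (hb : MemLp b 2 μ)
    (hle : ∀ k x, |h k x| ≤ |b x|) (hlim : ∀ᵐ x ∂μ, Tendsto (fun k => h k x) atTop (𝓝 0)) :
    Tendsto (fun k => eLpNorm (h k) 2 μ) atTop (𝓝 0) := by
  have h1 : Tendsto (fun k => ∫⁻ x, ‖h k x‖ₑ ^ 2 ∂μ) atTop (𝓝 (∫⁻ _, 0 ∂μ)) := by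
    refine tendsto_lintegral_of_dominated_convergence' (fun x => ‖b x‖ₑ ^ 2)
      (fun k => (hm k).enorm.pow_const 2) ?_ ?_ ?_
    · intro k
      refine Eventually.of_forall fun x => ?_
      have : ‖h k x‖ₑ ≤ ‖b x‖ₑ := by
        rw [enorm_le_iff_norm_le]; exact hle k x
      exact pow_le_pow_left' this 2
    · rw [← eLpNorm_two_sq]
      exact (ENNReal.pow_lt_top hb.2).ne
    · filter_upwards [hlim] with x hx
      have h2 := ENNReal.Tendsto.pow (n := 2) hx.enorm
      simpa using h2
  simp only [lintegral_zero, ← eLpNorm_two_sq] at h1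
  have h3 := h1.ennrpow_const (1 / 2)
  rw [ENNReal.zero_rpow_of_pos (by norm_num)] at h3
  refine h3.congr fun k => ?_
  rw [← ENNReal.rpow_natCast, ← ENNReal.rpow_mul]
  norm_num

lemma tendsto_eLpNorm_of_le_mul {α : Type*} [MeasurableSpace α] {μ : Measure α}
    {a b : ℕ → α → ℝ} {C : ℝ} (hle : ∀ᶠ k in atTop, ∀ᵐ x ∂μ, |a k x| ≤ C * |b k x|)
    (hb : Tendsto (fun k => eLpNorm (b k) 2 μ) atTop (𝓝 0)) :
    Tendsto (fun k => eLpNorm (a k) 2 μ) atTop (𝓝 0) := by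
  have h4 := ENNReal.Tendsto.const_mul (a := ENNReal.ofReal C) hb (Or.inr ENNReal.ofReal_ne_top)
  rw [mul_zero] at h4
  refine tendsto_of_tendsto_of_tendsto_of_le_of_le' tendsto_const_nhds h4
    (Eventually.of_forall fun _ => zero_le) ?_
  filter_upwards [hle] with k hk
  exact eLpNorm_le_mul_eLpNorm_of_ae_le_mul hk 2

lemma IsTest.exists_bound {φ : Euc n → ℝ} (hφ : IsTest Ω φ) : ∃ C, 0 ≤ C ∧ ∀ x, |φ x| ≤ C := by
  obtain ⟨C, hC⟩ := hφ.2.exists_bound_of_continuous hφ.1.continuous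
  exact ⟨C, (norm_nonneg _).trans (hC 0), hC⟩

lemma exists_uniform_closedBall_subset (hΩ : IsOpen Ω) {K : Set (Euc n)} (hK : IsCompact K)
    (hKΩ : K ⊆ Ω) : ∃ η > 0, ∀ x ∈ K, Metric.closedBall x η ⊆ Ω := by
  obtain ⟨η, hη, hs⟩ := hK.exists_cthickening_subset_open hΩ hKΩ
  exact ⟨η, hη, fun x hx => (Metric.closedBall_subset_cthickening hx η).trans hs⟩

/-- Chain rule: `φ A(f) ∈ H¹₀(Ω)` for a test function `φ` and a Sobolev function `f`. -/
lemma isH10_mul_comp (hΩ : IsOpen Ω) [IsFiniteMeasure (volume.restrict Ω)] {f : Euc n → ℝ}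
    {G : Euc n → Euc n} (hf : MemLp f 2 (volume.restrict Ω))
    (hG : MemLp G 2 (volume.restrict Ω)) (hw : IsWeakGradient Ω f G) {φ : Euc n → ℝ}
    (hφ : IsTest Ω φ) {A A' : ℝ → ℝ} (hA : ContDiff ℝ ∞ A) (hA' : ∀ s, HasDerivAt A (A' s) s)
    (hA'c : Continuous A') {L : ℝ} (hL : ∀ s, |A' s| ≤ L) :
    IsH10 Ω (fun x => φ x * A (f x))
      fun j x => A (f x) * pd j φ x + φ x * (A' (f x) * G x j) := by
  set μ := volume.restrict Ω with hμ
  have hGj : ∀ j, MemLp (fun x => G x j) 2 μ := memLp_piLp_iff.1 hG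
  have hL0 : 0 ≤ L := (abs_nonneg _).trans (hL 0)
  have hlip : ∀ s t, |A s - A t| ≤ L * |s - t| := by
    intro s t
    have := Convex.norm_image_sub_le_of_norm_hasDerivWithin_le (f := A) (f' := A') (s := univ)
      (x := t) (y := s) (fun x _ => (hA' x).hasDerivWithinAt) (fun x _ => hL x) convex_univ
      (mem_univ _) (mem_univ _)
    simpa using this
  have hAf : MemLp (fun x => A (f x)) 2 μ := by
    have h1 : MemLp (fun x => |A 0| + L * |f x|) 2 μ :=
      (memLp_const |A 0|).add (hf.norm.const_mul L)
    refine h1.mono (hA.continuous.comp_aestronglyMeasurable hf.1)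
      (Eventually.of_forall fun x => ?_)
    rw [Real.norm_eq_abs, Real.norm_eq_abs, abs_of_nonneg (by positivity : 0 ≤ |A 0| + L * |f x|)]
    have := hlip (f x) 0
    rw [sub_zero] at this
    have h2 := abs_add_le (A 0) (A (f x) - A 0)
    rw [add_sub_cancel] at h2
    linarith
  obtain ⟨C, hC0, hC⟩ := hφ.exists_bound
  have hφm : ∀ ψ : Euc n → ℝ, IsTest Ω ψ → AEStronglyMeasurable ψ μ := fun ψ hψ =>
    hψ.1.continuous.aestronglyMeasurable
  have hbdd : ∀ (ψ h : Euc n → ℝ), IsTest Ω ψ → MemLp h 2 μ → MemLp (fun x => ψ x * h x) 2 μ := by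
    intro ψ h hψ hh
    obtain ⟨C, -, hC⟩ := hψ.exists_bound
    refine hh.of_le_mul (c := C) ((hφm ψ hψ).mul hh.1) (Eventually.of_forall fun x => ?_)
    rw [norm_mul]
    exact mul_le_mul_of_nonneg_right (hC x) (norm_nonneg _)
  have hAG : ∀ j, MemLp (fun x => A' (f x) * G x j) 2 μ := fun j =>
    (hGj j).of_le_mul (c := L) ((hA'c.comp_aestronglyMeasurable hf.1).mul (hGj j).1)
      (Eventually.of_forall fun x => by
        rw [norm_mul]; exact mul_le_mul_of_nonneg_right (hL _) (norm_nonneg _))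
  refine ⟨hbdd φ _ hφ hAf, fun j => ?_, ?_⟩
  · have h1 : MemLp (fun x => A (f x) * pd j φ x) 2 μ := by
      simpa only [mul_comm] using hbdd _ _ (hφ.pd j) hAf
    exact h1.add (hbdd φ _ hφ (hAG j))
  set F := Ω.indicator f with hFdef
  have hF := memLp_ext hΩ hf
  have hloc := locallyIntegrable_of_memLp_two hF
  obtain ⟨u, hu, hu0, hae⟩ := exists_seq_tendsto_zero_ae hF
  have hUc : ∀ k, ContDiff ℝ ∞ (moll (u k) F) := fun k => contDiff_moll (hu0 k) hloc
  have hFf : F =ᵐ[μ] f := (ae_restrict_iff' hΩ.measurableSet).2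
    (Eventually.of_forall fun x hx => indicator_of_mem hx f)
  have hres : ∀ {H : Euc n → ℝ}, MemLp H 2 μ →
      Tendsto (fun k => eLpNorm (fun x => moll (u k) (Ω.indicator H) x - H x) 2 μ)
        atTop (𝓝 0) := by
    intro H hH
    have h1 := (tendsto_eLpNorm_moll_sub (memLp_ext hΩ hH)).comp hu
    refine tendsto_of_tendsto_of_tendsto_of_le_of_le tendsto_const_nhds h1
      (fun _ => zero_le) fun k => ?_
    refine le_trans (le_of_eq (eLpNorm_congr_ae ?_))
      (eLpNorm_mono_measure _ Measure.restrict_le_self)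
    refine (ae_restrict_iff' hΩ.measurableSet).2 (Eventually.of_forall fun x hx => ?_)
    simp only [indicator_of_mem hx]
  have hUf := hres hf
  -- Below scale `η`, mollification commutes with weak differentiation at every point of the support
  -- of `φ`; off the support the terms involving derivatives of `f` carry the factor `φ = 0`.
  obtain ⟨η, hη, hball⟩ := exists_uniform_closedBall_subset hΩ hφ.2.isCompact hφ.3
  refine ⟨fun k x => φ x * A (moll (u k) F x), fun k =>
    hφ.mul_contDiffOn hΩ (hA.comp (hUc k)).contDiffOn, ?_, fun j => ?_⟩
  · refine tendsto_eLpNorm_of_le_mul (C := C * L) (Eventually.of_forall fun k =>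
      Eventually.of_forall fun x => ?_) hUf
    rw [← mul_sub, abs_mul, mul_assoc]
    exact mul_le_mul (hC x) (hlip _ _) (abs_nonneg _) hC0
  · obtain ⟨C', hC'0, hC'⟩ := (hφ.pd j).exists_bound
    set V : ℕ → Euc n → ℝ := fun k => moll (u k) (Ω.indicator fun y => G y j) with hV
    -- The gradient error splits into three terms. `T1` and `T2` are controlled by the `L²` errors
    -- of the function and of its gradient. `T3` has no rate, since `A'` is merely continuous, and
    -- goes to zero by dominated convergence along the a.e. convergent scales.
    set T1 : ℕ → Euc n → ℝ := fun k x => pd j φ x * (A (moll (u k) F x) - A (f x)) with hT1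
    set T2 : ℕ → Euc n → ℝ := fun k x => φ x * A' (moll (u k) F x) * (V k x - G x j) with hT2
    set T3 : ℕ → Euc n → ℝ := fun k x =>
      φ x * (A' (moll (u k) F x) - A' (f x)) * G x j with hT3
    have hVc : ∀ k, Continuous (V k) := fun k =>
      (contDiff_moll (hu0 k) (locallyIntegrable_of_memLp_two (memLp_ext hΩ (hGj j)))).continuous
    have m1 : ∀ k, AEStronglyMeasurable (T1 k) μ := fun k => (hφm _ (hφ.pd j)).mul
      ((hA.continuous.comp (hUc k).continuous).aestronglyMeasurable.sub hAf.1)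
    have m2 : ∀ k, AEStronglyMeasurable (T2 k) μ := fun k => ((hφm _ hφ).mul
      (hA'c.comp (hUc k).continuous).aestronglyMeasurable).mul
      ((hVc k).aestronglyMeasurable.sub (hGj j).1)
    have m3 : ∀ k, AEStronglyMeasurable (T3 k) μ := fun k => ((hφm _ hφ).mul
      ((hA'c.comp (hUc k).continuous).aestronglyMeasurable.sub
        (hA'c.comp_aestronglyMeasurable hf.1))).mul (hGj j).1
    have t1 : Tendsto (fun k => eLpNorm (T1 k) 2 μ) atTop (𝓝 0) := by
      refine tendsto_eLpNorm_of_le_mul (C := C' * L) (Eventually.of_forall fun k =>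
        Eventually.of_forall fun x => ?_) hUf
      rw [hT1, abs_mul, mul_assoc]
      exact mul_le_mul (hC' x) (hlip _ _) (abs_nonneg _) hC'0
    have t2 : Tendsto (fun k => eLpNorm (T2 k) 2 μ) atTop (𝓝 0) := by
      refine tendsto_eLpNorm_of_le_mul (C := C * L) (Eventually.of_forall fun k =>
        Eventually.of_forall fun x => ?_) (hres (hGj j))
      rw [hT2, abs_mul, abs_mul]
      exact mul_le_mul_of_nonneg_right (mul_le_mul (hC x) (hL _) (abs_nonneg _) hC0)
        (abs_nonneg _)
    have t3 : Tendsto (fun k => eLpNorm (T3 k) 2 μ) atTop (𝓝 0) := by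
      refine tendsto_eLpNorm_two_of_dominated m3 ((hGj j).const_mul (C * (2 * L))) ?_ ?_
      · intro k x
        rw [hT3, abs_mul, abs_mul, abs_mul (C * (2 * L)), abs_of_nonneg (by positivity :
          0 ≤ C * (2 * L))]
        refine mul_le_mul_of_nonneg_right (mul_le_mul (hC x) ?_ (abs_nonneg _) hC0) (abs_nonneg _)
        have := abs_sub (A' (moll (u k) F x)) (A' (f x))
        linarith [hL (moll (u k) F x), hL (f x)]
      · filter_upwards [ae_restrict_of_ae hae, hFf] with x hx hxf
        rw [show Ω.indicator f x = f x from hxf] at hx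
        have h1 := (hA'c.tendsto (f x)).comp hx
        have h2 := ((h1.sub_const (A' (f x))).const_mul (φ x)).mul_const (G x j)
        simpa using h2
    have hsum : Tendsto (fun k => eLpNorm (T1 k) 2 μ + eLpNorm (T2 k) 2 μ + eLpNorm (T3 k) 2 μ)
        atTop (𝓝 0) := by simpa using (t1.add t2).add t3
    refine tendsto_of_tendsto_of_tendsto_of_le_of_le' tendsto_const_nhds hsum
      (Eventually.of_forall fun _ => zero_le) ?_
    filter_upwards [hu.eventually (Ioo_mem_nhdsGT hη)] with k hk
    have e : (fun x => pd j (fun x => φ x * A (moll (u k) F x)) x -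
        (A (f x) * pd j φ x + φ x * (A' (f x) * G x j))) = T1 k + T2 k + T3 k := by
      ext x
      rw [pd_mul (g := fun x => A (moll (u k) F x)) hφ.1.diffAt ((hA.comp (hUc k)).diffAt),
        pd_comp (hA' _) (hUc k).diffAt]
      simp only [Pi.add_apply, hT1, hT2, hT3]
      by_cases hx : x ∈ tsupport φ
      · rw [hFdef, pd_moll hΩ hf hw (hu0 k) ((Metric.closedBall_subset_closedBall
          hk.2.le).trans (hball x hx))]
        simp only [hV]; ring
      · rw [image_eq_zero_of_notMem_tsupport hx]; ring
    rw [e]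
    exact (eLpNorm_add_le ((m1 k).add (m2 k)) (m3 k) (by norm_num)).trans
      (by gcongr; exact eLpNorm_add_le (m1 k) (m2 k) (by norm_num))

end SobolevZero
end

/-! ### Competitors changing one component, and their energy. -/

noncomputable section

section Competitor

variable {n m : ℕ} {Ω : Set (Euc n)} {θ : Euc n → ℝ} {Γ : Fin n → Euc n → ℝ}

lemma MeasureTheory.MemLp.integrable_mul_test {h ψ : Euc n → ℝ}
    (hh : MemLp h 2 (volume.restrict Ω)) (hψ : IsTest Ω ψ) :
    Integrable (fun x => h x * ψ x) (volume.restrict Ω) :=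
  hh.integrable_mul ((hψ.memLp 2).restrict Ω)

lemma memLp_vec (hΓ : ∀ j, MemLp (Γ j) 2 (volume.restrict Ω)) :
    MemLp (vec Γ) 2 (volume.restrict Ω) :=
  memLp_piLp_iff.2 hΓ

lemma vec_norm_sq (x : Euc n) : ‖vec Γ x‖ ^ 2 = ∑ j, Γ j x ^ 2 := norm_sq_eq_sum _

lemma SobolevH1.memLp_coord (u : SobolevH1 Ω m) (i : Fin m) :
    MemLp (fun x => u.toFun x i) 2 (volume.restrict Ω) := memLp_piLp_iff.1 u.memLp_toFun i

lemma SobolevH1.memLp_grad_coord (u : SobolevH1 Ω m) (i : Fin m) (j : Fin n) :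
    MemLp (fun x => u.grad i x j) 2 (volume.restrict Ω) := memLp_piLp_iff.1 (u.memLp_grad i) j

/-- The function `u + θ eᵢ` for `θ ∈ H¹₀(Ω)`. -/
def SobolevH1.addComp (u : SobolevH1 Ω m) (i : Fin m) (h : IsH10 Ω θ Γ) : SobolevH1 Ω m where
  toFun x := u.toFun x + θ x • EuclideanSpace.single i (1 : ℝ)
  grad k x := u.grad k x + if k = i then vec Γ x else 0
  memLp_toFun := by
    refine u.memLp_toFun.add ?_
    exact (ContinuousLinearMap.toSpanSingleton ℝ
      (EuclideanSpace.single i (1 : ℝ))).comp_memLp' h.memLp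
  memLp_grad k := by
    refine (u.memLp_grad k).add ?_
    by_cases hk : k = i
    · simpa [hk] using memLp_vec h.memLp_grad
    · simp [hk]
  isWeakGradient k := by
    by_cases hk : k = i
    · subst hk
      intro ψ h1 h2 h3 j
      have hψ : IsTest Ω ψ := ⟨h1, h2, h3⟩
      have e1 := u.isWeakGradient k ψ h1 h2 h3 j
      have e2 := h.isWeakGradient ψ h1 h2 h3 j
      have hv : ∀ x, vec Γ x j = Γ j x := fun x => rfl
      simp only [gradient_apply_eq_pd, hv] at e1 e2 ⊢
      simp only [PiLp.add_apply, PiLp.smul_apply, PiLp.single_apply, smul_eq_mul,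
        if_true, mul_one, add_mul, hv]
      rw [integral_add ((u.memLp_coord k).integrable_mul_test (hψ.pd j))
        (h.memLp.integrable_mul_test (hψ.pd j)),
        integral_add ((u.memLp_grad_coord k j).integrable_mul_test hψ)
        ((h.memLp_grad j).integrable_mul_test hψ), e1, e2]
      ring
    · have := u.isWeakGradient k
      simpa [hk] using this

lemma SobolevH1.addComp_apply (u : SobolevH1 Ω m) (i k : Fin m) (h : IsH10 Ω θ Γ) (x : Euc n) :
    (u.addComp i h).toFun x k = u.toFun x k + if k = i then θ x else 0 := by
  simp [SobolevH1.addComp, PiLp.single_apply]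

lemma SobolevH1.addComp_of_eq_zero (u : SobolevH1 Ω m) (i : Fin m) (h : IsH10 Ω θ Γ) {x : Euc n}
    (hx : θ x = 0) : (u.addComp i h).toFun x = u.toFun x := by
  simp [SobolevH1.addComp, hx]

lemma norm_add_sq_le_two_mul {E : Type*} [SeminormedAddCommGroup E] (a b : E) :
    ‖a + b‖ ^ 2 ≤ 2 * ‖a‖ ^ 2 + 2 * ‖b‖ ^ 2 := by
  have := norm_add_le a b
  nlinarith [norm_nonneg (a + b), sq_nonneg (‖a‖ - ‖b‖), norm_nonneg a, norm_nonneg b]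

/-- A test approximation of `u - g` is corrected in the `i`-th slot by one of `θ`; the squared
errors add up to a factor two. -/
lemma SobolevH1.addComp_eqOnBoundary {u g : SobolevH1 Ω m} (hu : u.EqOnBoundary g) (i : Fin m)
    (h : IsH10 Ω θ Γ) : (u.addComp i h).EqOnBoundary g := by
  intro ε hε
  -- Two squared errors below `ε / 4`, each doubled by `norm_add_sq_le_two_mul`, stay below `ε`.
  obtain ⟨φ₀, hφ₀, hφ₀s, hφ₀t, hlt⟩ := hu (ε / 4) (by positivity)
  obtain ⟨φ, h1, h2, h3⟩ := h.exists_approx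
  have t1 := tendsto_integral_sq_of_tendsto_eLpNorm (fun k =>
    (h1 k).1.continuous.aestronglyMeasurable.sub h.memLp.1) h2
  have t2 : ∀ j, Tendsto (fun k => ∫ x in Ω, (pd j (φ k) x - Γ j x) ^ 2) atTop (𝓝 0) := fun j =>
    tendsto_integral_sq_of_tendsto_eLpNorm (fun k =>
      ((h1 k).pd j).1.continuous.aestronglyMeasurable.sub (h.memLp_grad j).1) (h3 j)
  have t3 := t1.add (tendsto_finsetSum Finset.univ fun j _ => t2 j)
  rw [Finset.sum_const_zero, add_zero] at t3
  obtain ⟨k, hk⟩ := (t3.eventually_lt_const (show (0 : ℝ) < ε / 4 by positivity)).exists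
  have hφk := h1 k
  have hc : ∀ l, IsTest Ω (fun y => φ₀ y l) := fun l => by
    have hs : tsupport (fun y => φ₀ y l) ⊆ tsupport φ₀ :=
      tsupport_comp_subset (g := fun v : EuclideanSpace ℝ (Fin m) => v l) rfl φ₀
    exact ⟨by fun_prop, hφ₀s.of_isClosed_subset (isClosed_tsupport _) hs, hs.trans hφ₀t⟩
  set Φ : Euc n → EuclideanSpace ℝ (Fin m) := fun x =>
    φ₀ x + φ k x • EuclideanSpace.single i (1 : ℝ) with hΦ
  have hts : tsupport (fun x => φ k x • EuclideanSpace.single i (1 : ℝ)) ⊆ tsupport (φ k) :=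
    tsupport_smul_subset_left _ _
  have hg : ∀ l x, gradient (fun y => Φ y l) x =
      gradient (fun y => φ₀ y l) x + if l = i then gradient (φ k) x else 0 := by
    intro l x
    ext j
    have e : (fun y => Φ y l) = fun y => φ₀ y l + (if l = i then 1 else 0) * φ k y := by
      ext y; simp [hΦ, PiLp.single_apply]
    rw [gradient_apply_eq_pd, e, pd_add (hc l).1.diffAt (hφk.1.diffAt.const_mul _),
      pd_const_mul _ hφk.1.diffAt, PiLp.add_apply, gradient_apply_eq_pd]
    by_cases hl : l = i <;> simp [hl, gradient_apply_eq_pd]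
  refine ⟨Φ, ?_, ?_, ?_, ?_⟩
  · exact hφ₀.add (hφk.1.smul contDiff_const)
  · exact hφ₀s.add (hφk.2.smul_right)
  · exact (tsupport_add _ _).trans (union_subset hφ₀t (hts.trans hφk.3))
  · set I₀ : Euc n → ℝ := fun x => ‖u.toFun x - g.toFun x - φ₀ x‖ ^ 2 +
      ∑ l, ‖u.grad l x - g.grad l x - gradient (fun y => φ₀ y l) x‖ ^ 2 with hI₀
    set I₁ : Euc n → ℝ := fun x => (φ k x - θ x) ^ 2 + ∑ j, (pd j (φ k) x - Γ j x) ^ 2 with hI₁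
    have hgm : ∀ l, MemLp (fun x => gradient (fun y => φ₀ y l) x) 2 (volume.restrict Ω) := by
      intro l
      refine memLp_piLp_iff.2 fun j => ?_
      simp only [gradient_apply_eq_pd]
      exact (((hc l).pd j).memLp 2).restrict Ω
    have hφ₀m : MemLp φ₀ 2 (volume.restrict Ω) :=
      (hφ₀.continuous.memLp_of_hasCompactSupport hφ₀s).restrict Ω
    have i0 : Integrable I₀ (volume.restrict Ω) := by
      refine Integrable.add ?_ (integrable_finsetSum _ fun l _ => ?_)
      · exact ((u.memLp_toFun.sub g.memLp_toFun).sub hφ₀m).integrable_norm_pow (p := 2)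
          two_ne_zero
      · exact (((u.memLp_grad l).sub (g.memLp_grad l)).sub (hgm l)).integrable_norm_pow (p := 2)
          two_ne_zero
    have i1a : Integrable (fun x => (φ k x - θ x) ^ 2) (volume.restrict Ω) :=
      (((hφk.memLp 2).restrict Ω).sub h.memLp).integrable_sq
    have i1b : ∀ j, Integrable (fun x => (pd j (φ k) x - Γ j x) ^ 2) (volume.restrict Ω) :=
      fun j => ((((hφk.pd j).memLp 2).restrict Ω).sub (h.memLp_grad j)).integrable_sq
    have i1 : Integrable I₁ (volume.restrict Ω) :=
      i1a.add (integrable_finsetSum _ fun j _ => i1b j)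
    have hI₁e : ∫ x in Ω, I₁ x < ε / 4 := by
      rw [hI₁, integral_add i1a (integrable_finsetSum _ fun j _ => i1b j),
        integral_finsetSum _ fun j _ => i1b j]
      exact hk
    calc _ ≤ ∫ x in Ω, (2 * I₀ x + 2 * I₁ x) := by
          refine integral_mono_of_nonneg (Eventually.of_forall fun x => by positivity)
            ((i0.const_mul 2).add (i1.const_mul 2)) (Eventually.of_forall fun x => ?_)
          simp only [hI₀, hI₁]
          have a1 : ‖(u.addComp i h).toFun x - g.toFun x - Φ x‖ ^ 2 ≤
              2 * ‖u.toFun x - g.toFun x - φ₀ x‖ ^ 2 + 2 * (φ k x - θ x) ^ 2 := by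
            have e : (u.addComp i h).toFun x - g.toFun x - Φ x = (u.toFun x - g.toFun x - φ₀ x) +
                (θ x - φ k x) • EuclideanSpace.single i (1 : ℝ) := by
              simp only [SobolevH1.addComp, hΦ, sub_smul]; abel
            rw [e]
            refine (norm_add_sq_le_two_mul _ _).trans (le_of_eq ?_)
            rw [norm_smul, mul_pow, Real.norm_eq_abs, sq_abs]
            simp; ring
          have a2 : ∑ l, ‖(u.addComp i h).grad l x - g.grad l x -
              gradient (fun y => Φ y l) x‖ ^ 2 ≤
              2 * ∑ l, ‖u.grad l x - g.grad l x - gradient (fun y => φ₀ y l) x‖ ^ 2 +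
              2 * ∑ j, (pd j (φ k) x - Γ j x) ^ 2 := by
            have e : ∀ l, (u.addComp i h).grad l x - g.grad l x - gradient (fun y => Φ y l) x =
                (u.grad l x - g.grad l x - gradient (fun y => φ₀ y l) x) +
                if l = i then vec Γ x - gradient (φ k) x else 0 := by
              intro l
              rw [hg]
              simp only [SobolevH1.addComp]
              split_ifs <;> abel
            have e2 : ∑ j, (pd j (φ k) x - Γ j x) ^ 2 = ‖vec Γ x - gradient (φ k) x‖ ^ 2 := by
              rw [norm_sq_eq_sum]
              refine Finset.sum_congr rfl fun j _ => ?_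
              rw [PiLp.sub_apply, gradient_apply_eq_pd]
              simp only [vec]; ring
            calc _ ≤ ∑ l, (2 * ‖u.grad l x - g.grad l x - gradient (fun y => φ₀ y l) x‖ ^ 2 +
                  if l = i then 2 * ‖vec Γ x - gradient (φ k) x‖ ^ 2 else 0) := by
                  refine Finset.sum_le_sum fun l _ => ?_
                  rw [e]
                  refine (norm_add_sq_le_two_mul _ _).trans (le_of_eq ?_)
                  split_ifs <;> simp
              _ = _ := by
                  rw [Finset.sum_add_distrib, ← Finset.mul_sum, e2]; simp
          linarith
      _ = 2 * (∫ x in Ω, I₀ x) + 2 * ∫ x in Ω, I₁ x := by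
          rw [integral_add (i0.const_mul 2) (i1.const_mul 2), integral_const_mul,
            integral_const_mul]
      _ < ε := by linarith

lemma SobolevH1.aestronglyMeasurable_posIndicator (u : SobolevH1 Ω m) :
    AEStronglyMeasurable u.posIndicator (volume.restrict Ω) := by
  refine (aestronglyMeasurable_const (b := (1 : ℝ))).indicator₀ ?_
  exact nullMeasurableSet_lt aemeasurable_const u.memLp_toFun.1.norm.aemeasurable

lemma SobolevH1.posIndicator_nonneg (u : SobolevH1 Ω m) (x : Euc n) : 0 ≤ u.posIndicator x :=
  indicator_nonneg (fun _ _ => zero_le_one) x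

lemma SobolevH1.posIndicator_le_one (u : SobolevH1 Ω m) (x : Euc n) : u.posIndicator x ≤ 1 :=
  indicator_le_self' (fun _ _ => zero_le_one) x

lemma SobolevH1.posIndicator_eq (u : SobolevH1 Ω m) (x : Euc n) [Decidable (u.toFun x = 0)] :
    u.posIndicator x = if u.toFun x = 0 then 0 else 1 := by
  by_cases hx : u.toFun x = 0 <;> simp [SobolevH1.posIndicator, hx]

lemma SobolevH1.dist_addComp (u : SobolevH1 Ω m) (i : Fin m) (h : IsH10 Ω θ Γ) :
    SobolevH1.dist u (u.addComp i h) = Real.sqrt (∫ x in Ω, (θ x ^ 2 + ∑ j, Γ j x ^ 2)) +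
      ∫ x in Ω, |u.posIndicator x - (u.addComp i h).posIndicator x| := by
  have e1 : ∀ x, ‖u.toFun x - (u.addComp i h).toFun x‖ ^ 2 = θ x ^ 2 := fun x => by
    simp [SobolevH1.addComp, norm_smul]
  have e2 : ∀ x, ∑ k, ‖u.grad k x - (u.addComp i h).grad k x‖ ^ 2 = ∑ j, Γ j x ^ 2 := fun x => by
    rw [Finset.sum_eq_single i]
    · simp [SobolevH1.addComp, vec_norm_sq]
    · intro k _ hk; simp [SobolevH1.addComp, hk]
    · simp
  simp only [SobolevH1.dist, e1, e2]

/-- The standing assumptions on the weight `Q`. -/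
structure IsWeight (Ω : Set (Euc n)) (Q : Euc n → ℝ) (Qmax : ℝ) : Prop where
  aemeasurable : AEMeasurable Q (volume.restrict Ω)
  bound : ∀ᵐ x ∂(volume.restrict Ω), 0 ≤ Q x ∧ Q x ≤ Qmax

lemma IsWeight.sq_le {Q : Euc n → ℝ} {Qmax : ℝ} (hQ : IsWeight Ω Q Qmax) :
    ∀ᵐ x ∂(volume.restrict Ω), Q x ^ 2 ≤ Qmax ^ 2 := by
  filter_upwards [hQ.bound] with x hx using pow_le_pow_left₀ hx.1 hx.2 2

variable [IsFiniteMeasure (volume.restrict Ω)] {Q : Euc n → ℝ} {Qmax : ℝ}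

lemma SobolevH1.integrable_weight (hQ : IsWeight Ω Q Qmax) (u : SobolevH1 Ω m) :
    Integrable (fun x => Q x ^ 2 * u.posIndicator x) (volume.restrict Ω) := by
  refine (integrable_const (Qmax ^ 2)).mono'
    ((hQ.aemeasurable.aestronglyMeasurable.pow 2).mul u.aestronglyMeasurable_posIndicator) ?_
  filter_upwards [hQ.sq_le] with x hx
  rw [Real.norm_eq_abs, abs_of_nonneg (mul_nonneg (sq_nonneg _) (u.posIndicator_nonneg x))]
  calc _ ≤ Q x ^ 2 * 1 := mul_le_mul_of_nonneg_left (u.posIndicator_le_one x) (sq_nonneg _)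
    _ ≤ _ := by rw [mul_one]; exact hx

/-- Expansion of the square in the one component that changes. Splitting the integral needs the
volume term to be integrable, which follows from the bound on `Q` and finite measure. -/
lemma SobolevH1.energy_addComp (hQ : IsWeight Ω Q Qmax) (u : SobolevH1 Ω m) (i : Fin m)
    (h : IsH10 Ω θ Γ) :
    SobolevH1.energy Q (u.addComp i h) = SobolevH1.energy Q u +
      (∫ x in Ω, (2 * ∑ j, u.grad i x j * Γ j x + ∑ j, Γ j x ^ 2)) +
      ∫ x in Ω, Q x ^ 2 * ((u.addComp i h).posIndicator x - u.posIndicator x) := by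
  have ig : ∀ w : SobolevH1 Ω m, Integrable (fun x => ∑ k, ‖w.grad k x‖ ^ 2)
      (volume.restrict Ω) := fun w => integrable_finsetSum _ fun k _ =>
    (w.memLp_grad k).integrable_norm_pow (p := 2) two_ne_zero
  have e : ∀ w : SobolevH1 Ω m, SobolevH1.energy Q w =
      (∫ x in Ω, ∑ k, ‖w.grad k x‖ ^ 2) + ∫ x in Ω, Q x ^ 2 * w.posIndicator x := fun w => by
    rw [SobolevH1.energy, integral_add (ig w) (w.integrable_weight hQ)]
  have i1 : Integrable (fun x => 2 * ∑ j, u.grad i x j * Γ j x + ∑ j, Γ j x ^ 2)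
      (volume.restrict Ω) := by
    refine Integrable.add (Integrable.const_mul (integrable_finsetSum _ fun j _ => ?_) _)
      (integrable_finsetSum _ fun j _ => (h.memLp_grad j).integrable_sq)
    exact (u.memLp_grad_coord i j).integrable_mul (h.memLp_grad j)
  have hpt : ∀ x, ∑ k, ‖(u.addComp i h).grad k x‖ ^ 2 = (∑ k, ‖u.grad k x‖ ^ 2) +
      (2 * ∑ j, u.grad i x j * Γ j x + ∑ j, Γ j x ^ 2) := by
    intro x
    have e1 : ∀ k, ‖(u.addComp i h).grad k x‖ ^ 2 = ‖u.grad k x‖ ^ 2 +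
        if k = i then (2 * ∑ j, u.grad i x j * Γ j x + ∑ j, Γ j x ^ 2) else 0 := by
      intro k
      simp only [SobolevH1.addComp]
      by_cases hk : k = i
      · subst hk
        simp only [if_true, norm_sq_eq_sum, Finset.mul_sum, ← Finset.sum_add_distrib]
        refine Finset.sum_congr rfl fun j _ => ?_
        simp only [PiLp.add_apply, vec]; ring
      · simp [hk]
    simp only [e1, Finset.sum_add_distrib, Finset.sum_ite_eq', Finset.mem_univ, if_true]
  rw [e, e]
  simp only [hpt, mul_sub]
  rw [integral_add (ig u) i1, integral_sub ((u.addComp i h).integrable_weight hQ)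
    (u.integrable_weight hQ)]
  ring

end Competitor
end

/-! ### Components of local minimizers are subharmonic. -/

noncomputable section

section Subharmonic

/-- A smooth convex approximation of `|s|`. -/
def smoothAbs (δ s : ℝ) : ℝ := Real.sqrt (s ^ 2 + δ ^ 2)

lemma smoothAbs_pos {δ : ℝ} (hδ : 0 < δ) (s : ℝ) : 0 < smoothAbs δ s :=
  Real.sqrt_pos.2 (by positivity)

lemma smoothAbs_sq (δ s : ℝ) : smoothAbs δ s ^ 2 = s ^ 2 + δ ^ 2 := Real.sq_sqrt (by positivity)

lemma le_smoothAbs (δ s : ℝ) : δ ≤ smoothAbs δ s :=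
  Real.le_sqrt_of_sq_le (by nlinarith [sq_nonneg s])

lemma abs_le_smoothAbs (δ s : ℝ) : |s| ≤ smoothAbs δ s :=
  Real.le_sqrt_of_sq_le (by rw [sq_abs]; nlinarith [sq_nonneg δ])

lemma smoothAbs_le {δ : ℝ} (hδ : 0 < δ) (s : ℝ) : smoothAbs δ s ≤ |s| + δ :=
  Real.sqrt_le_iff.2 ⟨by positivity, by nlinarith [sq_abs s, abs_nonneg s]⟩

lemma contDiff_smoothAbs {δ : ℝ} (hδ : 0 < δ) : ContDiff ℝ ∞ (smoothAbs δ) :=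
  ContDiff.sqrt (by fun_prop) fun s => by positivity

lemma contDiff_div_smoothAbs {δ : ℝ} (hδ : 0 < δ) : ContDiff ℝ ∞ fun s => s / smoothAbs δ s :=
  contDiff_id.div (contDiff_smoothAbs hδ) fun s => (smoothAbs_pos hδ s).ne'

lemma hasDerivAt_smoothAbs {δ : ℝ} (hδ : 0 < δ) (s : ℝ) : HasDerivAt (smoothAbs δ) (s / smoothAbs δ s) s := by
  have h : HasDerivAt (fun s : ℝ => s ^ 2 + δ ^ 2) (2 * s) s := by
    simpa using (hasDerivAt_pow 2 s).add_const (δ ^ 2)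
  have h2 := h.sqrt (by positivity)
  rwa [mul_div_mul_left _ _ two_ne_zero] at h2

lemma hasDerivAt_div_smoothAbs {δ : ℝ} (hδ : 0 < δ) (s : ℝ) :
    HasDerivAt (fun s => s / smoothAbs δ s) (δ ^ 2 / smoothAbs δ s ^ 3) s := by
  have hp := (smoothAbs_pos hδ s).ne'
  have h := (hasDerivAt_id s).div (hasDerivAt_smoothAbs hδ s) hp
  have e : δ ^ 2 / smoothAbs δ s ^ 3 =
      (1 * smoothAbs δ s - id s * (s / smoothAbs δ s)) / smoothAbs δ s ^ 2 := by
    have := smoothAbs_sq δ s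
    simp only [id]
    field_simp
    linarith
  rw [e]
  exact h

lemma abs_div_smoothAbs_le {δ : ℝ} (hδ : 0 < δ) (s : ℝ) : |s / smoothAbs δ s| ≤ 1 := by
  rw [abs_div, abs_of_pos (smoothAbs_pos hδ s)]
  exact div_le_one_of_le₀ (abs_le_smoothAbs δ s) (smoothAbs_pos hδ s).le

lemma abs_deriv_div_smoothAbs_le {δ : ℝ} (hδ : 0 < δ) (s : ℝ) : |δ ^ 2 / smoothAbs δ s ^ 3| ≤ δ⁻¹ := by
  have := smoothAbs_pos hδ s
  rw [abs_of_pos (by positivity), div_le_iff₀ (by positivity)]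
  calc δ ^ 2 = δ⁻¹ * δ ^ 3 := by field_simp
    _ ≤ _ := mul_le_mul_of_nonneg_left (pow_le_pow_left₀ hδ.le (le_smoothAbs δ s) 3)
      (by positivity)

variable {n m : ℕ} {Ω : Set (Euc n)} {θ : Euc n → ℝ} {Γ : Fin n → Euc n → ℝ}
 {Q : Euc n → ℝ} {Qmax : ℝ} {u g : SobolevH1 Ω m}

/-- Since `t θ ≤ t L uᵢ ≤ uᵢ / 2`, the lowered component is at least `uᵢ / 2`: it stays nonnegative
and positive exactly where `uᵢ` is, up to null sets. -/
lemma SobolevH1.addComp_neg_nonneg (hu : u.Nonneg) {i : Fin m} {L t : ℝ} (ht : 0 < t)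
    (htL : t * L ≤ 1 / 2) (hθ : ∀ᵐ x ∂(volume.restrict Ω), 0 ≤ θ x ∧ θ x ≤ L * u.toFun x i)
    (h : IsH10 Ω (fun x => -t * θ x) Γ) :
    (u.addComp i h).Nonneg ∧
      (u.addComp i h).posIndicator =ᵐ[volume.restrict Ω] u.posIndicator := by
  constructor
  · intro k
    filter_upwards [hu k, hθ] with x hk hx
    rw [SobolevH1.addComp_apply]
    split_ifs with hki
    · subst hki
      nlinarith [mul_le_mul_of_nonneg_left hx.2 ht.le, mul_le_mul_of_nonneg_right htL hk]
    · simpa using hk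
  · classical
    filter_upwards [hu i, hθ] with x hk hx
    rcases hk.eq_or_lt with h0 | h0
    · have : θ x = 0 := le_antisymm (by simpa [← h0] using hx.2) hx.1
      rw [SobolevH1.posIndicator_eq, SobolevH1.posIndicator_eq,
        SobolevH1.addComp_of_eq_zero u i h (by simp [this])]
    · have hv : 0 < (u.addComp i h).toFun x i := by
        rw [SobolevH1.addComp_apply, if_pos rfl]
        nlinarith [mul_le_mul_of_nonneg_left hx.2 ht.le, mul_le_mul_of_nonneg_right htL h0.le]
      have ne : ∀ {v : EuclideanSpace ℝ (Fin m)}, 0 < v i → v ≠ 0 := by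
        rintro v hv rfl; simp at hv
      rw [SobolevH1.posIndicator_eq, SobolevH1.posIndicator_eq, if_neg (ne hv), if_neg (ne h0)]

variable [IsFiniteMeasure (volume.restrict Ω)]

/-- First variation in the direction `-θ`. The positivity set is unchanged, so the distance to `u`
is of order `t` and the energy difference is `-2tA + t²K`; dividing by `t` and letting `t → 0` gives
`A ≤ 0`. -/
lemma SobolevH1.IsLocalMinimizer.integral_grad_mul_nonpos (hQ : IsWeight Ω Q Qmax)
    (hu : SobolevH1.IsLocalMinimizer Q g u) {i : Fin m} {L : ℝ}
    (hθ : ∀ᵐ x ∂(volume.restrict Ω), 0 ≤ θ x ∧ θ x ≤ L * u.toFun x i) (h : IsH10 Ω θ Γ) :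
    ∫ x in Ω, ∑ j, u.grad i x j * Γ j x ≤ 0 := by
  obtain ⟨⟨hb, hn⟩, ε, hε, hmin⟩ := hu
  set A := ∫ x in Ω, ∑ j, u.grad i x j * Γ j x with hA
  set K := ∫ x in Ω, ∑ j, Γ j x ^ 2 with hK
  set K' := ∫ x in Ω, (θ x ^ 2 + ∑ j, Γ j x ^ 2) with hK'
  have iA : Integrable (fun x => ∑ j, u.grad i x j * Γ j x) (volume.restrict Ω) :=
    integrable_finsetSum _ fun j _ => (u.memLp_grad_coord i j).integrable_mul (h.memLp_grad j)
  have iK : Integrable (fun x => ∑ j, Γ j x ^ 2) (volume.restrict Ω) :=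
    integrable_finsetSum _ fun j _ => (h.memLp_grad j).integrable_sq
  have key : ∀ᶠ t in 𝓝[>] (0 : ℝ), A ≤ t / 2 * K := by
    have c1 : ∀ᶠ t in 𝓝[>] (0 : ℝ), t * L < 1 / 2 := by
      have : Tendsto (fun t : ℝ => t * L) (𝓝[>] 0) (𝓝 (0 * L)) :=
        (tendsto_id.mono_left nhdsWithin_le_nhds).mul_const L
      rw [zero_mul] at this
      exact this.eventually_lt_const (by norm_num)
    have c2 : ∀ᶠ t in 𝓝[>] (0 : ℝ), t * Real.sqrt K' < ε := by
      have : Tendsto (fun t : ℝ => t * Real.sqrt K') (𝓝[>] 0) (𝓝 (0 * Real.sqrt K')) :=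
        (tendsto_id.mono_left nhdsWithin_le_nhds).mul_const _
      rw [zero_mul] at this
      exact this.eventually_lt_const hε
    filter_upwards [c1, c2, self_mem_nhdsWithin] with t h1 h2 h3
    have ht : 0 < t := h3
    obtain ⟨p1, p2⟩ := SobolevH1.addComp_neg_nonneg hn ht h1.le hθ (h.const_mul (-t))
    have d : SobolevH1.dist u (u.addComp i (h.const_mul (-t))) = t * Real.sqrt K' := by
      rw [SobolevH1.dist_addComp]
      have e1 : ∫ x in Ω, |u.posIndicator x - (u.addComp i (h.const_mul (-t))).posIndicator x| =
          0 := by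
        rw [integral_eq_zero_of_ae]
        filter_upwards [p2] with x hx
        exact abs_eq_zero.2 (sub_eq_zero.2 hx.symm)
      have e2 : ∫ x in Ω, ((-t * θ x) ^ 2 + ∑ j, (-t * Γ j x) ^ 2) = t ^ 2 * K' := by
        rw [hK', ← integral_const_mul]
        congr 1; ext x
        rw [mul_add, Finset.mul_sum]
        simp only [mul_pow, neg_sq]
      rw [e1, e2, add_zero, Real.sqrt_mul (sq_nonneg t), Real.sqrt_sq ht.le]
    have hle := hmin _ ⟨SobolevH1.addComp_eqOnBoundary hb i _, p1⟩ (d.trans_lt h2)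
    have e3 : ∫ x in Ω, Q x ^ 2 * ((u.addComp i (h.const_mul (-t))).posIndicator x -
        u.posIndicator x) = 0 := by
      rw [integral_eq_zero_of_ae]
      filter_upwards [p2] with x hx
      exact mul_eq_zero_of_right _ (sub_eq_zero.2 hx)
    have e4 : ∫ x in Ω, (2 * ∑ j, u.grad i x j * (-t * Γ j x) + ∑ j, (-t * Γ j x) ^ 2) =
        -2 * t * A + t ^ 2 * K := by
      rw [hA, hK, ← integral_const_mul, ← integral_const_mul,
        ← integral_add (iA.const_mul _) (iK.const_mul _)]
      congr 1; ext x
      simp only [Finset.mul_sum]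
      congr 1
      · exact Finset.sum_congr rfl fun j _ => by ring
      · exact Finset.sum_congr rfl fun j _ => by ring
    rw [SobolevH1.energy_addComp hQ, e3, e4] at hle
    have : 0 ≤ t * (t / 2 * K - A) := by nlinarith
    linarith [(mul_nonneg_iff_of_pos_left ht).1 this]
  have lim : Tendsto (fun t : ℝ => t / 2 * K) (𝓝[>] 0) (𝓝 0) := by
    have : Tendsto (fun t : ℝ => t / 2 * K) (𝓝[>] 0) (𝓝 (0 / 2 * K)) :=
      ((tendsto_id.mono_left nhdsWithin_le_nhds).div_const 2).mul_const K
    simpa using this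
  exact ge_of_tendsto lim key

/-- The components of a local minimizer are weakly subharmonic. -/
lemma SobolevH1.IsLocalMinimizer.weaklySubharmonic (hΩ : IsOpen Ω) (hQ : IsWeight Ω Q Qmax)
    (hu : SobolevH1.IsLocalMinimizer Q g u) (i : Fin m) :
    WeaklySubharmonic Ω (fun x => u.toFun x i) := by
  intro φ hφ hφ0
  set f : Euc n → ℝ := fun x => u.toFun x i with hf
  set G := u.grad i with hG
  have hf2 : MemLp f 2 (volume.restrict Ω) := u.memLp_coord i
  have hG2 := u.memLp_grad i
  have hw := u.isWeakGradient i
  have hf0 := hu.1.2 i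
  have hlap : IsTest Ω (lap φ) := hφ.lap
  -- The direction is `φ f / smoothAbs δ f`, bounded by a multiple of `f` as the first variation
  -- demands. The factor `f / smoothAbs δ f` is the derivative of `smoothAbs δ` at `f`, so the
  -- variation speaks about the gradient of `smoothAbs δ f`.
  have main : ∀ δ : ℝ, 0 < δ → 0 ≤ ∫ x in Ω, smoothAbs δ (f x) * lap φ x := by
    intro δ hδ
    have hΘc : Continuous fun s => s / smoothAbs δ s := (contDiff_div_smoothAbs hδ).continuous
    have hΘ'c : Continuous fun s => δ ^ 2 / smoothAbs δ s ^ 3 :=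
      continuous_const.div ((contDiff_smoothAbs hδ).continuous.pow 3)
        fun s => (pow_pos (smoothAbs_pos hδ s) 3).ne'
    have h1 := isH10_mul_comp hΩ hf2 hG2 hw hφ (contDiff_div_smoothAbs hδ)
      (hasDerivAt_div_smoothAbs hδ) hΘ'c (abs_deriv_div_smoothAbs_le hδ)
    have h2 := fun j => isH10_mul_comp hΩ hf2 hG2 hw (hφ.pd j) (contDiff_smoothAbs hδ)
      (hasDerivAt_smoothAbs hδ) hΘc (abs_div_smoothAbs_le hδ)
    have h3 := (isH10_mul_comp hΩ hf2 hG2 hw hlap (contDiff_smoothAbs hδ)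
      (hasDerivAt_smoothAbs hδ) hΘc (abs_div_smoothAbs_le hδ)).memLp.integrable one_le_two
    set X : Euc n → ℝ := fun x => ∑ j, pd j φ x * (f x / smoothAbs δ (f x) * G x j) with hX
    -- The integrand is the divergence of `smoothAbs δ (f) ∇φ`, a field with components in `H¹₀`.
    have e1 : ∫ x in Ω, (lap φ x * smoothAbs δ (f x) + X x) = 0 := by
      have : ∀ x, lap φ x * smoothAbs δ (f x) + X x = ∑ j, (smoothAbs δ (f x) *
          pd j (pd j φ) x + pd j φ x * (f x / smoothAbs δ (f x) * G x j)) := fun x => by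
        rw [Finset.sum_add_distrib, ← Finset.mul_sum, mul_comm]; rfl
      simp only [this]
      rw [integral_finsetSum _ fun j _ => ((h2 j).memLp_grad j).integrable one_le_two]
      exact Finset.sum_eq_zero fun j _ => (h2 j).integral_grad_eq_zero j
    have iX : Integrable X (volume.restrict Ω) := by
      have : Integrable (fun x => lap φ x * smoothAbs δ (f x) + X x) (volume.restrict Ω) := by
        have e : ∀ x, lap φ x * smoothAbs δ (f x) + X x = ∑ j, (smoothAbs δ (f x) *
            pd j (pd j φ) x + pd j φ x * (f x / smoothAbs δ (f x) * G x j)) := fun x => by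
          rw [Finset.sum_add_distrib, ← Finset.mul_sum, mul_comm]; rfl
        simp only [e]
        exact integrable_finsetSum _ fun j _ => ((h2 j).memLp_grad j).integrable one_le_two
      refine (this.sub h3).congr (Eventually.of_forall fun x => ?_)
      simp
    have v := hu.integral_grad_mul_nonpos hQ (L := hφ.exists_bound.choose * δ⁻¹)
      (i := i) (by
        obtain ⟨hC0, hC⟩ := hφ.exists_bound.choose_spec
        filter_upwards [hf0] with x hx
        have hp := smoothAbs_pos hδ (f x)
        refine ⟨mul_nonneg (hφ0 x) (div_nonneg hx hp.le), ?_⟩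
        have b1 : f x / smoothAbs δ (f x) ≤ δ⁻¹ * f x := by
          rw [div_eq_inv_mul]
          exact mul_le_mul_of_nonneg_right (inv_anti₀ hδ (le_smoothAbs δ _)) hx
        calc φ x * (f x / smoothAbs δ (f x)) ≤ hφ.exists_bound.choose * (δ⁻¹ * f x) :=
              mul_le_mul ((le_abs_self _).trans (hC x)) b1 (div_nonneg hx hp.le) hC0
          _ = _ := by ring) h1
    have v2 : ∫ x in Ω, X x ≤ 0 := by
      refine (integral_mono iX (integrable_finsetSum _ fun j _ =>
        (u.memLp_grad_coord i j).integrable_mul (h1.memLp_grad j)) fun x => ?_).trans v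
      refine Finset.sum_le_sum fun j _ => ?_
      -- Convexity of `smoothAbs δ` gives this term its sign, so it can be dropped from the first
      -- variation.
      have : 0 ≤ φ x * (δ ^ 2 / smoothAbs δ (f x) ^ 3) * (G x j) ^ 2 := by
        have := smoothAbs_pos hδ (f x)
        have := hφ0 x
        positivity
      calc _ ≤ pd j φ x * (f x / smoothAbs δ (f x) * G x j) +
            φ x * (δ ^ 2 / smoothAbs δ (f x) ^ 3) * (G x j) ^ 2 := by linarith
        _ = G x j * (f x / smoothAbs δ (f x) * pd j φ x +
            φ x * (δ ^ 2 / smoothAbs δ (f x) ^ 3 * G x j)) := by ring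
    rw [integral_add h3 iX] at e1
    simp only [mul_comm (smoothAbs δ _)]
    linarith
  have ilap : Integrable (fun x => |lap φ x|) (volume.restrict Ω) := hlap.integrable.abs.restrict
  -- As `f ≥ 0`, one has `f ≤ smoothAbs δ f ≤ f + δ`, so removing the regularization costs at most
  -- `δ ∫ |Δφ|`.
  have bound : ∀ δ : ℝ, 0 < δ → -(δ * ∫ x in Ω, |lap φ x|) ≤ ∫ x in Ω, f x * lap φ x := by
    intro δ hδ
    have hi : Integrable (fun x => f x * lap φ x) (volume.restrict Ω) :=
      hf2.integrable_mul_test hlap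
    have h4 : ∫ x in Ω, smoothAbs δ (f x) * lap φ x ≤
        ∫ x in Ω, (f x * lap φ x + δ * |lap φ x|) := by
      refine integral_mono_ae ?_ (hi.add (ilap.const_mul δ)) ?_
      · refine (hi.abs.add (ilap.const_mul δ)).mono' ?_ (Eventually.of_forall fun x => ?_)
        · exact ((contDiff_smoothAbs hδ).continuous.comp_aestronglyMeasurable hf2.1).mul
            hlap.1.continuous.aestronglyMeasurable
        · simp only [Real.norm_eq_abs, abs_mul, Pi.add_apply]
          rw [abs_of_pos (smoothAbs_pos hδ _), ← add_mul]
          exact mul_le_mul_of_nonneg_right (smoothAbs_le hδ _) (abs_nonneg _)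
      · filter_upwards [hf0] with x hx
        have a1 := smoothAbs_le hδ (f x)
        have a2 := abs_le_smoothAbs δ (f x)
        rw [abs_of_nonneg hx] at a1 a2
        have : (smoothAbs δ (f x) - f x) * lap φ x ≤ δ * |lap φ x| :=
          (mul_le_mul_of_nonneg_left (le_abs_self (lap φ x)) (sub_nonneg.2 a2)).trans
            (mul_le_mul_of_nonneg_right (by linarith) (abs_nonneg _))
        linarith
    rw [integral_add hi (ilap.const_mul δ), integral_const_mul] at h4
    linarith [main δ hδ]
  have lim : Tendsto (fun δ : ℝ => -(δ * ∫ x in Ω, |lap φ x|)) (𝓝[>] 0) (𝓝 0) := by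
    have : Tendsto (fun δ : ℝ => -(δ * ∫ x in Ω, |lap φ x|)) (𝓝[>] 0)
        (𝓝 (-(0 * ∫ x in Ω, |lap φ x|))) :=
      ((tendsto_id.mono_left nhdsWithin_le_nhds).mul_const _).neg
    simpa using this
  exact le_of_tendsto lim (by filter_upwards [self_mem_nhdsWithin] with δ hδ using bound δ hδ)

end Subharmonic
end

/-! ### The test function built from a harmonic replacement. -/

noncomputable section

/-- Cauchy–Schwarz for vector fields, from the discriminant of the nonnegative quadratic `t ↦ ∫ |a +
t b|²`. -/
lemma sq_integral_sum_mul_le {α ι : Type*} [Fintype ι] [MeasurableSpace α] {μ : Measure α}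
    {a b : ι → α → ℝ} (ha : ∀ j, MemLp (a j) 2 μ) (hb : ∀ j, MemLp (b j) 2 μ) :
    (∫ x, ∑ j, a j x * b j x ∂μ) ^ 2 ≤
      (∫ x, ∑ j, a j x ^ 2 ∂μ) * ∫ x, ∑ j, b j x ^ 2 ∂μ := by
  have ia : Integrable (fun x => ∑ j, a j x ^ 2) μ :=
    integrable_finsetSum _ fun j _ => (ha j).integrable_sq
  have ib : Integrable (fun x => ∑ j, b j x ^ 2) μ :=
    integrable_finsetSum _ fun j _ => (hb j).integrable_sq
  have iab : Integrable (fun x => ∑ j, a j x * b j x) μ :=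
    integrable_finsetSum _ fun j _ => (ha j).integrable_mul (hb j)
  have h := discrim_le_zero (a := ∫ x, ∑ j, b j x ^ 2 ∂μ) (b := 2 * ∫ x, ∑ j, a j x * b j x ∂μ)
    (c := ∫ x, ∑ j, a j x ^ 2 ∂μ) fun t => by
      have : 0 ≤ ∫ x, ∑ j, (a j x + t * b j x) ^ 2 ∂μ :=
        integral_nonneg fun x => Finset.sum_nonneg fun j _ => sq_nonneg _
      have e : ∀ x, ∑ j, (a j x + t * b j x) ^ 2 = ((t * t) * ∑ j, b j x ^ 2 +
          (2 * t) * ∑ j, a j x * b j x) + ∑ j, a j x ^ 2 := fun x => by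
        rw [Finset.mul_sum, Finset.mul_sum, ← Finset.sum_add_distrib, ← Finset.sum_add_distrib]
        exact Finset.sum_congr rfl fun j _ => by ring
      simp only [e] at this
      have i1 : Integrable (fun x => (t * t) * ∑ j, b j x ^ 2 + (2 * t) * ∑ j, a j x * b j x) μ :=
        (ib.const_mul _).add (iab.const_mul _)
      rw [integral_add i1 ia,
        integral_add (ib.const_mul _) (iab.const_mul _), integral_const_mul,
        integral_const_mul] at this
      linarith
  rw [discrim] at h
  nlinarith

/-- A smooth approximation of the positive part of `s`. -/
def smoothPos (δ s : ℝ) : ℝ := ∫ τ in (0 : ℝ)..s, Real.smoothTransition ((τ - δ) / δ)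

section smoothPos
variable {δ : ℝ}

lemma hasDerivAt_smoothPos (δ s : ℝ) :
    HasDerivAt (smoothPos δ) (Real.smoothTransition ((s - δ) / δ)) s := by
  have hc : Continuous fun τ : ℝ => Real.smoothTransition ((τ - δ) / δ) :=
    Real.smoothTransition.continuous.comp (by fun_prop)
  exact (hc.integral_hasStrictDerivAt 0 s).hasDerivAt

lemma contDiff_smoothPos (δ : ℝ) : ContDiff ℝ ∞ (smoothPos δ) := by
  refine contDiff_infty_iff_deriv.2 ⟨fun s => (hasDerivAt_smoothPos δ s).differentiableAt, ?_⟩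
  rw [funext fun s => (hasDerivAt_smoothPos δ s).deriv]
  exact Real.smoothTransition.contDiff.comp (by fun_prop)

lemma smoothPos_eq_zero (hδ : 0 < δ) {s : ℝ} (hs : s ≤ δ) : smoothPos δ s = 0 := by
  rw [smoothPos, intervalIntegral.integral_congr (g := fun _ => 0), intervalIntegral.integral_zero]
  intro τ hτ
  have : τ ≤ δ := hτ.2.trans (sup_le hδ.le hs)
  exact Real.smoothTransition.zero_of_nonpos (div_nonpos_of_nonpos_of_nonneg (by linarith) hδ.le)

lemma monotone_smoothPos (δ : ℝ) : Monotone (smoothPos δ) :=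
  monotone_of_deriv_nonneg (fun s => (hasDerivAt_smoothPos δ s).differentiableAt) fun s => by
    rw [(hasDerivAt_smoothPos δ s).deriv]; exact Real.smoothTransition.nonneg _

lemma smoothPos_nonneg (hδ : 0 < δ) (s : ℝ) : 0 ≤ smoothPos δ s := by
  rcases le_total s δ with h | h
  · exact (smoothPos_eq_zero hδ h).ge
  · rw [← smoothPos_eq_zero hδ le_rfl]; exact monotone_smoothPos δ h

lemma sub_le_smoothPos (hδ : 0 < δ) (s : ℝ) : s - 2 * δ ≤ smoothPos δ s := by
  rcases le_total s (2 * δ) with h | h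
  · linarith [smoothPos_nonneg hδ s]
  · have hd : ∀ t, HasDerivAt (fun t => smoothPos δ t - t)
        (Real.smoothTransition ((t - δ) / δ) - 1) t := fun t =>
      (hasDerivAt_smoothPos δ t).sub (hasDerivAt_id t)
    have hm : MonotoneOn (fun t => smoothPos δ t - t) (Ici (2 * δ)) := by
      refine monotoneOn_of_deriv_nonneg (convex_Ici _)
        (fun t _ => (hd t).continuousAt.continuousWithinAt)
        (fun t _ => (hd t).differentiableAt.differentiableWithinAt) fun t ht => ?_
      rw [interior_Ici] at ht
      have ht : 2 * δ < t := ht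
      rw [(hd t).deriv, Real.smoothTransition.one_of_one_le, sub_self]
      rw [le_div_iff₀ hδ]; linarith
    have := hm self_mem_Ici h h
    simp only at this
    linarith [smoothPos_nonneg hδ (2 * δ)]

end smoothPos

section Barrier

variable {n : ℕ} {x₀ : Euc n} {R : ℝ}

/-- A test function comparing a smooth function with its harmonic replacement in a ball. -/
lemma exists_isTest_poissonInt_sub_le (hn : 1 ≤ n) {U : Euc n → ℝ} (hU : ContDiff ℝ ∞ U)
    (hR : 0 < R) {δ : ℝ} (hδ : 0 < δ) :
    ∃ φ, IsTest (Metric.ball x₀ R) φ ∧ (∀ x, 0 ≤ φ x) ∧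
      (∀ x ∈ Metric.ball x₀ R, poissonInt U x₀ R x - U x - 2 * δ ≤ φ x) ∧
      ∫ x, ∑ j, pd j φ x ^ 2 ≤ -∫ x, ∑ j, pd j φ x * pd j U x := by
  classical
  set B := Metric.ball x₀ R with hB
  set h := poissonInt U x₀ R with hh
  have hBo : IsOpen B := Metric.isOpen_ball
  have hhs : ContDiffOn ℝ ∞ h B := contDiffOn_poissonInt hU.continuous x₀ R
  -- Outside radius `s` the difference `h - U` is below `δ`, where `smoothPos δ` vanishes; hence `φ`
  -- has compact support in the open ball even though `h` is only smooth inside.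
  obtain ⟨s, hs0, hsR, hs⟩ := poissonInt_lt_add hn hU.continuous x₀ hR hδ
  set φ : Euc n → ℝ := fun x => if x ∈ B then smoothPos δ (h x - U x) else 0 with hφdef
  have hφB : ∀ x ∈ B, φ x = smoothPos δ (h x - U x) := fun x hx => if_pos hx
  have hφ0 : ∀ x, s < ‖x - x₀‖ → φ x = 0 := by
    intro x hx
    by_cases hxB : x ∈ B
    · rw [hφB x hxB]
      exact smoothPos_eq_zero hδ (by linarith [hs x hxB hx])
    · exact if_neg hxB
  have hsub : Metric.closedBall x₀ s ⊆ B := Metric.closedBall_subset_ball hsR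
  have hts : tsupport φ ⊆ Metric.closedBall x₀ s := by
    refine closure_minimal (fun x hx => ?_) Metric.isClosed_closedBall
    by_contra hc
    rw [Metric.mem_closedBall, dist_eq_norm, not_le] at hc
    exact hx (hφ0 x hc)
  have hev : ∀ x ∈ B, φ =ᶠ[𝓝 x] fun y => smoothPos δ (h y - U y) := fun x hx => by
    filter_upwards [hBo.mem_nhds hx] with y hy using hφB y hy
  have hφ : IsTest B φ := by
    refine ⟨contDiff_iff_contDiffAt.2 fun x => ?_, ?_, hts.trans hsub⟩
    · by_cases hx : x ∈ B
      · refine ContDiffAt.congr_of_eventuallyEq ?_ (hev x hx)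
        exact (contDiff_smoothPos δ).contDiffAt.comp x
          ((hhs.contDiffAt (hBo.mem_nhds hx)).sub hU.contDiffAt)
      · have : (Metric.closedBall x₀ s)ᶜ ∈ 𝓝 x :=
          Metric.isClosed_closedBall.isOpen_compl.mem_nhds fun hc => hx (hsub hc)
        refine (contDiffAt_const (c := (0 : ℝ))).congr_of_eventuallyEq ?_
        filter_upwards [this] with y hy
        refine hφ0 y ?_
        rwa [mem_compl_iff, Metric.mem_closedBall, dist_eq_norm, not_le] at hy
    · exact HasCompactSupport.of_support_subset_isCompact (isCompact_closedBall x₀ s)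
        ((subset_tsupport _).trans hts)
  have hpd : ∀ j, ∀ x ∈ B, pd j φ x =
      Real.smoothTransition ((h x - U x - δ) / δ) * (pd j h x - pd j U x) := by
    intro j x hx
    have d1 : DifferentiableAt ℝ h x := hhs.diffAt hBo hx
    have e : pd j φ x = pd j (fun y => smoothPos δ (h y - U y)) x := by
      simp only [pd, (hev x hx).fderiv_eq]
    rw [e, pd_comp (f := fun y => h y - U y) (hasDerivAt_smoothPos δ _) (d1.sub hU.diffAt), pd_sub d1 hU.diffAt]
  refine ⟨φ, hφ, fun x => ?_, fun x hx => ?_, ?_⟩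
  · by_cases hx : x ∈ B
    · rw [hφB x hx]; exact smoothPos_nonneg hδ _
    · exact (if_neg hx).ge
  · rw [hφB x hx]; exact sub_le_smoothPos hδ _
  · have i1 : ∀ j, Integrable (fun x => pd j φ x * pd j h x) := fun j =>
      (hφ.pd j).integrable_mul hBo (hhs.pd hBo j).continuousOn
    have i2 : ∀ j, Integrable (fun x => pd j φ x * pd j U x) := fun j =>
      (hφ.pd j).integrable_mul hBo (hU.pd j).continuous.continuousOn
    -- The Dirichlet pairing of a test function with the weakly harmonic `h` vanishes.
    have hz : ∫ x, ∑ j, pd j φ x * pd j h x = 0 := by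
      rw [integral_finsetSum _ fun j _ => i1 j]
      have := integral_lap_mul hBo hφ hhs
      rw [integral_poissonInt_mul_lap hU.continuous hR hφ] at this
      linarith
    have hle : ∫ x, ∑ j, pd j φ x ^ 2 ≤
        ∫ x, ((∑ j, pd j φ x * pd j h x) - ∑ j, pd j φ x * pd j U x) := by
      refine integral_mono (integrable_finsetSum _ fun j _ => ((hφ.pd j).memLp 2).integrable_sq)
        ((integrable_finsetSum _ fun j _ => i1 j).sub (integrable_finsetSum _ fun j _ => i2 j))
        fun x => ?_
      simp only [← Finset.sum_sub_distrib]
      refine Finset.sum_le_sum fun j _ => ?_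
      by_cases hx : x ∈ B
      · rw [hpd j x hx]
        set T := Real.smoothTransition ((h x - U x - δ) / δ)
        have t0 : 0 ≤ T := Real.smoothTransition.nonneg _
        have t1 : T ≤ 1 := Real.smoothTransition.le_one _
        -- With `∇φ = T ∇(h - U)` and `0 ≤ T ≤ 1`, this says `|∇φ|² ≤ ∇φ · ∇(h - U)`.
        have : T * T * (pd j h x - pd j U x) ^ 2 ≤ T * 1 * (pd j h x - pd j U x) ^ 2 := by gcongr
        linarith
      · rw [(hφ.pd j).eq_zero hx]; simp
    rw [integral_sub (integrable_finsetSum _ fun j _ => i1 j)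
      (integrable_finsetSum _ fun j _ => i2 j), hz] at hle
    linarith

end Barrier
end

/-! ### Energy comparison with the raised component. -/

noncomputable section

section Estimate

variable {n m : ℕ} {Ω : Set (Euc n)} {Q : Euc n → ℝ} {Qmax : ℝ} {u g : SobolevH1 Ω m} {i : Fin m}
  {x₀ : Euc n} {R : ℝ}

lemma SobolevH1.addComp_nonneg {θ : Euc n → ℝ} {Γ : Fin n → Euc n → ℝ} (hu : u.Nonneg)
    (hθ : ∀ x, 0 ≤ θ x) (h : IsH10 Ω θ Γ) : (u.addComp i h).Nonneg := by
  intro k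
  filter_upwards [hu k] with x hk
  rw [SobolevH1.addComp_apply]
  have := hθ x
  split_ifs <;> linarith

lemma setIntegral_eq_of_eq_zero_of_notMem {B : Set (Euc n)} (hBΩ : B ⊆ Ω)
    {F : Euc n → ℝ} (hF : ∀ x ∉ B, F x = 0) : ∫ x in Ω, F x = ∫ x in B, F x := by
  rw [setIntegral_eq_integral_of_forall_compl_eq_zero fun x hx => hF x fun h => hx (hBΩ h),
    setIntegral_eq_integral_of_forall_compl_eq_zero hF]

variable [IsFiniteMeasure (volume.restrict Ω)]

lemma SobolevH1.integrable_one_sub_posIndicator (u : SobolevH1 Ω m) :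
    Integrable (fun x => 1 - u.posIndicator x) (volume.restrict Ω) := by
  refine (integrable_const (1 : ℝ)).mono'
    (aestronglyMeasurable_const.sub u.aestronglyMeasurable_posIndicator)
    (Eventually.of_forall fun x => ?_)
  rw [Real.norm_eq_abs, abs_le]
  constructor <;> linarith [u.posIndicator_nonneg x, u.posIndicator_le_one x]

/-- The positivity set can only gain points of `B` where `u = 0`, and each costs at most `Qmax²`; `1
- u.posIndicator` is the indicator of the zero set. -/
lemma SobolevH1.integral_posIndicator_addComp_sub_le (hQ : IsWeight Ω Q Qmax)
    (u : SobolevH1 Ω m) {B : Set (Euc n)} (hBΩ : B ⊆ Ω)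
    {θ : Euc n → ℝ} {Γ : Fin n → Euc n → ℝ} (hθ : ∀ x ∉ B, θ x = 0) (h : IsH10 Ω θ Γ) :
    ∫ x in Ω, Q x ^ 2 * ((u.addComp i h).posIndicator x - u.posIndicator x) ≤
      Qmax ^ 2 * ∫ x in B, (1 - u.posIndicator x) := by
  classical
  have hz : ∀ x ∉ B, Q x ^ 2 * ((u.addComp i h).posIndicator x - u.posIndicator x) = 0 := by
    intro x hx
    rw [SobolevH1.posIndicator_eq, SobolevH1.posIndicator_eq,
      SobolevH1.addComp_of_eq_zero u i h (hθ x hx), sub_self, mul_zero]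
  rw [setIntegral_eq_of_eq_zero_of_notMem hBΩ hz, ← integral_const_mul]
  refine integral_mono_ae ?_ ?_ ?_
  · have := ((u.addComp i h).integrable_weight hQ).sub (u.integrable_weight hQ)
    simp only [mul_sub]
    exact this.mono_measure (Measure.restrict_mono hBΩ le_rfl)
  · exact (u.integrable_one_sub_posIndicator.mono_measure
      (Measure.restrict_mono hBΩ le_rfl)).const_mul _
  · filter_upwards [ae_restrict_of_ae_restrict_of_subset hBΩ hQ.sq_le] with x hx
    have h1 := (u.addComp i h).posIndicator_le_one x
    have h2 := u.posIndicator_le_one x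
    calc _ ≤ Q x ^ 2 * (1 - u.posIndicator x) :=
          mul_le_mul_of_nonneg_left (by linarith) (sq_nonneg _)
      _ ≤ _ := mul_le_mul_of_nonneg_right hx (by linarith)

lemma Continuous.memLp_ball {U : Euc n → ℝ} (hU : Continuous U) :
    MemLp U 2 (volume.restrict (Metric.ball x₀ R)) := by
  rw [memLp_two_iff_integrable_sq hU.aestronglyMeasurable]
  exact ((hU.pow 2).continuousOn.integrableOn_compact
    (isCompact_closedBall x₀ R)).mono_set Metric.ball_subset_closedBall

/-- Comparison of `u` with the competitor obtained by raising one component towards the harmonic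
replacement of a smooth approximation of it. -/
lemma SobolevH1.exists_isTest_poissonInt_sub_le (hn : 1 ≤ n) (hQ : IsWeight Ω Q Qmax)
    (hR : 0 < R) (hsub : Metric.ball x₀ R ⊆ Ω) {τ : ℝ} (hτ : 0 ≤ τ)
    (hmin : ∀ φ (hφ : IsTest (Metric.ball x₀ R) φ), (∀ x, 0 ≤ φ x) →
      ∫ x, ∑ j, pd j φ x ^ 2 ≤ τ ^ 2 →
      SobolevH1.energy Q u ≤ SobolevH1.energy Q (u.addComp i (hφ.mono hsub).isH10))
    {U : Euc n → ℝ} (hU : ContDiff ℝ ∞ U)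
    (he : 2 * (∫ x in Metric.ball x₀ R, ∑ j, u.grad i x j ^ 2) +
      2 * (∫ x in Metric.ball x₀ R, ∑ j, (u.grad i x j - pd j U x) ^ 2) ≤ τ ^ 2)
    {δ : ℝ} (hδ : 0 < δ) :
    ∃ φ, IsTest (Metric.ball x₀ R) φ ∧ (∀ x, 0 ≤ φ x) ∧
      (∀ x ∈ Metric.ball x₀ R, poissonInt U x₀ R x - U x - 2 * δ ≤ φ x) ∧
      ∫ x, ∑ j, pd j φ x ^ 2 ≤
        2 * (Real.sqrt (∫ x in Metric.ball x₀ R, ∑ j, (u.grad i x j - pd j U x) ^ 2) * τ) +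
        Qmax ^ 2 * ∫ x in Metric.ball x₀ R, (1 - u.posIndicator x) := by
  obtain ⟨φ, hφ, hφ0, hφle, hφS⟩ := _root_.exists_isTest_poissonInt_sub_le hn hU hR hδ (x₀ := x₀)
  refine ⟨φ, hφ, hφ0, hφle, ?_⟩
  set B := Metric.ball x₀ R with hB
  set S := ∫ x, ∑ j, pd j φ x ^ 2 with hS
  set e := ∫ x in B, ∑ j, (u.grad i x j - pd j U x) ^ 2 with he'
  have hpz : ∀ x ∉ B, ∀ j, pd j φ x = 0 := fun x hx j => (hφ.pd j).eq_zero hx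
  have hSB : S = ∫ x in B, ∑ j, pd j φ x ^ 2 := by
    rw [hS, setIntegral_eq_integral_of_forall_compl_eq_zero fun x hx => by simp [hpz x hx]]
  have hUB : ∫ x, ∑ j, pd j φ x * pd j U x = ∫ x in B, ∑ j, pd j φ x * pd j U x := by
    rw [setIntegral_eq_integral_of_forall_compl_eq_zero fun x hx => by simp [hpz x hx]]
  have hS0 : 0 ≤ S := integral_nonneg fun x => Finset.sum_nonneg fun j _ => sq_nonneg _
  have he0 : 0 ≤ e := integral_nonneg fun x => Finset.sum_nonneg fun j _ => sq_nonneg _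
  have mφ : ∀ j, MemLp (pd j φ) 2 (volume.restrict B) := fun j => ((hφ.pd j).memLp 2).restrict B
  have mU : ∀ j, MemLp (pd j U) 2 (volume.restrict B) := fun j => (hU.pd j).continuous.memLp_ball
  have mG : ∀ j, MemLp (fun x => u.grad i x j) 2 (volume.restrict B) := fun j =>
    (u.memLp_grad_coord i j).mono_measure (Measure.restrict_mono hsub le_rfl)
  have mD : ∀ j, MemLp (fun x => u.grad i x j - pd j U x) 2 (volume.restrict B) :=
    fun j => (mG j).sub (mU j)
  have isum : ∀ {a b : Fin n → Euc n → ℝ}, (∀ j, MemLp (a j) 2 (volume.restrict B)) →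
      (∀ j, MemLp (b j) 2 (volume.restrict B)) →
      Integrable (fun x => ∑ j, a j x * b j x) (volume.restrict B) := fun ha hb =>
    integrable_finsetSum _ fun j _ => (ha j).integrable_mul (hb j)
  have isq : ∀ {a : Fin n → Euc n → ℝ}, (∀ j, MemLp (a j) 2 (volume.restrict B)) →
      Integrable (fun x => ∑ j, a j x ^ 2) (volume.restrict B) := fun ha =>
    integrable_finsetSum _ fun j _ => (ha j).integrable_sq
  -- Membership in the range where minimality is assumed: `S ≤ -∫ ∇φ·∇U` and Cauchy–Schwarz give `S
  -- ≤ ∫ |∇U|²`, and the latter is at most `2∫|∇uᵢ|² + 2∫|∇uᵢ - ∇U|²`.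
  have hSτ : S ≤ τ ^ 2 := by
    have h1 : ∫ x in B, ∑ j, pd j U x ^ 2 ≤ τ ^ 2 := by
      refine le_trans ?_ he
      rw [← integral_const_mul, ← integral_const_mul,
        ← integral_add ((isq mG).const_mul 2) ((isq mD).const_mul 2)]
      refine integral_mono (isq mU) (((isq mG).const_mul 2).add ((isq mD).const_mul 2)) fun x => ?_
      simp only [Finset.mul_sum, ← Finset.sum_add_distrib]
      refine Finset.sum_le_sum fun j _ => ?_
      nlinarith [sq_nonneg (2 * u.grad i x j - pd j U x)]
    have h2 := sq_integral_sum_mul_le mφ mU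
    rw [← hSB, ← hUB] at h2
    rcases hS0.eq_or_lt with h | h
    · rw [← h]; positivity
    · have h3 : S ^ 2 ≤ (∫ x, ∑ j, pd j φ x * pd j U x) ^ 2 := by
        rw [← neg_sq (∫ x, ∑ j, pd j φ x * pd j U x)]
        exact pow_le_pow_left₀ hS0 hφS 2
      have h4 : S * S ≤ S * ∫ x in B, ∑ j, pd j U x ^ 2 := by
        rw [← sq]; exact h3.trans h2
      exact (le_of_mul_le_mul_left h4 h).trans h1
  have hE := hmin φ hφ hφ0 hSτ
  rw [SobolevH1.energy_addComp hQ] at hE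
  have hE2 := u.integral_posIndicator_addComp_sub_le (i := i) hQ hsub
    (fun x hx => hφ.eq_zero hx) (hφ.mono hsub).isH10
  have hE3 : ∫ x in Ω, (2 * ∑ j, u.grad i x j * pd j φ x + ∑ j, pd j φ x ^ 2) =
      2 * (∫ x in B, ∑ j, u.grad i x j * pd j φ x) + S := by
    rw [setIntegral_eq_of_eq_zero_of_notMem hsub fun x hx => by simp [hpz x hx],
      integral_add ((isum mG mφ).const_mul 2) (isq mφ), integral_const_mul, hSB]
  rw [hE3] at hE
  have hsplit : (∫ x in B, ∑ j, u.grad i x j * pd j φ x) - ∫ x in B, ∑ j, pd j φ x * pd j U x =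
      ∫ x in B, ∑ j, (u.grad i x j - pd j U x) * pd j φ x := by
    rw [← integral_sub (isum mG mφ) (isum mφ mU)]
    congr 1; ext x
    rw [← Finset.sum_sub_distrib]
    exact Finset.sum_congr rfl fun j _ => by ring
  have hCS : ∫ x in B, ∑ j, (u.grad i x j - pd j U x) * pd j φ x ≤ Real.sqrt e * τ := by
    have h2 := sq_integral_sum_mul_le mD mφ
    rw [← hSB] at h2
    refine Real.le_sqrt_of_sq_le (h2.trans ?_) |>.trans (le_of_eq ?_) (b := Real.sqrt (e * τ ^ 2))
    · exact mul_le_mul_of_nonneg_left hSτ he0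
    · rw [Real.sqrt_mul he0, Real.sqrt_sq hτ]
  rw [hUB] at hφS
  -- Minimality reads `0 ≤ 2∫ ∇uᵢ·∇φ + S + Qmax²|Z|`, where `|Z|` is the measure of the zero set in
  -- the ball. Splitting `∇uᵢ` into `∇U` and the error, the first part contributes at most `-2S` by
  -- `hφS`, which leaves the bound on `S`.
  linarith

end Estimate
end

/-! ### Hardy's inequality against the Poisson lower bound. -/

noncomputable section

section Dichotomy

variable {n m : ℕ} {Ω : Set (Euc n)} {Q : Euc n → ℝ} {Qmax : ℝ} {u g : SobolevH1 Ω m} {i : Fin m}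
  {x₀ : Euc n} {R : ℝ} [IsFiniteMeasure (volume.restrict Ω)]

/-- The lower barrier furnished by the Poisson integral of a nonnegative function whose mean over
the sphere `∂B_R(x₀)` is `M`. -/
def poissonBarrier (x₀ : Euc n) (R M : ℝ) (x : Euc n) : ℝ :=
  (R ^ 2 - ‖x - x₀‖ ^ 2) / (2 ^ n * R ^ 2) * M

lemma ball_sq_sub_pos {x : Euc n} (hx : x ∈ Metric.ball x₀ R) : 0 < R ^ 2 - ‖x - x₀‖ ^ 2 := by
  rw [Metric.mem_ball, dist_eq_norm] at hx
  nlinarith [norm_nonneg (x - x₀)]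

lemma measurable_hardyWeight (x₀ : Euc n) (R : ℝ) :
    Measurable fun x : Euc n => (R / (R ^ 2 - ‖x - x₀‖ ^ 2)) ^ 2 :=
  (measurable_const.div (Continuous.measurable (by fun_prop))).pow_const 2

lemma IsTest.integrable_sq_mul_hardyWeight {φ : Euc n → ℝ} (hφ : IsTest (Metric.ball x₀ R) φ) :
    Integrable fun x => φ x ^ 2 * (R / (R ^ 2 - ‖x - x₀‖ ^ 2)) ^ 2 := by
  have h1 : IsTest (Metric.ball x₀ R) fun x => φ x * φ x :=
    hφ.mul_contDiffOn Metric.isOpen_ball hφ.1.contDiffOn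
  refine (h1.integrable_mul (f := fun x => (R / (R ^ 2 - ‖x - x₀‖ ^ 2)) ^ 2)
    Metric.isOpen_ball ?_).congr (Eventually.of_forall fun x => by simp only [sq])
  refine (continuousOn_const.div (Continuous.continuousOn (by fun_prop)) fun x hx => ?_).pow 2
  exact (ball_sq_sub_pos hx).ne'

/-- Hardy's inequality for test functions, with lower integrals. -/
lemma lintegral_hardy_le (hn : 1 ≤ n) {φ : Euc n → ℝ} (hφ : IsTest (Metric.ball x₀ R) φ)
    {b : ℝ} (hb : ∫ x, ∑ j, pd j φ x ^ 2 ≤ b) :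
    ∫⁻ x in Metric.ball x₀ R,
      ENNReal.ofReal (φ x ^ 2 * (R / (R ^ 2 - ‖x - x₀‖ ^ 2)) ^ 2) ≤ ENNReal.ofReal b := by
  have hi := hφ.integrable_sq_mul_hardyWeight
  rw [← ofReal_integral_eq_lintegral_ofReal hi.restrict
    (Eventually.of_forall fun x => by positivity)]
  refine ENNReal.ofReal_le_ofReal (le_trans (setIntegral_le_integral hi
    (Eventually.of_forall fun x => by positivity)) ((hardy hn hφ).trans hb))

/-- Quantitative positivity in the ball. -/
lemma SobolevH1.lintegral_poissonBarrier_sub_le (hn : 1 ≤ n) (hΩ : IsOpen Ω)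
    (hQ : IsWeight Ω Q Qmax) (hu : u.Nonneg)
    (hR : 0 < R) (hball : Metric.closedBall x₀ R ⊆ Ω) {τ : ℝ} (hτ : 0 ≤ τ)
    (hGτ : 2 * (∫ x in Metric.ball x₀ R, ∑ j, u.grad i x j ^ 2) < τ ^ 2)
    (hmin : ∀ φ (hφ : IsTest (Metric.ball x₀ R) φ), (∀ x, 0 ≤ φ x) →
      ∫ x, ∑ j, pd j φ x ^ 2 ≤ τ ^ 2 →
      SobolevH1.energy Q u ≤ SobolevH1.energy Q
        (u.addComp i (hφ.mono (Metric.ball_subset_closedBall.trans hball)).isH10))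
    {M : ℝ} (hM : ∀ᶠ ε in 𝓝[>] (0 : ℝ), M ≤
      sphereMean (moll ε (Ω.indicator fun x => u.toFun x i)) x₀ R) :
    ∫⁻ x in Metric.ball x₀ R, ENNReal.ofReal
      ((max (poissonBarrier x₀ R M x - u.toFun x i) 0) ^ 2 *
        (R / (R ^ 2 - ‖x - x₀‖ ^ 2)) ^ 2) ≤
      ENNReal.ofReal (Qmax ^ 2 * ∫ x in Metric.ball x₀ R, (1 - u.posIndicator x)) := by
  set B := Metric.ball x₀ R with hB
  set f : Euc n → ℝ := fun x => u.toFun x i with hf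
  set F := Ω.indicator f with hFdef
  set Z := ∫ x in B, (1 - u.posIndicator x) with hZ
  set W : Euc n → ℝ := fun x => (R / (R ^ 2 - ‖x - x₀‖ ^ 2)) ^ 2 with hW
  have hBΩ : B ⊆ Ω := Metric.ball_subset_closedBall.trans hball
  have hf2 : MemLp f 2 (volume.restrict Ω) := u.memLp_coord i
  have hF2 : MemLp F 2 := memLp_ext hΩ hf2
  have hFloc := locallyIntegrable_of_memLp_two hF2
  have hF0 : ∀ᵐ x, 0 ≤ F x := by
    have := (ae_restrict_iff' hΩ.measurableSet).1 (hu i)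
    filter_upwards [this] with x hx
    by_cases h : x ∈ Ω
    · simp only [hFdef, indicator_of_mem h]; exact hx h
    · simp [hFdef, h]
  obtain ⟨η, hη, hηΩ⟩ := exists_closedBall_subset hΩ hR.le hball
  obtain ⟨s, hs, hs0, hsae⟩ := exists_seq_tendsto_zero_ae hF2
  set e : ℕ → ℝ := fun k => ∫ x in B, ∑ j, (u.grad i x j - pd j (moll (s k) F) x) ^ 2 with he
  have hse : ∀ᶠ k in atTop, s k < η :=
    (tendsto_nhds_of_tendsto_nhdsWithin hs).eventually_lt_const hη
  -- For scales below `η` the gradient of the mollification is the mollified gradient on the whole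
  -- ball, so `L²` convergence of mollifications applies.
  have he0 : Tendsto e atTop (𝓝 0) := by
    have hj : ∀ j, Tendsto (fun k => ∫ x in B, (moll (s k)
        (Ω.indicator fun y => u.grad i y j) x - Ω.indicator (fun y => u.grad i y j) x) ^ 2)
        atTop (𝓝 0) := fun j => by
      have hm := memLp_ext hΩ (u.memLp_grad_coord i j)
      refine tendsto_integral_sq_of_tendsto_eLpNorm (fun k => ?_) ?_
      · exact ((contDiff_moll (hs0 k) (locallyIntegrable_of_memLp_two
          hm)).continuous.aestronglyMeasurable.sub hm.1).restrict
      · refine tendsto_of_tendsto_of_tendsto_of_le_of_le tendsto_const_nhds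
          ((tendsto_eLpNorm_moll_sub hm).comp hs) (fun _ => zero_le) fun k => ?_
        exact eLpNorm_mono_measure _ Measure.restrict_le_self
    have hsum := tendsto_finsetSum Finset.univ fun j _ => hj j
    rw [Finset.sum_const_zero] at hsum
    refine hsum.congr' ?_
    filter_upwards [hse] with k hk
    have hm : ∀ j, MemLp (fun x => moll (s k) (Ω.indicator fun y => u.grad i y j) x -
        Ω.indicator (fun y => u.grad i y j) x) 2 (volume.restrict B) := fun j => by
      have hm := memLp_ext hΩ (u.memLp_grad_coord i j)
      exact ((contDiff_moll (hs0 k) (locallyIntegrable_of_memLp_two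
        hm)).continuous.memLp_ball).sub (hm.restrict B)
    rw [he, ← integral_finsetSum _ fun j _ => (hm j).integrable_sq]
    refine setIntegral_congr_fun measurableSet_ball fun x hx => ?_
    refine Finset.sum_congr rfl fun j _ => ?_
    have hxk : Metric.closedBall x (s k) ⊆ Ω := by
      refine (Metric.closedBall_subset_closedBall' ?_).trans hηΩ
      have := Metric.mem_ball.1 hx
      linarith
    rw [pd_moll hΩ hf2 (u.isWeakGradient i) (hs0 k) hxk j, indicator_of_mem (hBΩ hx)]
    ring
  set δ : ℕ → ℝ := fun k => 1 / ((k : ℝ) + 1) with hδ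
  have hδ0 : ∀ k, 0 < δ k := fun k => Nat.one_div_pos_of_nat
  have hδlim : Tendsto δ atTop (𝓝 0) := tendsto_one_div_add_atTop_nhds_zero_nat
  set b : ℕ → ℝ := fun k => 2 * (Real.sqrt (e k) * τ) + Qmax ^ 2 * Z with hb
  have hblim : Tendsto b atTop (𝓝 (Qmax ^ 2 * Z)) := by
    have := (((Real.continuous_sqrt.tendsto 0).comp he0).mul_const τ).const_mul 2
    simpa [hb] using this.add_const (Qmax ^ 2 * Z)
  set H : ℕ → Euc n → ℝ := fun k x =>
    (max (poissonBarrier x₀ R M x - moll (s k) F x - 2 * δ k) 0) ^ 2 * W x with hH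
  have hbc : Continuous (poissonBarrier x₀ R M) := by unfold poissonBarrier; fun_prop
  have hbound : ∀ᶠ k in atTop, ∫⁻ x in B, ENNReal.ofReal (H k x) ≤ ENNReal.ofReal (b k) := by
    have c1 : ∀ᶠ k in atTop, 2 * (∫ x in B, ∑ j, u.grad i x j ^ 2) + 2 * e k ≤ τ ^ 2 := by
      have : Tendsto (fun k => 2 * (∫ x in B, ∑ j, u.grad i x j ^ 2) + 2 * e k) atTop
          (𝓝 (2 * (∫ x in B, ∑ j, u.grad i x j ^ 2) + 2 * 0)) := (he0.const_mul 2).const_add _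
      exact (this.eventually_lt_const (by linarith)).mono fun k hk => hk.le
    filter_upwards [c1, hs.eventually hM] with k hk1 hk2
    have hUs := contDiff_moll (hs0 k) hFloc
    obtain ⟨φ, hφ, hφ0, hφle, hφS⟩ := u.exists_isTest_poissonInt_sub_le hn hQ hR hBΩ hτ hmin hUs
      hk1 (hδ0 k)
    -- The test function dominates `h - U - 2δ`, and `h` dominates the barrier because the spherical
    -- means of `U` are at least `M`; so `H k` lies below the Hardy integrand of `φ`.
    refine le_trans (setLIntegral_mono' measurableSet_ball fun x hx => ?_)
      (lintegral_hardy_le hn hφ hφS)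
    refine ENNReal.ofReal_le_ofReal (mul_le_mul_of_nonneg_right ?_ (sq_nonneg _))
    refine pow_le_pow_left₀ (le_max_right _ _) (max_le ?_ (hφ0 x)) 2
    have h1 := le_poissonInt hn hUs.continuous
      (fun θ => moll_nonneg (hs0 k) hF0 _) hx
    have h2 : poissonBarrier x₀ R M x ≤ poissonInt (moll (s k) F) x₀ R x := by
      refine le_trans (mul_le_mul_of_nonneg_left hk2 ?_) h1
      exact div_nonneg (ball_sq_sub_pos hx).le (by positivity)
    linarith [hφle x hx]
  have hlim : ∀ᵐ x ∂(volume.restrict B), Tendsto (fun k => ENNReal.ofReal (H k x)) atTop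
      (𝓝 (ENNReal.ofReal ((max (poissonBarrier x₀ R M x - f x) 0) ^ 2 * W x))) := by
    filter_upwards [ae_restrict_of_ae hsae, ae_restrict_mem measurableSet_ball] with x hx hxB
    rw [hFdef, indicator_of_mem (hBΩ hxB), ← hFdef] at hx
    refine ENNReal.tendsto_ofReal (Tendsto.mul_const _ (Tendsto.pow (Tendsto.max ?_
      tendsto_const_nhds) 2))
    simpa using (tendsto_const_nhds.sub hx).sub (hδlim.const_mul 2)
  -- Fatou's lemma: only a.e. convergence along the chosen scales is at hand, and the weight `W` is
  -- singular at the sphere, so no integrability of the limit is presupposed.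
  calc ∫⁻ x in B, ENNReal.ofReal ((max (poissonBarrier x₀ R M x - f x) 0) ^ 2 * W x)
      = ∫⁻ x in B, liminf (fun k => ENNReal.ofReal (H k x)) atTop :=
        lintegral_congr_ae (hlim.mono fun x hx => hx.liminf_eq.symm)
    _ ≤ liminf (fun k => ∫⁻ x in B, ENNReal.ofReal (H k x)) atTop := by
        refine lintegral_liminf_le fun k => ENNReal.measurable_ofReal.comp ?_
        refine Measurable.mul (Measurable.pow_const ?_ 2) (measurable_hardyWeight x₀ R)
        refine Measurable.max (Measurable.sub_const (Measurable.sub hbc.measurable ?_) _)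
          measurable_const
        exact (contDiff_moll (hs0 k) hFloc).continuous.measurable
    _ ≤ liminf (fun k => ENNReal.ofReal (b k)) atTop := liminf_le_liminf hbound
    _ = _ := (ENNReal.tendsto_ofReal hblim).liminf_eq

/-- Either the spherical mean is controlled by the radius, or the component stays above the
barrier. -/
lemma SobolevH1.le_or_ae_poissonBarrier_le (hQ0 : 0 ≤ Qmax) (hR : 0 < R) (hBΩ : Metric.ball x₀ R ⊆ Ω) {M : ℝ} (hM : 0 ≤ M)
    (h : ∫⁻ x in Metric.ball x₀ R, ENNReal.ofReal
      ((max (poissonBarrier x₀ R M x - u.toFun x i) 0) ^ 2 *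
        (R / (R ^ 2 - ‖x - x₀‖ ^ 2)) ^ 2) ≤
      ENNReal.ofReal (Qmax ^ 2 * ∫ x in Metric.ball x₀ R, (1 - u.posIndicator x))) :
    M ≤ 2 ^ n * Qmax * R ∨
      ∀ᵐ x ∂(volume.restrict (Metric.ball x₀ R)), poissonBarrier x₀ R M x ≤ u.toFun x i := by
  classical
  set B := Metric.ball x₀ R with hB
  set Z := ∫ x in B, (1 - u.posIndicator x) with hZ
  have hi : Integrable (fun x => 1 - u.posIndicator x) (volume.restrict B) :=
    u.integrable_one_sub_posIndicator.mono_measure (Measure.restrict_mono hBΩ le_rfl)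
  have h01 : ∀ x, 0 ≤ 1 - u.posIndicator x := fun x => by linarith [u.posIndicator_le_one x]
  have hZ0 : 0 ≤ Z := integral_nonneg h01
  rcases hZ0.eq_or_lt with hz | hz
  · right
    rw [← hz, mul_zero, ENNReal.ofReal_zero, nonpos_iff_eq_zero, lintegral_eq_zero_iff'] at h
    · filter_upwards [h, ae_restrict_mem measurableSet_ball] with x hx hxB
      have hx : ENNReal.ofReal _ = 0 := hx
      rw [ENNReal.ofReal_eq_zero] at hx
      have hW : 0 < (R / (R ^ 2 - ‖x - x₀‖ ^ 2)) ^ 2 := by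
        have := ball_sq_sub_pos hxB
        positivity
      by_contra hc
      have : 0 < max (poissonBarrier x₀ R M x - u.toFun x i) 0 :=
        lt_max_of_lt_left (by linarith)
      have : 0 < (max (poissonBarrier x₀ R M x - u.toFun x i) 0) ^ 2 *
        (R / (R ^ 2 - ‖x - x₀‖ ^ 2)) ^ 2 := by positivity
      linarith
    · refine ENNReal.measurable_ofReal.comp_aemeasurable ?_
      refine AEMeasurable.mul (AEMeasurable.pow_const ?_ 2)
        (measurable_hardyWeight x₀ R).aemeasurable
      refine AEMeasurable.max (AEMeasurable.sub ?_ ?_) aemeasurable_const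
      · exact Continuous.aemeasurable (by unfold poissonBarrier; fun_prop)
      · exact (u.memLp_coord i).1.aemeasurable.mono_measure (Measure.restrict_mono hBΩ le_rfl)
  · left
    -- Where `u = 0`, barrier times `R / (R² - |x - x₀|²)` equals exactly `M / (2ⁿR)`: the boundary
    -- decay of the barrier cancels the singularity of the Hardy weight.
    have h1 : ENNReal.ofReal ((M / (2 ^ n * R)) ^ 2 * Z) ≤ ENNReal.ofReal (Qmax ^ 2 * Z) := by
      refine le_trans ?_ h
      rw [hZ, ← integral_const_mul, ofReal_integral_eq_lintegral_ofReal (hi.const_mul _)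
        (Eventually.of_forall fun x => mul_nonneg (sq_nonneg _) (h01 x))]
      refine setLIntegral_mono' measurableSet_ball fun x hx => ENNReal.ofReal_le_ofReal ?_
      have hD := ball_sq_sub_pos hx
      rw [SobolevH1.posIndicator_eq]
      split_ifs with hux
      · have hb : 0 ≤ poissonBarrier x₀ R M x := by unfold poissonBarrier; positivity
        rw [hux, PiLp.zero_apply, sub_zero, sub_zero, max_eq_left hb, poissonBarrier]
        refine le_of_eq ?_
        field_simp
      · rw [sub_self, mul_zero]; positivity
    rw [ENNReal.ofReal_le_ofReal_iff (by positivity)] at h1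
    have h2 := le_of_mul_le_mul_right h1 hz
    have h3 := (pow_le_pow_iff_left₀ (by positivity) hQ0 two_ne_zero).1 h2
    rw [div_le_iff₀ (by positivity)] at h3
    linarith

end Dichotomy
end

/-! ### Minimality against competitors supported in balls. -/

noncomputable section

section SmallBalls

variable {n m : ℕ} {Ω : Set (Euc n)} {Q : Euc n → ℝ} {u g : SobolevH1 Ω m} {i : Fin m}
  {x₀ : Euc n} {R : ℝ}

/-- Raising the `i`-th component of `u` by a test function in the ball `B_R(x₀)` with small
Dirichlet integral does not decrease the energy; here small refers to a level exceeding twice the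
Dirichlet integral of that component. -/
def SobolevH1.MinimizesAbove (Q : Euc n → ℝ) (u : SobolevH1 Ω m) (i : Fin m) (x₀ : Euc n)
    (R : ℝ) : Prop :=
  ∃ τ : ℝ, 0 ≤ τ ∧ 2 * (∫ x in Metric.ball x₀ R, ∑ j, u.grad i x j ^ 2) < τ ^ 2 ∧
    ∀ (hsub : Metric.ball x₀ R ⊆ Ω) φ (hφ : IsTest (Metric.ball x₀ R) φ), (∀ x, 0 ≤ φ x) →
      ∫ x, ∑ j, pd j φ x ^ 2 ≤ τ ^ 2 →
      SobolevH1.energy Q u ≤ SobolevH1.energy Q (u.addComp i (hφ.mono hsub).isH10)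

lemma SobolevH1.IsAbsoluteMinimizer.minimizesAbove (hu : SobolevH1.IsAbsoluteMinimizer Q g u)
    (i : Fin m) (x₀ : Euc n) (R : ℝ) : u.MinimizesAbove Q i x₀ R := by
  set D := 2 * (∫ x in Metric.ball x₀ R, ∑ j, u.grad i x j ^ 2) with hD
  -- Any level whose square exceeds `D` will do, since absolute minimality has no smallness
  -- restriction.
  refine ⟨|D| + 1, by positivity, ?_, fun hsub φ hφ hφ0 _ => ?_⟩
  · nlinarith [le_abs_self D, abs_nonneg D]
  · exact hu.2 _ ⟨SobolevH1.addComp_eqOnBoundary hu.1.1 i _,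
      SobolevH1.addComp_nonneg hu.1.2 hφ0 _⟩

lemma SobolevH1.IsAbsoluteMinimizer.isLocalMinimizer
    (hu : SobolevH1.IsAbsoluteMinimizer Q g u) : SobolevH1.IsLocalMinimizer Q g u :=
  ⟨hu.1, 1, one_pos, fun v hv _ => hu.2 v hv⟩

/-- Poincaré's inequality for test functions in a ball. -/
lemma IsTest.integral_sq_le (hn : 1 ≤ n) {φ : Euc n → ℝ}
    (hφ : IsTest (Metric.ball x₀ R) φ) :
    ∫ x, φ x ^ 2 ≤ R ^ 2 * ∫ x, ∑ j, _root_.pd j φ x ^ 2 := by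
  refine le_trans ?_ (mul_le_mul_of_nonneg_left (hardy hn hφ) (sq_nonneg R))
  rw [← integral_const_mul]
  refine integral_mono (hφ.memLp 2).integrable_sq
    (hφ.integrable_sq_mul_hardyWeight.const_mul _) fun x => ?_
  by_cases hx : x ∈ Metric.ball x₀ R
  · have hD := ball_sq_sub_pos hx
    have h1 : 1 ≤ R ^ 2 * (R / (R ^ 2 - ‖x - x₀‖ ^ 2)) ^ 2 := by
      rw [div_pow, mul_div_assoc', le_div_iff₀ (by positivity), one_mul,
        show R ^ 2 * R ^ 2 = (R ^ 2) ^ 2 by ring]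
      exact pow_le_pow_left₀ hD.le (by linarith [sq_nonneg ‖x - x₀‖]) 2
    calc φ x ^ 2 = φ x ^ 2 * 1 := (mul_one _).symm
      _ ≤ φ x ^ 2 * (R ^ 2 * (R / (R ^ 2 - ‖x - x₀‖ ^ 2)) ^ 2) :=
        mul_le_mul_of_nonneg_left h1 (sq_nonneg _)
      _ = _ := by ring
  · simp [hφ.eq_zero hx]

lemma tendsto_volume_ball_zero (hn : 1 ≤ n) :
    Tendsto (fun R : ℝ => volume (Metric.ball (0 : Euc n) R)) (𝓝[>] 0) (𝓝 0) := by
  have h1 : Tendsto (fun R : ℝ => ENNReal.ofReal (R ^ n) * volume (Metric.ball (0 : Euc n) 1))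
      (𝓝[>] 0) (𝓝 (ENNReal.ofReal (0 ^ n) * volume (Metric.ball (0 : Euc n) 1))) := by
    refine ENNReal.Tendsto.mul_const (ENNReal.tendsto_ofReal ?_)
      (Or.inr measure_ball_lt_top.ne)
    exact ((continuous_pow n).tendsto 0).mono_left nhdsWithin_le_nhds
  rw [zero_pow (by omega), ENNReal.ofReal_zero, zero_mul] at h1
  refine h1.congr' ?_
  filter_upwards [self_mem_nhdsWithin] with R hR
  have : Nonempty (Fin n) := ⟨⟨0, hn⟩⟩
  have : Nontrivial (Euc n) := inferInstance
  rw [Measure.addHaar_ball _ _ (le_of_lt hR), finrank_euclideanSpace_fin]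

/-- Absolute continuity of the integral, uniform in the centre because the volume of a ball depends
only on its radius. The uniformity makes `r₀` independent of the ball. -/
lemma eventually_setIntegral_ball_lt (hn : 1 ≤ n) {h : Euc n → ℝ}
    (hh : Integrable h (volume.restrict Ω)) {c : ℝ} (hc : 0 < c) :
    ∀ᶠ R in 𝓝[>] (0 : ℝ), ∀ x, Metric.ball x R ⊆ Ω → ∫ y in Metric.ball x R, h y < c := by
  -- Pulling the filter back along the radius leaves the centre unconstrained, which encodes
  -- uniformity.
  have hlim : Tendsto (fun p : Euc n × ℝ => (volume.restrict Ω) (Metric.ball p.1 p.2))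
      (comap Prod.snd (𝓝[>] 0)) (𝓝 0) := by
    refine tendsto_of_tendsto_of_tendsto_of_le_of_le tendsto_const_nhds
      ((tendsto_volume_ball_zero hn).comp tendsto_comap) (fun _ => zero_le) fun p => ?_
    refine (Measure.restrict_le_self _).trans ?_
    rw [Measure.addHaar_ball_center]; rfl
  have h2 := (hh.tendsto_setIntegral_nhds_zero hlim).eventually_lt_const hc
  rw [eventually_comap] at h2
  filter_upwards [h2] with R hR x hx
  have := hR (x, R) rfl
  rwa [Measure.restrict_restrict measurableSet_ball, inter_eq_left.2 hx] at this

/-- In a small ball each part of the distance to the competitor is small: the gradient part by the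
level `τ`, the function part by Poincaré, the indicator part by the volume of the ball. -/
lemma SobolevH1.IsLocalMinimizer.eventually_minimizesAbove (hn : 1 ≤ n)
    [IsFiniteMeasure (volume.restrict Ω)]
    (hu : SobolevH1.IsLocalMinimizer Q g u) (i : Fin m) :
    ∀ᶠ R in 𝓝[>] (0 : ℝ), ∀ x₀, Metric.ball x₀ R ⊆ Ω → u.MinimizesAbove Q i x₀ R := by
  classical
  obtain ⟨⟨hb, hn0⟩, ε, hε, hmin⟩ := hu
  have iG : Integrable (fun x => ∑ j, u.grad i x j ^ 2) (volume.restrict Ω) :=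
    integrable_finsetSum _ fun j _ => (u.memLp_grad_coord i j).integrable_sq
  -- The level is `τ = ε / 4`. With `R < 1`, Poincaré makes the squared `H¹` distance at most `2 (ε
  -- / 4)²`, whose root is at most `ε / 2`; the indicators use up less than the other `ε / 2`.
  have c1 := eventually_setIntegral_ball_lt hn iG (c := (ε / 4) ^ 2 / 2) (by positivity)
  have c2 := eventually_setIntegral_ball_lt hn (Ω := Ω) (integrable_const (1 : ℝ))
    (c := ε / 2) (by positivity)
  have c3 : ∀ᶠ R in 𝓝[>] (0 : ℝ), R < 1 :=
    (tendsto_id.mono_left nhdsWithin_le_nhds).eventually_lt_const one_pos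
  filter_upwards [c1, c2, c3, self_mem_nhdsWithin] with R h1 h2 h3 h4 x₀ hx₀
  have hR : 0 < R := h4
  refine ⟨ε / 4, by positivity, by linarith [h1 x₀ hx₀], fun hsub φ hφ hφ0 hS => ?_⟩
  set B := Metric.ball x₀ R with hB
  refine hmin _ ⟨SobolevH1.addComp_eqOnBoundary hb i _,
    SobolevH1.addComp_nonneg hn0 hφ0 _⟩ ?_
  rw [SobolevH1.dist_addComp]
  set v := u.addComp i (hφ.mono hsub).isH10 with hv
  have isq : Integrable fun x => ∑ j, pd j φ x ^ 2 :=
    integrable_finsetSum _ fun j _ => ((hφ.pd j).memLp 2).integrable_sq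
  have e1 : ∫ x in Ω, (φ x ^ 2 + ∑ j, pd j φ x ^ 2) ≤ 2 * (ε / 4) ^ 2 := by
    rw [integral_add (hφ.memLp 2).integrable_sq.restrict isq.restrict]
    have a1 : ∫ x in Ω, φ x ^ 2 ≤ ∫ x, φ x ^ 2 :=
      setIntegral_le_integral (hφ.memLp 2).integrable_sq
        (Eventually.of_forall fun x => sq_nonneg _)
    have a2 : ∫ x in Ω, ∑ j, pd j φ x ^ 2 ≤ ∫ x, ∑ j, pd j φ x ^ 2 :=
      setIntegral_le_integral isq
        (Eventually.of_forall fun x => Finset.sum_nonneg fun j _ => sq_nonneg _)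
    have a3 := hφ.integral_sq_le hn
    have a4 : R ^ 2 * ∫ x, ∑ j, pd j φ x ^ 2 ≤ 1 * (ε / 4) ^ 2 :=
      mul_le_mul (by nlinarith) hS
        (integral_nonneg fun x => Finset.sum_nonneg fun j _ => sq_nonneg _) zero_le_one
    linarith
  have e2 : Real.sqrt (∫ x in Ω, (φ x ^ 2 + ∑ j, pd j φ x ^ 2)) ≤ ε / 2 := by
    refine Real.sqrt_le_iff.2 ⟨by positivity, e1.trans ?_⟩
    nlinarith [sq_nonneg ε]
  have hz : ∀ x ∉ B, |u.posIndicator x - v.posIndicator x| = 0 := fun x hx => by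
    rw [SobolevH1.posIndicator_eq, SobolevH1.posIndicator_eq,
      SobolevH1.addComp_of_eq_zero u i _ (hφ.eq_zero hx), sub_self, abs_zero]
  have e3 : ∫ x in Ω, |u.posIndicator x - v.posIndicator x| < ε / 2 := by
    rw [setIntegral_eq_of_eq_zero_of_notMem hsub hz]
    refine lt_of_le_of_lt ?_ (h2 x₀ hx₀)
    refine integral_mono_of_nonneg (Eventually.of_forall fun x => abs_nonneg _)
      ((integrable_const (1 : ℝ)).mono_measure (Measure.restrict_mono hsub le_rfl))
      (Eventually.of_forall fun x => ?_)
    rw [abs_le]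
    constructor <;> linarith [u.posIndicator_nonneg x, u.posIndicator_le_one x,
      v.posIndicator_nonneg x, v.posIndicator_le_one x]
  linarith

end SmallBalls
end

/-! ### The precise version and its spherical means. -/

noncomputable section

section PreciseVersion

variable {n m : ℕ} {Ω : Set (Euc n)} {Q : Euc n → ℝ} {Qmax : ℝ} {u g : SobolevH1 Ω m} {i : Fin m}

/-- The function given by the limits of the ball averages of `u`. -/
def SobolevH1.precise (u : SobolevH1 Ω m) (x : Euc n) : EuclideanSpace ℝ (Fin m) :=
  WithLp.toLp 2 fun i => limUnder (𝓝[>] (0 : ℝ)) fun ρ => ⨍ y in Metric.ball x ρ, u.toFun y i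

lemma SobolevH1.tendsto_precise (hn : 1 ≤ n) (hΩ : IsOpen Ω) (hu : u.Nonneg)
    (hsub : WeaklySubharmonic Ω fun x => u.toFun x i) {x : Euc n} (hx : x ∈ Ω) :
    Tendsto (fun ρ : ℝ => ⨍ y in Metric.ball x ρ, u.toFun y i) (𝓝[>] 0) (𝓝 (u.precise x i)) := by
  obtain ⟨c, -, hc⟩ := exists_tendsto_setAverage_ball hn hΩ (u.memLp_coord i) hsub (hu i) hx
  have : u.precise x i = c := hc.limUnder_eq
  rwa [this]

lemma SobolevH1.precise_nonneg (hn : 1 ≤ n) (hΩ : IsOpen Ω) (hu : u.Nonneg)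
    (hsub : WeaklySubharmonic Ω fun x => u.toFun x i) {x : Euc n} (hx : x ∈ Ω) :
    0 ≤ u.precise x i := by
  obtain ⟨c, h0, hc⟩ := exists_tendsto_setAverage_ball hn hΩ (u.memLp_coord i) hsub (hu i) hx
  have : u.precise x i = c := hc.limUnder_eq
  rwa [this]

lemma SobolevH1.isPreciseVersion_precise (hn : 1 ≤ n) (hΩ : IsOpen Ω) (hu : u.Nonneg)
    (hsub : ∀ i, WeaklySubharmonic Ω fun x => u.toFun x i) : u.IsPreciseVersion u.precise := by
  refine ⟨?_, fun x hx i => SobolevH1.tendsto_precise hn hΩ hu (hsub i) hx⟩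
  have h := ae_all_iff.2 fun i => ae_tendsto_setAverage_ball hn hΩ (u.memLp_coord i)
  filter_upwards [h] with x hx
  ext i
  exact (hx i).limUnder_eq

/-- Replacing `F` by a measurable representative changes no ball integral, for any centre, so the
function is Borel everywhere and not only up to null sets. -/
lemma measurable_setAverage_ball {F : Euc n → ℝ} (hF : AEStronglyMeasurable F) (ρ : ℝ) :
    Measurable fun y => ⨍ x in Metric.ball y ρ, F x := by
  have e : ∀ y, ⨍ x in Metric.ball y ρ, F x = (volume.real (Metric.ball (0 : Euc n) ρ))⁻¹ *
      ∫ x, {p : Euc n × Euc n | dist p.2 p.1 < ρ}.indicator (fun p => hF.mk F p.2) (y, x) := by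
    intro y
    rw [setAverage_eq, smul_eq_mul, Measure.real, Measure.addHaar_ball_center, ← Measure.real,
      integral_congr_ae (ae_restrict_of_ae hF.ae_eq_mk), ← integral_indicator measurableSet_ball]
    rfl
  simp only [e]
  refine Measurable.const_mul (StronglyMeasurable.measurable ?_) _
  refine StronglyMeasurable.integral_prod_right (f := fun y x =>
    {p : Euc n × Euc n | dist p.2 p.1 < ρ}.indicator (fun p => hF.mk F p.2) (y, x)) ?_
  refine StronglyMeasurable.indicator (hF.stronglyMeasurable_mk.comp_measurable measurable_snd) ?_
  exact (isOpen_lt (by fun_prop) continuous_const).measurableSet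

lemma add_smul_sphere_mem_closedBall {x : Euc n} {r : ℝ} (hr : 0 ≤ r) (θ : USphere n) :
    x + r • (θ : Euc n) ∈ Metric.closedBall x r := by
  rw [Metric.mem_closedBall, dist_eq_norm, add_sub_cancel_left, norm_smul, USphere.norm_eq, mul_one,
    Real.norm_eq_abs, abs_of_nonneg hr]

/-- A sphere is a null set, so measurability there cannot come from the a.e. class of `u`. It comes
from convergence of the Borel ball averages at every point of the sphere. -/
lemma SobolevH1.measurable_precise_sphere (hn : 1 ≤ n) (hΩ : IsOpen Ω) (hu : u.Nonneg)
    (hsub : WeaklySubharmonic Ω fun x => u.toFun x i) {x : Euc n} {r : ℝ} (hr : 0 ≤ r)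
    (hball : Metric.closedBall x r ⊆ Ω) :
    Measurable fun θ : USphere n => u.precise (x + r • (θ : Euc n)) i := by
  set F := Ω.indicator fun x => u.toFun x i with hF
  have hF2 : MemLp F 2 := memLp_ext hΩ (u.memLp_coord i)
  have hmeas : Measurable fun θ : USphere n => x + r • (θ : Euc n) :=
    Continuous.measurable (by fun_prop)
  refine measurable_of_tendsto_metrizable (f := fun (k : ℕ) (θ : USphere n) =>
    ⨍ y in Metric.ball (x + r • (θ : Euc n)) (1 / ((k : ℝ) + 1)), F y)
    (fun k => (measurable_setAverage_ball hF2.1 _).comp hmeas) ?_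
  refine tendsto_pi_nhds.2 fun θ => ?_
  have hθ := hball (add_smul_sphere_mem_closedBall hr θ)
  have hδ : Tendsto (fun k : ℕ => 1 / ((k : ℝ) + 1)) atTop (𝓝[>] 0) :=
    tendsto_nhdsWithin_iff.2 ⟨tendsto_one_div_add_atTop_nhds_zero_nat,
      Eventually.of_forall fun k => mem_Ioi.2 Nat.one_div_pos_of_nat⟩
  refine ((SobolevH1.tendsto_precise hn hΩ hu hsub hθ).comp hδ).congr' ?_
  obtain ⟨η, hη, hηΩ⟩ := Metric.isOpen_iff.1 hΩ _ hθ
  filter_upwards [(tendsto_nhds_of_tendsto_nhdsWithin hδ).eventually_lt_const hη] with k hk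
  refine average_congr ?_
  filter_upwards [ae_restrict_mem measurableSet_ball] with y hy
  rw [hF, indicator_of_mem (hηΩ (Metric.ball_subset_ball hk.le hy))]

lemma sphereMean_mono (hn : 1 ≤ n) {f₁ f₂ : Euc n → ℝ} {x : Euc n} {r₁ r₂ : ℝ}
    (h : sphInt f₁ x r₁ ≤ sphInt f₂ x r₂) : sphereMean f₁ x r₁ ≤ sphereMean f₂ x r₂ := by
  rw [sphereMean_eq, sphereMean_eq]
  exact mul_le_mul_of_nonneg_left h (inv_nonneg.2 (surf_real_univ_pos hn).le)

variable [IsFiniteMeasure (volume.restrict Ω)]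

/-- Linear growth of the spherical means away from the zero set. -/
theorem SobolevH1.sphereMean_precise_le (hn : 1 ≤ n) (hΩ : IsOpen Ω) (hQ : IsWeight Ω Q Qmax)
    (hQ0 : 0 ≤ Qmax) (hu : u.Nonneg) (hsub : WeaklySubharmonic Ω fun x => u.toFun x i)
    {x : Euc n} {r : ℝ} (hr : 0 < r) (hball : Metric.closedBall x r ⊆ Ω)
    {y : Euc n} (hy : y ∈ Metric.closedBall x r) (hy0 : u.precise y i = 0)
    (hmin : ∀ᶠ R in 𝓝[>] r, Metric.ball x R ⊆ Ω → u.MinimizesAbove Q i x R) :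
    IntegrableOnSphere (fun z => u.precise z i) x r ∧
      sphereMean (fun z => u.precise z i) x r ≤ 2 ^ n * Qmax * r := by
  set f : Euc n → ℝ := fun x => u.toFun x i with hf
  set w : Euc n → ℝ := fun z => u.precise z i with hw
  have hf2 : MemLp f 2 (volume.restrict Ω) := u.memLp_coord i
  set F := Ω.indicator f with hFdef
  have hFloc := locallyIntegrable_of_memLp_two (memLp_ext hΩ hf2)
  have hUc : ∀ {ε : ℝ}, 0 < ε → ContDiff ℝ ∞ (moll ε F) := fun hε => contDiff_moll hε hFloc
  have hUi : ∀ {ε : ℝ}, 0 < ε → Integrable (fun θ : USphere n => moll ε F (x + r • (θ : Euc n)))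
      (surf n) := fun hε => integrable_sphere_of_continuous
    ((hUc hε).continuous.comp (by fun_prop))
  obtain ⟨η, hη, hηΩ⟩ := exists_closedBall_subset hΩ hr.le hball
  have hw0 : ∀ θ : USphere n, 0 ≤ w (x + r • (θ : Euc n)) := fun θ =>
    SobolevH1.precise_nonneg hn hΩ hu hsub (hball (add_smul_sphere_mem_closedBall hr.le θ))
  have hwU : ∀ {ε : ℝ}, 0 < ε → ε ≤ η → ∀ θ : USphere n,
      w (x + r • (θ : Euc n)) ≤ moll ε F (x + r • (θ : Euc n)) := fun {ε} hε hεη θ => by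
    have hθ := add_smul_sphere_mem_closedBall (x := x) hr.le θ
    refine precise_le_moll hn hΩ hf2 hsub hε ((Metric.closedBall_subset_closedBall' ?_).trans hηΩ)
      (SobolevH1.tendsto_precise hn hΩ hu hsub (hball hθ))
    have := Metric.mem_closedBall.1 hθ
    linarith
  -- On the sphere `w` lies between `0` and a continuous function, the mollification at scale `η`.
  have hint : Integrable (fun θ : USphere n => w (x + r • (θ : Euc n))) (surf n) := by
    refine (hUi hη).mono' (SobolevH1.measurable_precise_sphere hn hΩ hu hsub hr.le
      hball).aestronglyMeasurable (Eventually.of_forall fun θ => ?_)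
    rw [Real.norm_eq_abs, abs_of_nonneg (hw0 θ)]
    exact hwU hη le_rfl θ
  refine ⟨hint, ?_⟩
  set M := sphereMean w x r with hM
  have hM0 : 0 ≤ M := by
    rw [hM, sphereMean_eq]
    exact mul_nonneg (inv_nonneg.2 (surf_real_univ_pos hn).le) (integral_nonneg hw0)
  -- The comparison is made in a larger ball because the zero `y` may lie on `∂B_r`, where the
  -- barrier of `B_r` itself vanishes.
  have key : ∀ᶠ R in 𝓝[>] r, M ≤ 2 ^ n * Qmax * R := by
    have c1 : ∀ᶠ R in 𝓝[>] r, R < r + η / 2 :=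
      eventually_nhdsWithin_of_eventually_nhds (eventually_lt_nhds (by linarith))
    filter_upwards [hmin, c1, self_mem_nhdsWithin] with R hR1 hR2 hR3
    have hrR : r < R := hR3
    have hR : 0 < R := hr.trans hrR
    have hballR : Metric.closedBall x R ⊆ Ω :=
      (Metric.closedBall_subset_closedBall (by linarith)).trans hηΩ
    have hBΩ := Metric.ball_subset_closedBall.trans hballR
    obtain ⟨τ, hτ, hGτ, hτmin⟩ := hR1 hBΩ
    -- The mollification dominates `w` on `∂B_r`, and its spherical mean grows from radius `r` to
    -- radius `R`.
    have hMε : ∀ᶠ ε in 𝓝[>] (0 : ℝ), M ≤ sphereMean (moll ε F) x R := by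
      have d1 : ∀ᶠ ε in 𝓝[>] (0 : ℝ), ε < η / 2 :=
        eventually_nhdsWithin_of_eventually_nhds (eventually_lt_nhds (by linarith))
      filter_upwards [d1, self_mem_nhdsWithin] with ε hε1 hε2
      have hε : 0 < ε := hε2
      have hmono := monotoneOn_sphInt (x₀ := x) (R := r + η / 2) hn (hUc hε).contDiffOn
        fun z hz => by
          refine lap_moll_nonneg hΩ hf2 hsub hε
            ((Metric.closedBall_subset_closedBall' ?_).trans hηΩ)
          have := Metric.mem_ball.1 hz
          linarith
      refine sphereMean_mono hn (le_trans ?_ (hmono ⟨hr.le, by linarith⟩ ⟨hR.le, hR2⟩ hrR.le))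
      exact integral_mono hint (hUi hε) (hwU hε (by linarith))
    have hlint := u.lintegral_poissonBarrier_sub_le hn hΩ hQ hu hR hballR hτ hGτ
      (hτmin hBΩ) hMε
    rcases u.le_or_ae_poissonBarrier_le hQ0 hR hBΩ hM0 hlint with h | h
    · exact h
    · set ρ₀ := (R - r) / 2 with hρ₀
      have hρ₀0 : 0 < ρ₀ := by rw [hρ₀]; linarith
      -- A lower bound for the barrier on the ball of radius `(R + r) / 2`, which contains the balls
      -- of radius at most `ρ₀` around `y`. The averages of `uᵢ` over small balls at `y` are thus at
      -- least `c`, yet tend to `0`.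
      set c := (R ^ 2 - ((R + r) / 2) ^ 2) / (2 ^ n * R ^ 2) * M with hc
      have hD : 0 < R ^ 2 - ((R + r) / 2) ^ 2 := by nlinarith
      have hsubρ : ∀ ρ ≤ ρ₀, Metric.ball y ρ ⊆ Metric.ball x ((R + r) / 2) := fun ρ hρ => by
        refine Metric.ball_subset_ball' ?_
        have := Metric.mem_closedBall.1 hy
        rw [hρ₀] at hρ
        linarith
      have hBR : Metric.ball x ((R + r) / 2) ⊆ Metric.ball x R :=
        Metric.ball_subset_ball (by linarith)
      have hc0 : c ≤ 0 := by
        rw [← hy0]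
        refine ge_of_tendsto (SobolevH1.tendsto_precise hn hΩ hu hsub (hball hy)) ?_
        have d1 : ∀ᶠ ρ in 𝓝[>] (0 : ℝ), ρ < ρ₀ :=
          (tendsto_id.mono_left nhdsWithin_le_nhds).eventually_lt_const hρ₀0
        filter_upwards [d1, self_mem_nhdsWithin] with ρ hρ1 hρ2
        have hρ : 0 < ρ := hρ2
        have hs := hsubρ ρ hρ1.le
        rw [setAverage_eq, smul_eq_mul, ← div_eq_inv_mul]
        have hv : 0 < volume.real (Metric.ball y ρ) :=
          ENNReal.toReal_pos (Metric.measure_ball_pos volume y hρ).ne' measure_ball_lt_top.ne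
        rw [le_div_iff₀ hv, mul_comm, ← smul_eq_mul, ← setIntegral_const]
        refine setIntegral_mono_on_ae ?_ ?_ measurableSet_ball ?_
        · exact integrableOn_const measure_ball_lt_top.ne
        · exact (hf2.integrable one_le_two).mono_measure
            (Measure.restrict_mono ((hs.trans hBR).trans hBΩ) le_rfl)
        · have h' := (ae_restrict_iff' measurableSet_ball).1 h
          filter_upwards [h'] with z hz hzρ
          have hzB := hs hzρ
          refine le_trans ?_ (hz (hBR hzB))
          rw [hc, poissonBarrier]
          refine mul_le_mul_of_nonneg_right ?_ hM0
          refine div_le_div_of_nonneg_right ?_ (by positivity)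
          rw [Metric.mem_ball, dist_eq_norm] at hzB
          have := pow_le_pow_left₀ (norm_nonneg _) hzB.le 2
          linarith
      have hM' : M ≤ 0 := by
        by_contra hcon
        have : 0 < c := by
          have : 0 < M := not_le.1 hcon
          positivity
        linarith
      exact hM'.trans (by positivity)
  have hlim : Tendsto (fun R : ℝ => 2 ^ n * Qmax * R) (𝓝[>] r) (𝓝 (2 ^ n * Qmax * r)) :=
    ((continuous_const.mul continuous_id).tendsto r).mono_left nhdsWithin_le_nhds
  exact ge_of_tendsto hlim key

end PreciseVersion
end

/-! ### The theorem for absolute and local minimizers. -/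

theorem mainTheorem2 (n : ℕ) (hn : 1 ≤ n) :
    ∃ C : ℝ, 0 < C ∧
      ∀ (m : ℕ) (_ : 1 ≤ m) (Ω : Set (EuclideanSpace ℝ (Fin n))),
        IsOpen Ω → IsConnected Ω → Bornology.IsBounded Ω →
      ∀ (Q : EuclideanSpace ℝ (Fin n) → ℝ) (Qmin Qmax : ℝ),
        AEMeasurable Q (volume.restrict Ω) → 0 < Qmin → Qmin ≤ Qmax →
        (∀ᵐ x ∂(volume.restrict Ω), Qmin ≤ Q x ∧ Q x ≤ Qmax) →
      ∀ g : SobolevH1 Ω m, g.Nonneg →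
      ∀ u : SobolevH1 Ω m,
        (SobolevH1.IsAbsoluteMinimizer Q g u →
          ∃ w, u.IsPreciseVersion w ∧
            ∀ (x : EuclideanSpace ℝ (Fin n)) (r : ℝ), 0 < r →
              closure (Metric.ball x r) ⊆ Ω →
              (closure (Metric.ball x r) ∩ {y | ‖w y‖ = 0}).Nonempty →
              ∀ i : Fin m, IntegrableOnSphere (fun y => w y i) x r ∧
                sphereMean (fun y => w y i) x r ≤ C * Qmax * r) ∧
        (SobolevH1.IsLocalMinimizer Q g u →
          ∃ w, u.IsPreciseVersion w ∧
            ∃ r₀ : ℝ, 0 < r₀ ∧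
            ∀ (x : EuclideanSpace ℝ (Fin n)) (r : ℝ), 0 < r → r < r₀ →
              closure (Metric.ball x r) ⊆ Ω →
              (closure (Metric.ball x r) ∩ {y | ‖w y‖ = 0}).Nonempty →
              ∀ i : Fin m, IntegrableOnSphere (fun y => w y i) x r ∧
                sphereMean (fun y => w y i) x r ≤ C * Qmax * r) := by
  -- The constant comes from the lower bound `le_poissonInt` for the Poisson integral; Hardy's
  -- inequality enters with constant one.
  refine ⟨2 ^ n, by positivity, fun m _ Ω hΩ _ hbd Q Qmin Qmax hQm hQ1 hQ2 hQ3 g _ u => ?_⟩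
  have : IsFiniteMeasure (volume.restrict Ω) := ⟨by
    rw [Measure.restrict_apply_univ]; exact hbd.measure_lt_top⟩
  have hQ0 : 0 ≤ Qmax := hQ1.le.trans hQ2
  have hQ : IsWeight Ω Q Qmax := ⟨hQm, by
    filter_upwards [hQ3] with x hx using ⟨hQ1.le.trans hx.1, hx.2⟩⟩
  have hball : ∀ {x : EuclideanSpace ℝ (Fin n)} {r : ℝ}, 0 < r →
      closure (Metric.ball x r) = Metric.closedBall x r := fun hr => closure_ball _ hr.ne'
  constructor
  · intro hu
    have hu' := hu.isLocalMinimizer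
    have hsub := hu'.weaklySubharmonic hΩ hQ
    refine ⟨u.precise, SobolevH1.isPreciseVersion_precise hn hΩ hu.1.2 hsub, ?_⟩
    rintro x r hr hx ⟨y, hy, hy0⟩ i
    rw [hball hr] at hx hy
    exact SobolevH1.sphereMean_precise_le hn hΩ hQ hQ0 hu.1.2 (hsub i) hr hx hy
      (by rw [norm_eq_zero.1 hy0]; rfl)
      (Eventually.of_forall fun R _ => hu.minimizesAbove i x R)
  · intro hu
    have hsub := hu.weaklySubharmonic hΩ hQ
    refine ⟨u.precise, SobolevH1.isPreciseVersion_precise hn hΩ hu.1.2 hsub, ?_⟩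
    -- Finitely many components share one threshold `r₀`; since `r < r₀`, there is room for the
    -- larger radii `R` between `r` and `r₀`.
    have hall := eventually_all.2 fun i => hu.eventually_minimizesAbove hn i
    obtain ⟨r₀, hr₀, hsm⟩ := mem_nhdsGT_iff_exists_Ioo_subset.1 hall
    refine ⟨r₀, hr₀, ?_⟩
    rintro x r hr hrr₀ hx ⟨y, hy, hy0⟩ i
    rw [hball hr] at hx hy
    refine SobolevH1.sphereMean_precise_le hn hΩ hQ hQ0 hu.1.2 (hsub i) hr hx hy
      (by rw [norm_eq_zero.1 hy0]; rfl) ?_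
    filter_upwards [Ioo_mem_nhdsGT hrr₀] with R hR hRΩ
    exact hsm ⟨hr.trans hR.1, hR.2⟩ i x hRΩ
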